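/- **Setting.** Non-uniform PPT algorithms are families of probabilistic Boolean circuits of polynomial size (with oracle gates if an oracle is present). Let $\mathcal G$ be a group-generator scheme: for each security parameter $\lambda$ it outputs, in polynomial time from its random coins, $(\mathbb G,p,g)$, where $\mathbb G$ is (the description of) a group of prime order $p$ with $|\log_2 p-\lambda|\le 1$ and generator $g$; group elements are represented uniquely by bit strings of length polynomial in $\lambda$, and multiplication and inversion are computable by circuits of polynomial size. The *DL assumption* says that every non-uniform PPT algorithm outputs $a$ on input $(\mathbb G,p,g,g^{a})$ with negligible probability only, and the *CDH assumption* says that every non-uniform PPT algorithm outputs $g^{a_1a_2}$ on input $(\mathbb G,p,g,g^{a_1},g^{a_2})$ with negligible probability only, where $(\mathbb G,p,g)\leftarrow\mathcal G(1^\lambda)$ and $a,a_1,a_2$ are uniform in $\mathbb Z_p$. Let $\sigma=\sigma(\lambda)$ be polynomially bounded, and let $\mathtt H:\{0,1\}^*\to\{0,1\}^\sigma$ be a random oracle, to which all parties, simulators and distinguishers have access. **Protocol DQ$^{\rm MR}$-OT**, between a sender $S$ with input $\boldsymbol m=[(m_{0,0},m_{1,0}),\dots,(m_{0,z-1},m_{1,z-1})]$,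 $m_{b,t}\in\{0,1\}^\sigma$, a proxy $P_1$ with input $v\in\{0,\dots,z-1\}$, a proxy $P_2$ with empty input $\epsilon$, and a receiver $R$ with input $s\in\{0,1\}$. 1. $S$ runs $(\mathbb G,p,g)\leftarrow\mathcal G(1^\lambda)$, picks $C\in\mathbb G$ uniformly, and publishes $pk=(\mathbb G,p,g,C)$. 2. $R$ picks a uniform bit $s_1$, sets $s_2=s_1\oplus s$, picks uniform $r_1,r_2\in\mathbb Z_p$, and sends $(s_i,r_i)$ to $P_i$ for $i=1,2$. 3. $P_2$ sets $\delta_{s_2}=g^{r_2}$, $\delta_{1-s_2}=C/g^{r_2}$ and sends $(\delta_0,\delta_1)$ to $P_1$. 4. $P_1$ sets $\beta_{s_1}=\delta_0\cdot g^{r_1}$, $\beta_{1-s_1}=\delta_1/g^{r_1}$ and sends $(\beta_0,\beta_1)$ to $S$. 5. $S$ aborts if $C\ne\beta_0\beta_1$. Otherwise, for all $t\in\{0,\dots,z-1\}$ and $b\in\{0,1\}$ it picks a uniform $y_{b,t}\in\mathbb Z_p$ and sets $e_{b,t}=\big(g^{y_{b,t}},\ \mathtt H(\beta_b^{\,y_{b,t}})\oplus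 m_{b,t}\big)$; it sends all $z$ pairs $(e_{0,t},e_{1,t})$ to $P_1$. 6. $P_1$ forwards only the $v$-th pair $(e_{0,v},e_{1,v})$ to $R$ (and outputs the number $z$ of pairs it received). 7. $R$ sets $x=r_2+r_1(-1)^{s_2}$ and outputs $\mathtt H(u^{x})\oplus w$, where $(u,w)=e_{s,v}$. The view of a party consists of its input, its random choices, $pk$, and the messages it receives (for $S$ the random choices are the coins of $\mathcal G$, the element $C$, and the $y_{b,t}$; the view of $R$ also contains its output). **Theorem.** If the DL and CDH assumptions hold for $\mathcal G$ and $\mathtt H$ is a random oracle, then DQ$^{\rm MR}$-OT securely computes the functionality $$\mathcal F:(\boldsymbol m,v,\epsilon,s)\mapsto(\epsilon,z,\epsilon,m_{s,v})$$ in the presence of semi-honest, non-colluding adversaries. That is: in every execution the parties obtain the outputs prescribed by $\mathcal F$, and there are non-uniform PPT simulators $\mathrm{Sim}_S,\mathrm{Sim}_{P_1},\mathrm{Sim}_{P_2},\mathrm{Sim}_R$ (of size polynomial in $\lambda+z$ for $S$ and $P_1$, and polynomial in $\lambda$, independently of $z$, for $P_2$ and $R$) such that $$\mathrm{Sim}_S(\boldsymbol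 m,\epsilon)\stackrel{c}{\equiv}\mathrm{View}_S(\boldsymbol m,v,\epsilon,s),\qquad \mathrm{Sim}_{P_1}(v,z)\stackrel{c}{\equiv}\mathrm{View}_{P_1}(\boldsymbol m,v,\epsilon,s),$$ $$\mathrm{Sim}_{P_2}(\epsilon,\epsilon)\stackrel{c}{\equiv}\mathrm{View}_{P_2}(\boldsymbol m,v,\epsilon,s),\qquad \mathrm{Sim}_R(s,m_{s,v})\stackrel{c}{\equiv}\mathrm{View}_R(\boldsymbol m,v,\epsilon,s).$$ Here $\stackrel{c}{\equiv}$ means: for every sequence (indexed by $\lambda$) of inputs $(\boldsymbol m,v,s)$ with $z$ polynomially bounded in $\lambda$, and every non-uniform PPT distinguisher with oracle $\mathtt H$, the distinguishing advantage, over $\mathtt H$ and all coins, is negligible in $\lambda$. -/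

import Mathlib

open MeasureTheory Filter

namespace DQMROT

noncomputable section

/-- Bit strings of length `k`. -/
abbrev Bits (k : ℕ) : Type := Fin k → Bool

/-- Bitwise exclusive or. -/
def bxor {k : ℕ} (x y : Bits k) : Bits k := fun i => xor (x i) (y i)

/-- The `w` low-order binary digits of `a` (all of `a` if `a < 2 ^ w`). -/
def encNat (w a : ℕ) : Bits w := fun i => a.testBit i

/-- A hash function `{0,1}* → {0,1}^σ`. -/
abbrev Oracle (σ : ℕ) : Type := List Bool → Bits σ

/-- The law of a random oracle: the values at different strings are independent and uniform. -/
def roLaw (σ : ℕ) : Measure (Oracle σ) :=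
  Measure.infinitePi fun _ : List Bool => (PMF.uniformOfFintype (Bits σ)).toMeasure

/-! ### Probabilistic oracle circuits -/

/-- Probabilistic Boolean circuits with oracle gates for a hash function `{0,1}* → {0,1}^σ`, input
wires `ι` and output wires `κ`, written as straight-line programs. Every gate adds its output
wire(s) to the wires that are available to the gates after it:
`out` ends the circuit and selects the output wires; `const` is a constant bit; `gate` is an
arbitrary gate of fan-in two; `coin` is a fresh uniform bit; `query q` sends the bit string on the
list of wires `q` to the oracle, whose `σ` answer bits become new wires. -/
inductive Circuit (σ : ℕ) (κ : Type) : Type → Type 1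
  | out {ι : Type} (f : κ → ι) : Circuit σ κ ι
  | const {ι : Type} (b : Bool) (k : Circuit σ κ (Option ι)) : Circuit σ κ ι
  | gate {ι : Type} (f : Bool → Bool → Bool) (i j : ι) (k : Circuit σ κ (Option ι)) :
      Circuit σ κ ι
  | coin {ι : Type} (k : Circuit σ κ (Option ι)) : Circuit σ κ ι
  | query {ι : Type} (q : List ι) (k : Circuit σ κ (ι ⊕ Fin σ)) : Circuit σ κ ι

/-- Add one wire (the wire `none`) that carries the bit `b`. -/
def addWire {ι : Type} (x : ι → Bool) (b : Bool) : Option ι → Bool := fun i => i.elim b x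

/-- The distribution of the output of a circuit on input `x`, relative to the oracle `H`. -/
def Circuit.eval {σ : ℕ} {κ : Type} (H : Oracle σ) :
    {ι : Type} → Circuit σ κ ι → (ι → Bool) → PMF (κ → Bool)
  | _, .out f, x => PMF.pure fun k => x (f k)
  | _, .const b k, x => k.eval H (addWire x b)
  | _, .gate f i j k, x => k.eval H (addWire x (f (x i) (x j)))
  | _, .coin k, x => (PMF.uniformOfFintype Bool).bind fun b => k.eval H (addWire x b)
  | _, .query q k, x => k.eval H (Sum.elim x (H (q.map x)))

/-- The size of a circuit: the number of its gates, an oracle gate also counting its query wires. -/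
def Circuit.size {σ : ℕ} {κ : Type} : {ι : Type} → Circuit σ κ ι → ℕ
  | _, .out _ => 0
  | _, .const _ k => k.size + 1
  | _, .gate _ _ _ k => k.size + 1
  | _, .coin k => k.size + 1
  | _, .query q k => k.size + q.length + 1

/-- Circuits without an oracle: the answer of a `0`-bit oracle consists of no wires. -/
abbrev PlainCircuit (κ ι : Type) : Type 1 := Circuit 0 κ ι

/-- The output distribution of a circuit without an oracle. -/
def PlainCircuit.run {κ ι : Type} (c : PlainCircuit κ ι) (x : ι → Bool) : PMF (κ → Bool) :=
  Circuit.eval (fun _ => Fin.elim0) c x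

/-! ### Asymptotics -/

/-- `f` is bounded by a polynomial. -/
def PolyBounded (f : ℕ → ℕ) : Prop := ∃ P : Polynomial ℕ, ∀ n, f n ≤ P.eval n

/-- `f` is bounded by a polynomial in the sum of its two arguments. -/
def PolyBounded₂ (f : ℕ → ℕ → ℕ) : Prop := ∃ P : Polynomial ℕ, ∀ n z, f n z ≤ P.eval (n + z)

/-- `ε` is a negligible function of the security parameter. -/
def Negligible (ε : ℕ → ℝ) : Prop :=
  Asymptotics.SuperpolynomialDecay atTop (fun n : ℕ => (n : ℝ)) ε

/-! ### Group generators and the hardness assumptions -/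

/-- A group-generator scheme. With security parameter `n` and coins `ρ`, it outputs the triple
`(𝔾, p, g)`: the description `desc n ρ` of a finite group, the prime order `p` of this group, of
about `n` bits, and a generator `g`. Group elements are represented by bit strings; there are
circuits of polynomial size for the scheme itself and for the group operations. -/
structure GroupGen where
  /-- number of coins of the scheme -/
  coinLen : ℕ → ℕ
  /-- length of a group description -/
  descLen : ℕ → ℕ
  /-- length of the representation of a group element -/
  elemLen : ℕ → ℕ
  /-- the description that the scheme outputs on coins `ρ` -/
  desc : (n : ℕ) → Bits (coinLen n) → Bits (descLen n)
  /-- the group with a given description -/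
  Carrier : (n : ℕ) → Bits (descLen n) → Type
  [group : ∀ n d, CommGroup (Carrier n d)]
  [fintype : ∀ n d, Fintype (Carrier n d)]
  /-- the generator that comes with a description -/
  gen : (n : ℕ) → (d : Bits (descLen n)) → Carrier n d
  /-- the representation of the group elements -/
  enc : (n : ℕ) → (d : Bits (descLen n)) → Carrier n d → Bits (elemLen n)
  prime_card : ∀ n ρ, (Fintype.card (Carrier n (desc n ρ))).Prime
  le_card : ∀ n ρ, 2 ^ n ≤ 2 * Fintype.card (Carrier n (desc n ρ))
  card_le : ∀ n ρ, Fintype.card (Carrier n (desc n ρ)) ≤ 2 ^ (n + 1)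
  gen_generates : ∀ n ρ, Subgroup.zpowers (gen n (desc n ρ)) = ⊤
  enc_injective : ∀ n ρ, Function.Injective (enc n (desc n ρ))
  coinLen_poly : PolyBounded coinLen
  descLen_poly : PolyBounded descLen
  elemLen_poly : PolyBounded elemLen
  /-- the circuits that compute the output `(𝔾, p, g)` of the scheme from its coins -/
  genC : (n : ℕ) →
    PlainCircuit (Fin (descLen n) ⊕ Fin (n + 2) ⊕ Fin (elemLen n)) (Fin (coinLen n))
  /-- the circuits for multiplication -/
  mulC : (n : ℕ) →
    PlainCircuit (Fin (elemLen n)) (Fin (descLen n) ⊕ Fin (elemLen n) ⊕ Fin (elemLen n))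
  /-- the circuits for inversion -/
  invC : (n : ℕ) → PlainCircuit (Fin (elemLen n)) (Fin (descLen n) ⊕ Fin (elemLen n))
  genC_poly : PolyBounded fun n => (genC n).size
  mulC_poly : PolyBounded fun n => (mulC n).size
  invC_poly : PolyBounded fun n => (invC n).size
  genC_run : ∀ n ρ, (genC n).run ρ =
    PMF.pure (Sum.elim (desc n ρ) (Sum.elim
      (encNat (n + 2) (Fintype.card (Carrier n (desc n ρ))))
      (enc n (desc n ρ) (gen n (desc n ρ)))))
  mulC_run : ∀ n ρ (a b : Carrier n (desc n ρ)),
    (mulC n).run (Sum.elim (desc n ρ) (Sum.elim (enc n (desc n ρ) a) (enc n (desc n ρ) b))) =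
      PMF.pure (enc n (desc n ρ) (a * b))
  invC_run : ∀ n ρ (a : Carrier n (desc n ρ)),
    (invC n).run (Sum.elim (desc n ρ) (enc n (desc n ρ) a)) =
      PMF.pure (enc n (desc n ρ) a⁻¹)

namespace GroupGen

variable (𝒢 : GroupGen)

instance (n : ℕ) (d : Bits (𝒢.descLen n)) : CommGroup (𝒢.Carrier n d) := 𝒢.group n d

instance (n : ℕ) (d : Bits (𝒢.descLen n)) : Fintype (𝒢.Carrier n d) := 𝒢.fintype n d

/-- The group produced on coins `ρ`. -/
abbrev Grp (n : ℕ) (ρ : Bits (𝒢.coinLen n)) : Type := 𝒢.Carrier n (𝒢.desc n ρ)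

/-- The order `p` of the group. -/
abbrev ord (n : ℕ) (ρ : Bits (𝒢.coinLen n)) : ℕ := Fintype.card (𝒢.Grp n ρ)

instance (n : ℕ) (ρ : Bits (𝒢.coinLen n)) : NeZero (𝒢.ord n ρ) := ⟨Fintype.card_ne_zero⟩

/-- The generator `g` of the group. -/
abbrev g (n : ℕ) (ρ : Bits (𝒢.coinLen n)) : 𝒢.Grp n ρ := 𝒢.gen n (𝒢.desc n ρ)

/-- The representation of group elements. -/
abbrev elem {n : ℕ} {ρ : Bits (𝒢.coinLen n)} (a : 𝒢.Grp n ρ) : Bits (𝒢.elemLen n) :=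
  𝒢.enc n (𝒢.desc n ρ) a

/-- The bit string `(𝔾, p, g)`. -/
def params (n : ℕ) (ρ : Bits (𝒢.coinLen n)) :
    Fin (𝒢.descLen n) ⊕ Fin (n + 2) ⊕ Fin (𝒢.elemLen n) → Bool :=
  Sum.elim (𝒢.desc n ρ) (Sum.elim (encNat (n + 2) (𝒢.ord n ρ)) (𝒢.elem (𝒢.g n ρ)))

/-- The positions of the bits of `(𝔾, p, g)`. -/
abbrev ParamWires (n : ℕ) : Type := Fin (𝒢.descLen n) ⊕ Fin (n + 2) ⊕ Fin (𝒢.elemLen n)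

/-- The experiment in which the circuit `A` tries to compute `a` from `(𝔾, p, g, g ^ a)`; the
result `True` means success. -/
def dlGame (n : ℕ) (A : PlainCircuit (Fin (n + 2)) (𝒢.ParamWires n ⊕ Fin (𝒢.elemLen n))) :
    PMF Prop :=
  (PMF.uniformOfFintype (Bits (𝒢.coinLen n))).bind fun ρ =>
  (PMF.uniformOfFintype (ZMod (𝒢.ord n ρ))).bind fun a =>
  (A.run (Sum.elim (𝒢.params n ρ) (𝒢.elem (𝒢.g n ρ ^ a.val)))).map fun w =>
    w = encNat (n + 2) a.val

/-- The discrete logarithm assumption (against non-uniform PPT adversaries). -/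
def DLAssumption : Prop :=
  ∀ A : (n : ℕ) → PlainCircuit (Fin (n + 2)) (𝒢.ParamWires n ⊕ Fin (𝒢.elemLen n)),
    PolyBounded (fun n => (A n).size) →
      Negligible fun n => (𝒢.dlGame n (A n) True).toReal

/-- The experiment in which the circuit `A` tries to compute `g ^ (a₁ a₂)` from
`(𝔾, p, g, g ^ a₁, g ^ a₂)`. -/
def cdhGame (n : ℕ) (A : PlainCircuit (Fin (𝒢.elemLen n))
      (𝒢.ParamWires n ⊕ Fin (𝒢.elemLen n) ⊕ Fin (𝒢.elemLen n))) : PMF Prop :=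
  (PMF.uniformOfFintype (Bits (𝒢.coinLen n))).bind fun ρ =>
  (PMF.uniformOfFintype (ZMod (𝒢.ord n ρ))).bind fun a₁ =>
  (PMF.uniformOfFintype (ZMod (𝒢.ord n ρ))).bind fun a₂ =>
  (A.run (Sum.elim (𝒢.params n ρ)
    (Sum.elim (𝒢.elem (𝒢.g n ρ ^ a₁.val)) (𝒢.elem (𝒢.g n ρ ^ a₂.val))))).map fun w =>
    w = 𝒢.elem (𝒢.g n ρ ^ (a₁ * a₂).val)

/-- The computational Diffie-Hellman assumption (against non-uniform PPT adversaries). -/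
def CDHAssumption : Prop :=
  ∀ A : (n : ℕ) → PlainCircuit (Fin (𝒢.elemLen n))
      (𝒢.ParamWires n ⊕ Fin (𝒢.elemLen n) ⊕ Fin (𝒢.elemLen n)),
    PolyBounded (fun n => (A n).size) →
      Negligible fun n => (𝒢.cdhGame n (A n) True).toReal

end GroupGen

/-! ### The functionality, and what it means to realize it securely -/

/-- The sender's database of `z` pairs of `σ`-bit messages; `m t b` is `m_{b,t}`. -/
abbrev Database (σ z : ℕ) : Type := Fin z → Bool → Bits σ

/-- The outputs of the four parties. -/
structure Outputs (σ : ℕ) where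
  /-- output of the sender -/
  toS : Unit
  /-- output of the first proxy -/
  toP1 : ℕ
  /-- output of the second proxy -/
  toP2 : Unit
  /-- output of the receiver -/
  toR : Bits σ

/-- The functionality `(m, v, ε, s) ↦ (ε, z, ε, m_{s,v})`. -/
def functionality {σ z : ℕ} (m : Database σ z) (v : Fin z) (s : Bool) : Outputs σ :=
  ⟨(), z, (), m v s⟩

/-- A four-party protocol in the random oracle model, given by the distributions of the views of
the parties and of their outputs (`none` if an output is missing), on the inputs `m` of the sender,
`v` of the first proxy, `ε` of the second proxy, and `s` of the receiver. A view is a bit string,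
with one bit for each wire in a type of wires. Here `n` is the security parameter and `z` the
number of message pairs. -/
structure Protocol (σ : ℕ → ℕ) where
  WiresS : ℕ → ℕ → Type
  WiresP1 : ℕ → ℕ → Type
  WiresP2 : ℕ → Type
  WiresR : ℕ → Type
  viewS (n : ℕ) {z : ℕ} (m : Database (σ n) z) (v : Fin z) (s : Bool) (H : Oracle (σ n)) :
    PMF (WiresS n z → Bool)
  viewP1 (n : ℕ) {z : ℕ} (m : Database (σ n) z) (v : Fin z) (s : Bool) (H : Oracle (σ n)) :
    PMF (WiresP1 n z → Bool)
  viewP2 (n : ℕ) {z : ℕ} (m : Database (σ n) z) (v : Fin z) (s : Bool) (H : Oracle (σ n)) :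
    PMF (WiresP2 n → Bool)
  viewR (n : ℕ) {z : ℕ} (m : Database (σ n) z) (v : Fin z) (s : Bool) (H : Oracle (σ n)) :
    PMF (WiresR n → Bool)
  outputs (n : ℕ) {z : ℕ} (m : Database (σ n) z) (v : Fin z) (s : Bool) (H : Oracle (σ n)) :
    PMF (Option (Outputs (σ n)))

/-- The probability, over the random oracle `H`, a sample `w` of `X H`, and the coins of the
circuit `D`, that `D`, with input `w` and oracle `H`, outputs `1`. -/
def acceptProb {σ : ℕ} {ι : Type} (D : Circuit σ Unit ι) (X : Oracle σ → PMF (ι → Bool)) : ℝ :=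
  (∫⁻ H, ((X H).bind fun w => D.eval H w) (fun _ => true) ∂roLaw σ).toReal

/-- Computational indistinguishability (against non-uniform PPT distinguishers) of two ensembles of
random bit strings in the random oracle model. -/
def CompIndist {σ : ℕ → ℕ} {ι : ℕ → Type} (X Y : (n : ℕ) → Oracle (σ n) → PMF (ι n → Bool)) :
    Prop :=
  ∀ D : (n : ℕ) → Circuit (σ n) Unit (ι n), PolyBounded (fun n => (D n).size) →
    Negligible fun n => |acceptProb (D n) (X n) - acceptProb (D n) (Y n)|

/-- All the bits of a database. -/
def encDatabase {σ z : ℕ} (m : Database σ z) : Fin z × Bool × Fin σ → Bool :=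
  fun i => m i.1 i.2.1 i.2.2

/-- The binary representation of an index `v < z`. -/
def encIndex {z : ℕ} (v : Fin z) : Bits z.size := encNat z.size v

/-- A sequence of inputs of polynomial size, one for each value of the security parameter. -/
structure Inputs (σ : ℕ → ℕ) where
  z : ℕ → ℕ
  z_poly : PolyBounded z
  m : (n : ℕ) → Database (σ n) (z n)
  v : (n : ℕ) → Fin (z n)
  s : ℕ → Bool

/-- The protocol `Γ` securely computes the functionality in the presence of semi-honest,
non-colluding adversaries: the parties obtain the outputs of the functionality, and for each party
there is a non-uniform PPT simulator with access to the random oracle that produces, from the input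
and the output of this party alone, a string that is computationally indistinguishable from its
view. The simulators for the second proxy and for the receiver do not depend on `z`. -/
structure Protocol.SecurelyRealizes {σ : ℕ → ℕ} (Γ : Protocol σ) : Prop where
  correct : ∀ (n z : ℕ) (m : Database (σ n) z) (v : Fin z) (s : Bool) (H : Oracle (σ n)),
    Γ.outputs n m v s H = PMF.pure (some (functionality m v s))
  sender : ∃ Sim : (n z : ℕ) → Circuit (σ n) (Γ.WiresS n z) (Fin z × Bool × Fin (σ n)),
    PolyBounded₂ (fun n z => (Sim n z).size) ∧
    ∀ x : Inputs σ, CompIndist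
      (fun n H => (Sim n (x.z n)).eval H (encDatabase (x.m n)))
      (fun n H => Γ.viewS n (x.m n) (x.v n) (x.s n) H)
  proxy1 : ∃ Sim : (n z : ℕ) → Circuit (σ n) (Γ.WiresP1 n z) (Fin z.size),
    PolyBounded₂ (fun n z => (Sim n z).size) ∧
    ∀ x : Inputs σ, CompIndist
      (fun n H => (Sim n (functionality (x.m n) (x.v n) (x.s n)).toP1).eval H (encIndex (x.v n)))
      (fun n H => Γ.viewP1 n (x.m n) (x.v n) (x.s n) H)
  proxy2 : ∃ Sim : (n : ℕ) → Circuit (σ n) (Γ.WiresP2 n) Empty,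
    PolyBounded (fun n => (Sim n).size) ∧
    ∀ x : Inputs σ, CompIndist
      (fun n H => (Sim n).eval H Empty.elim)
      (fun n H => Γ.viewP2 n (x.m n) (x.v n) (x.s n) H)
  receiver : ∃ Sim : (n : ℕ) → Circuit (σ n) (Γ.WiresR n) (Unit ⊕ Fin (σ n)),
    PolyBounded (fun n => (Sim n).size) ∧
    ∀ x : Inputs σ, CompIndist
      (fun n H => (Sim n).eval H (Sum.elim (fun _ => x.s n)
        (functionality (x.m n) (x.v n) (x.s n)).toR))
      (fun n H => Γ.viewR n (x.m n) (x.v n) (x.s n) H)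

/-! ### The algorithms of the protocol

In this section `h` is the hash function on group elements, and pairs are indexed by `Bool`. -/

section Algorithms

variable {G : Type} [CommGroup G] {p σ z : ℕ}

/-- XOR-based two-out-of-two secret sharing of `s` with random coin `c`. -/
def share (s c : Bool) : Bool × Bool := (c, xor c s)

/-- The query `(δ₀, δ₁)` of the second proxy: `δ_{s₂} = g ^ r₂`, `δ_{1-s₂} = C / g ^ r₂`. -/
def genQuery2 (g C : G) (s₂ : Bool) (r₂ : ZMod p) (b : Bool) : G :=
  if b = s₂ then g ^ r₂.val else C / g ^ r₂.val

/-- The query `(β₀, β₁)` of the first proxy: `β_{s₁} = δ₀ g ^ r₁`, `β_{1-s₁} = δ₁ / g ^ r₁`. -/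
def genQuery1 (g : G) (s₁ : Bool) (r₁ : ZMod p) (δ : Bool → G) (b : Bool) : G :=
  if b = s₁ then δ false * g ^ r₁.val else δ true / g ^ r₁.val

open Classical in
/-- The response of the sender with coins `y`: all the pairs
`e_{b,t} = (g ^ y_{b,t}, h (β_b ^ y_{b,t}) ⊕ m_{b,t})`, or `none` (abort) if `C ≠ β₀ β₁`. -/
def genRes (h : G → Bits σ) (g C : G) (m : Database σ z) (y : Fin z → Bool → ZMod p)
    (β : Bool → G) : Option (Fin z → Bool → G × Bits σ) :=
  if C ≠ β false * β true then none
  else some fun t b => (g ^ (y t b).val, bxor (h (β b ^ (y t b).val)) (m t b))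

/-- The oblivious filtering by the first proxy: the `v`-th pair of the response. -/
def oblFilter (v : Fin z) (res : Option (Fin z → Bool → G × Bits σ)) :
    Option (Bool → G × Bits σ) :=
  res.map fun e => e v

/-- The message extraction of the receiver, with `x = r₂ + r₁ (-1) ^ s₂`. -/
def retrieve (h : G → Bits σ) (s s₂ : Bool) (r₁ r₂ : ZMod p)
    (res' : Option (Bool → G × Bits σ)) : Option (Bits σ) :=
  res'.map fun e => bxor (h ((e s).1 ^ (r₂ + r₁ * (-1) ^ s₂.toNat).val)) (e s).2

end Algorithms

/-! ### Executions and views -/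

/-- The random choices and the messages in an execution of the protocol. -/
structure Transcript (𝒢 : GroupGen) (σ : ℕ → ℕ) (n z : ℕ) where
  /-- the sender's coins for the choice of `(𝔾, p, g)` -/
  ρ : Bits (𝒢.coinLen n)
  /-- the sender's random group element -/
  C : 𝒢.Grp n ρ
  /-- the sender's random exponents -/
  y : Fin z → Bool → ZMod (𝒢.ord n ρ)
  /-- the message of the receiver to the first proxy -/
  req₁ : Bool × ZMod (𝒢.ord n ρ)
  /-- the message of the receiver to the second proxy -/
  req₂ : Bool × ZMod (𝒢.ord n ρ)
  /-- the message of the second proxy to the first -/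
  q₂ : Bool → 𝒢.Grp n ρ
  /-- the message of the first proxy to the sender -/
  q₁ : Bool → 𝒢.Grp n ρ
  /-- the message of the sender to the first proxy -/
  res : Option (Fin z → Bool → 𝒢.Grp n ρ × Bits (σ n))
  /-- the message of the first proxy to the receiver -/
  res' : Option (Bool → 𝒢.Grp n ρ × Bits (σ n))
  /-- the output of the receiver -/
  out : Option (Bits (σ n))

/-- The transcript that is determined by the inputs, the hash function, and the random choices
`ρ, C, y` of the sender and `c, r₁, r₂` of the receiver. -/
def transcript (𝒢 : GroupGen) (σ : ℕ → ℕ) (n : ℕ) {z : ℕ} (m : Database (σ n) z) (v : Fin z)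
    (s : Bool) (H : Oracle (σ n)) (ρ : Bits (𝒢.coinLen n)) (C : 𝒢.Grp n ρ)
    (y : Fin z → Bool → ZMod (𝒢.ord n ρ)) (c : Bool) (r₁ r₂ : ZMod (𝒢.ord n ρ)) :
    Transcript 𝒢 σ n z :=
  let h : 𝒢.Grp n ρ → Bits (σ n) := fun a => H (List.ofFn (𝒢.elem a))
  let s₁ := (share s c).1
  let s₂ := (share s c).2
  let δ := genQuery2 (𝒢.g n ρ) C s₂ r₂
  let β := genQuery1 (𝒢.g n ρ) s₁ r₁ δ
  let res := genRes h (𝒢.g n ρ) C m y β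
  let res' := oblFilter v res
  { ρ := ρ, C := C, y := y, req₁ := (s₁, r₁), req₂ := (s₂, r₂), q₂ := δ, q₁ := β,
    res := res, res' := res', out := retrieve h s s₂ r₁ r₂ res' }

/-- A random execution of the protocol, relative to the hash function `H`. -/
def execution (𝒢 : GroupGen) (σ : ℕ → ℕ) (n : ℕ) {z : ℕ} (m : Database (σ n) z) (v : Fin z)
    (s : Bool) (H : Oracle (σ n)) : PMF (Transcript 𝒢 σ n z) :=
  (PMF.uniformOfFintype (Bits (𝒢.coinLen n))).bind fun ρ =>
  (PMF.uniformOfFintype (𝒢.Grp n ρ)).bind fun C =>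
  (PMF.uniformOfFintype Bool).bind fun c =>
  (PMF.uniformOfFintype (ZMod (𝒢.ord n ρ))).bind fun r₁ =>
  (PMF.uniformOfFintype (ZMod (𝒢.ord n ρ))).bind fun r₂ =>
  (PMF.uniformOfFintype (Fin z → Bool → ZMod (𝒢.ord n ρ))).map fun y =>
    transcript 𝒢 σ n m v s H ρ C y c r₁ r₂

/-- The bits of an optional value: a flag (the wire `none`), followed by the bits of the value if
there is one, and by zeros otherwise. -/
def encOption {α ι : Type} (e : α → ι → Bool) (a : Option α) : Option ι → Bool
  | none => a.isSome
  | some i => a.elim false fun x => e x i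

namespace Transcript

variable {𝒢 : GroupGen} {σ : ℕ → ℕ} {n z : ℕ}

/-- The positions of the bits of the public key `pk = (𝔾, p, g, C)`. -/
abbrev PkWires (𝒢 : GroupGen) (n : ℕ) : Type := 𝒢.ParamWires n ⊕ Fin (𝒢.elemLen n)

/-- The public key `pk = (𝔾, p, g, C)`. -/
def pk (τ : Transcript 𝒢 σ n z) : PkWires 𝒢 n → Bool :=
  Sum.elim (𝒢.params n τ.ρ) (𝒢.elem τ.C)

/-- The positions of the bits of a pair of group elements. -/
abbrev QueryWires (𝒢 : GroupGen) (n : ℕ) : Type := Bool × Fin (𝒢.elemLen n)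

/-- The bits of a pair of group elements. -/
def encQuery {ρ : Bits (𝒢.coinLen n)} (q : Bool → 𝒢.Grp n ρ) : QueryWires 𝒢 n → Bool :=
  fun i => 𝒢.elem (q i.1) i.2

/-- The positions of the bits of a request `(s_i, r_i)`. -/
abbrev ReqWires (n : ℕ) : Type := Unit ⊕ Fin (n + 2)

/-- The bits of a request `(s_i, r_i)`. -/
def encReq {p : ℕ} (r : Bool × ZMod p) : ReqWires n → Bool :=
  Sum.elim (fun _ => r.1) (encNat (n + 2) r.2.val)

/-- The positions of the bits of a pair `(e_{0,t}, e_{1,t})`. -/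
abbrev PairWires (𝒢 : GroupGen) (σ : ℕ → ℕ) (n : ℕ) : Type :=
  Bool × (Fin (𝒢.elemLen n) ⊕ Fin (σ n))

/-- The bits of a pair `(e_{0,t}, e_{1,t})`. -/
def encPair {ρ : Bits (𝒢.coinLen n)} (e : Bool → 𝒢.Grp n ρ × Bits (σ n)) :
    PairWires 𝒢 σ n → Bool :=
  fun i => Sum.elim (𝒢.elem (e i.1).1) (e i.1).2 i.2

/-- The view of the sender: its input `m`, its coins `(ρ, C, y)`, the public key, and the message
`(β₀, β₁)`. -/
def viewS (m : Database (σ n) z) (τ : Transcript 𝒢 σ n z) :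
    ((Fin z × Bool × Fin (σ n)) ⊕ Fin (𝒢.coinLen n) ⊕ PkWires 𝒢 n ⊕
      (Fin z × Bool × Fin (n + 2)) ⊕ QueryWires 𝒢 n) → Bool :=
  Sum.elim (encDatabase m) <| Sum.elim τ.ρ <| Sum.elim τ.pk <|
    Sum.elim (fun i => encNat (n + 2) (τ.y i.1 i.2.1).val i.2.2) (encQuery τ.q₁)

/-- The view of the first proxy: its input `v`, the public key, and the messages `(s₁, r₁)`,
`(δ₀, δ₁)` and `(e_{0,0}, e_{1,0}), …, (e_{0,z-1}, e_{1,z-1})`. -/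
def viewP1 (v : Fin z) (τ : Transcript 𝒢 σ n z) :
    (Fin z.size ⊕ PkWires 𝒢 n ⊕ ReqWires n ⊕ QueryWires 𝒢 n ⊕
      Option (Fin z × PairWires 𝒢 σ n)) → Bool :=
  Sum.elim (encIndex v) <| Sum.elim τ.pk <| Sum.elim (encReq τ.req₁) <|
    Sum.elim (encQuery τ.q₂) (encOption (fun e i => encPair (e i.1) i.2) τ.res)

/-- The view of the second proxy: the public key and the message `(s₂, r₂)`. -/
def viewP2 (τ : Transcript 𝒢 σ n z) : (PkWires 𝒢 n ⊕ ReqWires n) → Bool :=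
  Sum.elim τ.pk (encReq τ.req₂)

/-- The view of the receiver: its input `s`, its random choices `(s₁, r₁), (s₂, r₂)`, the public
key, the message `(e_{0,v}, e_{1,v})`, and the message that it extracts. -/
def viewR (s : Bool) (τ : Transcript 𝒢 σ n z) :
    (Unit ⊕ ReqWires n ⊕ ReqWires n ⊕ PkWires 𝒢 n ⊕ Option (PairWires 𝒢 σ n) ⊕
      Option (Fin (σ n))) → Bool :=
  Sum.elim (fun _ => s) <| Sum.elim (encReq τ.req₁) <| Sum.elim (encReq τ.req₂) <|
    Sum.elim τ.pk <| Sum.elim (encOption encPair τ.res') (encOption (fun x i => x i) τ.out)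

/-- The outputs of the parties: the first proxy outputs the number of pairs it received, and the
receiver the extracted message. -/
def outputs (τ : Transcript 𝒢 σ n z) : Option (Outputs (σ n)) :=
  τ.res.bind fun _ => τ.out.map fun x => ⟨(), z, (), x⟩

end Transcript

/-- The protocol, over the group-generator scheme `𝒢` and for `σ n`-bit messages. -/
def protocol (𝒢 : GroupGen) (σ : ℕ → ℕ) : Protocol σ where
  WiresS n z := (Fin z × Bool × Fin (σ n)) ⊕ Fin (𝒢.coinLen n) ⊕ Transcript.PkWires 𝒢 n ⊕
    (Fin z × Bool × Fin (n + 2)) ⊕ Transcript.QueryWires 𝒢 n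
  WiresP1 n z := Fin z.size ⊕ Transcript.PkWires 𝒢 n ⊕ Transcript.ReqWires n ⊕
    Transcript.QueryWires 𝒢 n ⊕ Option (Fin z × Transcript.PairWires 𝒢 σ n)
  WiresP2 n := Transcript.PkWires 𝒢 n ⊕ Transcript.ReqWires n
  WiresR n := Unit ⊕ Transcript.ReqWires n ⊕ Transcript.ReqWires n ⊕ Transcript.PkWires 𝒢 n ⊕
    Option (Transcript.PairWires 𝒢 σ n) ⊕ Option (Fin (σ n))
  viewS n _ m v s H := (execution 𝒢 σ n m v s H).map (Transcript.viewS m)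
  viewP1 n _ m v s H := (execution 𝒢 σ n m v s H).map (Transcript.viewP1 v)
  viewP2 n _ m v s H := (execution 𝒢 σ n m v s H).map Transcript.viewP2
  viewR n _ m v s H := (execution 𝒢 σ n m v s H).map (Transcript.viewR s)
  outputs n _ m v s H := (execution 𝒢 σ n m v s H).map Transcript.outputs

end

end DQMROT

/-! Everything rests on one computation in the group. The first proxy puts `δ_{s₂}` at position `s₁
⊕ s₂ = s`, so `β_s = g ^ x` with `x` the receiver's exponent, and `β_{1-s} = C / g ^ x`. Hence the
test `C = β₀ β₁` always succeeds, `(g ^ y) ^ x = β_s ^ y` removes the mask, and the outputs are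
correct with certainty. Moreover, for fixed `s`, `s₁`, `r₁` the pair `(C, r₂)` corresponds
bijectively to the pair of logarithms of `(β₀, β₁)` (`queryEquiv`): the query seen by the sender is
a pair of independent uniform elements, independent of `s`, `s₁`, `r₁`.

The sender's view is therefore a function of `m`, its own coins and two uniform elements, and the
second proxy sees a uniform key and a uniform request. Both are simulated by sampling. The only
error comes from circuits having coin bits and not uniform residues modulo `p`: a residue is sampled
by `n` rounds of rejection, each failing with probability at most `7/8` (`close_samp_ord`), and
polynomially many such errors remain negligible.

The first proxy and the receiver also see ciphertexts masked by `H (β_b ^ y)`. For them the key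
statement is `compIndist_hdh`: under CDH, `(g ^ a₁, g ^ a₂, H (g ^ (a₁ a₂)))` cannot be told from
the same pair with a uniform string. The value of `H` at the critical point may be resampled, so the
two experiments run the distinguisher on the same input with oracles that differ at that point only;
they diverge only if the point is queried (`Circuit.eval_le_of_agree`). Answering oracle queries
from a table and fresh coins (`Circuit.exists_lazy`) turns "run the distinguisher and output its
`j`-th query" into an oracle-free circuit, that is, a CDH solver.

For the receiver one application suffices, with `β_{1-s}` and `g ^ y_{1-s,v}` as the challenge. For
the first proxy the `2 z` masks are replaced one at a time; in the step for `(t, b)` the challenge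
takes the places of `β_b` and `g ^ y_{b,t}`, while every other mask is a power with a known exponent
`y`. Once all masks are uniform they are one-time pads, and the messages disappear from the view.

Polynomial size is never checked on explicit circuits: `Det` (one circuit with a size bound) and
`PDet` (a family with a polynomial bound) are closed under the operations needed to write down the
views. -/

namespace DQMROT

noncomputable section

/-! ### Operations on circuits -/

namespace Circuit

variable {σ : ℕ} {κ κ' : Type}

/-- Rename the input wires of a circuit. -/
def rename : {ι : Type} → Circuit σ κ ι → {ι' : Type} → (ι → ι') → Circuit σ κ ι'
  | _, .out f, _, g => .out (g ∘ f)
  | _, .const b k, _, g => .const b (k.rename (Option.map g))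
  | _, .gate f i j k, _, g => .gate f (g i) (g j) (k.rename (Option.map g))
  | _, .coin k, _, g => .coin (k.rename (Option.map g))
  | _, .query q k, _, g => .query (q.map g) (k.rename (Sum.map g id))

theorem addWire_comp_map {ι ι' : Type} (x : ι' → Bool) (b : Bool) (g : ι → ι') :
    addWire x b ∘ Option.map g = addWire (x ∘ g) b := by
  funext i; cases i <;> rfl

theorem eval_rename (H : Oracle σ) {ι : Type} (c : Circuit σ κ ι) {ι' : Type} (g : ι → ι')
    (x : ι' → Bool) : (c.rename g).eval H x = c.eval H (x ∘ g) := by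
  induction c generalizing ι' with
  | out f => rfl
  | const b k ih => simp only [rename, eval, ih, addWire_comp_map]
  | gate f i j k ih => simp only [rename, eval, ih, addWire_comp_map, Function.comp]
  | coin k ih => simp only [rename, eval, ih, addWire_comp_map]
  | query q k ih =>
    simp only [rename, eval, ih, List.map_map]
    congr 1
    funext i; cases i <;> rfl

@[simp] theorem size_rename {ι : Type} (c : Circuit σ κ ι) {ι' : Type} (g : ι → ι') :
    (c.rename g).size = c.size := by
  induction c generalizing ι' with
  | out f => rfl
  | const b k ih => simp only [rename, size, ih]
  | gate f i j k ih => simp only [rename, size, ih]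
  | coin k ih => simp only [rename, size, ih]
  | query q k ih => simp only [rename, size, ih, List.length_map]

/-- Run a circuit, and then another one which also has access to the input of the first. -/
def andThen : {ι : Type} → Circuit σ κ ι → Circuit σ κ' (ι ⊕ κ) → Circuit σ κ' ι
  | _, .out f, d => d.rename (Sum.elim id f)
  | _, .const b k, d => .const b (k.andThen (d.rename (Sum.map some id)))
  | _, .gate f i j k, d => .gate f i j (k.andThen (d.rename (Sum.map some id)))
  | _, .coin k, d => .coin (k.andThen (d.rename (Sum.map some id)))
  | _, .query q k, d => .query q (k.andThen (d.rename (Sum.map Sum.inl id)))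

theorem eval_andThen (H : Oracle σ) {ι : Type} (c : Circuit σ κ ι) (d : Circuit σ κ' (ι ⊕ κ))
    (x : ι → Bool) :
    (c.andThen d).eval H x = (c.eval H x).bind fun w => d.eval H (Sum.elim x w) := by
  have key : ∀ {ι ι' : Type} (y : ι' → Bool) (g : ι → ι') (w : κ → Bool),
      Sum.elim y w ∘ Sum.map g id = Sum.elim (y ∘ g) w := by
    intro ι ι' y g w
    funext i; cases i <;> rfl
  have key₁ : ∀ {ι : Type} (x : ι → Bool) (b : Bool), addWire x b ∘ some = x := fun _ _ => rfl
  induction c with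
  | out f =>
    simp only [andThen, eval, eval_rename, PMF.pure_bind]
    congr 1
    funext i; cases i <;> rfl
  | const b k ih => simp only [andThen, eval, ih, eval_rename, key, key₁]
  | gate f i j k ih => simp only [andThen, eval, ih, eval_rename, key, key₁]
  | coin k ih => simp only [andThen, eval, ih, eval_rename, key, key₁, PMF.bind_bind]
  | query q k ih => simp only [andThen, eval, ih, eval_rename, key, Sum.elim_comp_inl]

@[simp] theorem size_andThen {ι : Type} (c : Circuit σ κ ι) (d : Circuit σ κ' (ι ⊕ κ)) :
    (c.andThen d).size = c.size + d.size := by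
  induction c with
  | out f => simp only [andThen, size, size_rename, zero_add]
  | const b k ih => simp only [andThen, size, ih, size_rename]; omega
  | gate f i j k ih => simp only [andThen, size, ih, size_rename]; omega
  | coin k ih => simp only [andThen, size, ih, size_rename]; omega
  | query q k ih => simp only [andThen, size, ih, size_rename]; omega

/-- A circuit without an oracle, as a circuit with an oracle. -/
def ofPlain : {ι : Type} → PlainCircuit κ ι → Circuit σ κ ι
  | _, .out f => .out f
  | _, .const b k => .const b (ofPlain k)
  | _, .gate f i j k => .gate f i j (ofPlain k)
  | _, .coin k => .coin (ofPlain k)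
  -- The answer of a zero-bit oracle has no wires, so the gate can be dropped.
  | _, .query _ k => (ofPlain k).rename (Sum.elim id Fin.elim0)

theorem eval_ofPlain (H : Oracle σ) {ι : Type} (c : PlainCircuit κ ι) (x : ι → Bool) :
    (ofPlain c).eval H x = c.run x := by
  unfold PlainCircuit.run
  induction c with
  | out f => rfl
  | const b k ih => simp only [ofPlain, eval, ih]
  | gate f i j k ih => simp only [ofPlain, eval, ih]
  | coin k ih => simp only [ofPlain, eval, ih]
  | query q k ih =>
    simp only [ofPlain, eval, ih, eval_rename]
    congr 1
    funext i
    rcases i with i | i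
    · rfl
    · exact i.elim0

theorem size_ofPlain {ι : Type} (c : PlainCircuit κ ι) :
    (ofPlain c : Circuit σ κ ι).size ≤ c.size := by
  induction c with
  | out f => rfl
  | const b k ih => simp only [ofPlain, size]; omega
  | gate f i j k ih => simp only [ofPlain, size]; omega
  | coin k ih => simp only [ofPlain, size]; omega
  | query q k ih => simp only [ofPlain, size, size_rename]; omega

end Circuit

/-! ### Uniform distributions -/

section Uniform

variable {α β γ : Type}

theorem uniform_map_equiv [Fintype α] [Nonempty α] [Fintype β] [Nonempty β] (e : α ≃ β) :
    (PMF.uniformOfFintype α).map e = PMF.uniformOfFintype β := by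
  classical
  ext b
  rw [PMF.map_apply, tsum_eq_single (e.symm b)]
  · simp [Fintype.card_congr e]
  · intro a ha
    rw [if_neg]
    rintro rfl
    simp at ha

theorem uniform_bind_equiv [Fintype α] [Nonempty α] [Fintype β] [Nonempty β] (e : α ≃ β)
    (F : β → PMF γ) :
    (PMF.uniformOfFintype β).bind F = (PMF.uniformOfFintype α).bind fun a => F (e a) := by
  rw [← uniform_map_equiv e, PMF.bind_map]; rfl

theorem uniform_bind_prod [Fintype α] [Nonempty α] [Fintype β] [Nonempty β]
    (F : α × β → PMF γ) :
    (PMF.uniformOfFintype (α × β)).bind F =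
      (PMF.uniformOfFintype α).bind fun a => (PMF.uniformOfFintype β).bind fun b => F (a, b) := by
  ext c
  simp only [PMF.bind_apply, PMF.uniformOfFintype_apply, Fintype.card_prod, tsum_fintype,
    Fintype.sum_prod_type, Finset.mul_sum, ← mul_assoc]
  rw [Nat.cast_mul, ENNReal.mul_inv (Or.inr (ENNReal.natCast_ne_top _))
    (Or.inl (ENNReal.natCast_ne_top _))]

theorem uniform_bind_const [Fintype α] [Nonempty α] (P : PMF γ) :
    ((PMF.uniformOfFintype α).bind fun _ => P) = P := PMF.bind_const _ _

/-- Uniform bit strings on a disjoint union of wires. -/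
theorem uniform_bind_sumElim {κ κ' : Type} [Fintype (κ → Bool)] [Fintype (κ' → Bool)]
    [Fintype (κ ⊕ κ' → Bool)] (F : (κ ⊕ κ' → Bool) → PMF γ) :
    (PMF.uniformOfFintype (κ ⊕ κ' → Bool)).bind F =
      (PMF.uniformOfFintype (κ → Bool)).bind fun a =>
        (PMF.uniformOfFintype (κ' → Bool)).bind fun b => F (Sum.elim a b) := by
  rw [uniform_bind_equiv (Equiv.sumArrowEquivProdArrow κ κ' Bool).symm, uniform_bind_prod]
  rfl

/-- A uniform function on `Option κ`. -/
theorem uniform_bind_option {κ A : Type} [Fintype (κ → A)] [Fintype (Option κ → A)] [Fintype A]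
    [Nonempty A]
    (F : (Option κ → A) → PMF γ) :
    (PMF.uniformOfFintype (Option κ → A)).bind F =
      (PMF.uniformOfFintype A).bind fun a =>
        (PMF.uniformOfFintype (κ → A)).bind fun b => F (fun i => i.elim a b) := by
  rw [uniform_bind_equiv (Equiv.piOptionEquivProd (β := fun _ : Option κ => A)).symm,
    uniform_bind_prod]
  congr 1; funext a
  congr 1; funext b
  congr 1; funext i
  cases i <;> rfl

end Uniform

/-- A circuit that tosses a coin for each wire in `κ`. -/
theorem Circuit.exists_coins (σ : ℕ) (κ : Type) [Fintype κ] [DecidableEq κ] (ι : Type) :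
    ∃ c : Circuit σ κ ι, c.size = Fintype.card κ ∧
      ∀ H x, c.eval H x = PMF.uniformOfFintype (κ → Bool) := by
  -- Decidable equality is moved behind the choice of the circuit because the induction over finite
  -- types supplies a `Fintype` instance only.
  suffices h : ∀ (κ : Type) [Fintype κ], ∀ (ι : Type), ∃ c : Circuit σ κ ι,
      c.size = Fintype.card κ ∧ ∀ [DecidableEq κ] H x,
        c.eval H x = PMF.uniformOfFintype (κ → Bool) by
    obtain ⟨c, hc, h⟩ := h κ ι
    exact ⟨c, hc, h⟩
  intro κ _
  refine Fintype.induction_empty_option (P := fun κ [Fintype κ] => ∀ (ι : Type),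
    ∃ c : Circuit σ κ ι, c.size = Fintype.card κ ∧ ∀ [DecidableEq κ] H x,
      c.eval H x = PMF.uniformOfFintype (κ → Bool)) ?_ ?_ ?_ κ
  · intro α β _ e ih ι
    let _ := Fintype.ofEquiv β e.symm
    obtain ⟨c, hc, h⟩ := ih ι
    refine ⟨c.andThen (.out (Sum.inr ∘ e.symm)), ?_, fun H x => ?_⟩
    · rw [Circuit.size_andThen, hc]
      simp only [Circuit.size, add_zero]
      convert Fintype.card_congr e
    · classical
      rw [Circuit.eval_andThen, h, ← uniform_map_equiv (Equiv.arrowCongr e (Equiv.refl Bool))]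
      exact congrArg _ (funext fun w => rfl)
  · intro ι
    refine ⟨.out PEmpty.elim, by simp [Circuit.size], fun H x => ?_⟩
    ext w
    have : w = fun k => x (PEmpty.elim k) := Subsingleton.elim _ _
    simp [Circuit.eval, this]
  · intro α _ ih ι
    obtain ⟨c, hc, h⟩ := ih (Option ι)
    refine ⟨.coin (c.andThen (.out fun i => i.elim (Sum.inl none) Sum.inr)), ?_, fun H x => ?_⟩
    · simp [Circuit.size, hc]
    · classical
      rw [← PMF.bind_pure (PMF.uniformOfFintype (Option α → Bool)), uniform_bind_option]
      simp only [Circuit.eval, Circuit.eval_andThen, h]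
      congr 1; funext a
      congr 1; funext b
      congr 1; funext i
      cases i <;> rfl

/-! ### Values that are computed by circuits -/

/-- `Det O x v s`: there is a circuit of size at most `s` that computes the bits `v ω` from the
wires `x ω` with the oracle `O ω`, for all `ω`. -/
def Det {σ : ℕ} {Ω ι κ : Type} (O : Ω → Oracle σ) (x : Ω → ι → Bool) (v : Ω → κ → Bool)
    (s : ℕ) : Prop :=
  ∃ c : Circuit σ κ ι, c.size ≤ s ∧ ∀ ω, c.eval (O ω) (x ω) = PMF.pure (v ω)

namespace Det

variable {σ : ℕ} {Ω ι κ κ' : Type} {O : Ω → Oracle σ} {x : Ω → ι → Bool} {v : Ω → κ → Bool}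
  {w : Ω → κ' → Bool} {s t u : ℕ}

theorem mono (h : Det O x v s) (hst : s ≤ t) : Det O x v t := by
  obtain ⟨c, hc, h⟩ := h
  exact ⟨c, hc.trans hst, h⟩

theorem congr {v' : Ω → κ → Bool} (h : Det O x v s) (hv : ∀ ω k, v' ω k = v ω k) :
    Det O x v' s := by
  obtain rfl : v' = v := funext fun ω => funext fun k => hv ω k
  exact h

theorem select (f : κ → ι) : Det O x (fun ω k => x ω (f k)) 0 :=
  ⟨.out f, le_rfl, fun _ => rfl⟩

theorem comp (h : Det O x v s) (h' : Det O (fun ω => Sum.elim (x ω) (v ω)) w t) :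
    Det O x w (s + t) := by
  obtain ⟨c, hc, h⟩ := h
  obtain ⟨d, hd, h'⟩ := h'
  refine ⟨c.andThen d, by rw [Circuit.size_andThen]; omega, fun ω => ?_⟩
  rw [Circuit.eval_andThen, h, PMF.pure_bind, h']

theorem rename (f : κ → ι) (h : Det O (fun ω k => x ω (f k)) w t) : Det O x w t := by
  obtain ⟨c, hc, h⟩ := h
  refine ⟨c.rename f, by rwa [Circuit.size_rename], fun ω => ?_⟩
  rw [Circuit.eval_rename, ← h]
  rfl

theorem trans (h : Det O x v s) (h' : Det O v w t) : Det O x w (s + t) :=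
  h.comp (rename Sum.inr h')

theorem reindex (h : Det O x v s) (f : κ' → κ) : Det O x (fun ω k => v ω (f k)) s :=
  h.trans (select f)

theorem elim (h : Det O x v s) (h' : Det O x w t) :
    Det O x (fun ω => Sum.elim (v ω) (w ω)) (s + t) := by
  refine (h.comp ((rename Sum.inl h').comp
    (select (Sum.elim (fun k => Sum.inl (Sum.inr k)) Sum.inr)))).congr ?_
  rintro ω (k | k) <;> rfl

/-- One wire carrying `false` and one carrying `true` serve all output positions, so the size is 2
whatever the number of output bits. -/
theorem const (b : κ → Bool) : Det O x (fun _ => b) 2 := by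
  refine ⟨.const false (.const true (.out fun k => if b k then none else some none)), le_rfl,
    fun ω => ?_⟩
  simp only [Circuit.eval]
  congr 1
  funext k
  by_cases h : b k <;> simp [h, addWire]

theorem gate (f : Bool → Bool → Bool) {a b : Ω → Unit → Bool} (h : Det O x a s)
    (h' : Det O x b t) : Det O x (fun ω (_ : Unit) => f (a ω ()) (b ω ())) (s + t + 1) :=
  (h.elim h').trans (t := 1) ⟨.gate f (Sum.inl ()) (Sum.inr ()) (.out fun _ => none), le_rfl,
    fun _ => rfl⟩

theorem pi {I : Type} [Fintype I] {v : I → Ω → κ → Bool} (h : ∀ i, Det O x (v i) s) :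
    Det O x (fun ω (k : I × κ) => v k.1 ω k.2) (Fintype.card I * s) := by
  revert v
  refine Fintype.induction_empty_option (P := fun I [Fintype I] =>
    ∀ {v : I → Ω → κ → Bool}, (∀ i, Det O x (v i) s) →
      Det O x (fun ω (k : I × κ) => v k.1 ω k.2) (Fintype.card I * s)) ?_ ?_ ?_ I
  · intro I I' hI e ih v h
    let _ := Fintype.ofEquiv I' e.symm
    have := (ih (fun i => h (e i))).reindex (fun k : I' × κ => (e.symm k.1, k.2))
    simp only [Equiv.apply_symm_apply] at this
    refine this.mono ?_
    rw [@Fintype.card_congr I I' _ _ e]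
  · intro v _
    exact ⟨.out fun k : PEmpty × κ => k.1.elim, Nat.zero_le _, fun ω =>
      congrArg PMF.pure (funext fun k : PEmpty × κ => k.1.elim)⟩
  · intro I _ ih v h
    have := ((h none).elim (ih fun i => h (some i))).reindex (fun k : Option I × κ =>
      k.1.elim (Sum.inl k.2 : κ ⊕ I × κ) fun i => Sum.inr (i, k.2))
    refine (this.mono ?_).congr ?_
    · rw [Fintype.card_option, add_mul, one_mul, add_comm]
    · rintro ω ⟨_ | i, k⟩ <;> rfl

/-- Both arguments are computed once and the gates are then applied to their wires, so `s` and `t`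
are not multiplied by the number of bits. -/
theorem bitwise [Fintype κ] (f : Bool → Bool → Bool) {w : Ω → κ → Bool} (h : Det O x v s)
    (h' : Det O x w t) : Det O x (fun ω k => f (v ω k) (w ω k)) (s + t + Fintype.card κ) := by
  have : Det O (fun ω => Sum.elim (v ω) (w ω)) (fun ω (k : κ × Unit) => f (v ω k.1) (w ω k.1))
      (Fintype.card κ * 1) :=
    pi (v := fun k ω (_ : Unit) => f (v ω k) (w ω k)) fun k =>
      ((select (fun _ : Unit => (Sum.inl k : κ ⊕ κ))).gate f
        (select (fun _ : Unit => (Sum.inr k : κ ⊕ κ)))).congr fun _ _ => rfl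
  rw [mul_one] at this
  exact ((h.elim h').trans this).reindex fun k => (k, ())

/-- The multiplexer `(b ∧ v) ∨ (¬ b ∧ w)`: the condition is computed twice, and there are three
bitwise passes. -/
theorem ite [Fintype κ] {b : Ω → Bool} {w : Ω → κ → Bool} (hb : Det O x (fun ω (_ : Unit) => b ω) u)
    (h : Det O x v s) (h' : Det O x w t) :
    Det O x (fun ω k => if b ω then v ω k else w ω k) (2 * u + s + t + 3 * Fintype.card κ) := by
  have hb' : Det O x (fun ω (_ : κ) => b ω) u := hb.reindex fun _ => ()
  refine ((bitwise or (bitwise and hb' h) (bitwise (fun b c => !b && c) hb' h')).mono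
    (by omega)).congr fun ω k => ?_
  cases b ω <;> simp

/-- The lengths of the two wire lists are fixed when the circuit is built, so lists of different
lengths cost only a constant; otherwise the bits are compared one by one. -/
theorem decide_map_eq (q q' : List ι) :
    Det O x (fun ω (_ : Unit) => decide (q.map (x ω) = q'.map (x ω))) (2 * q.length + 2) := by
  induction q generalizing q' with
  | nil =>
    cases q' with
    | nil => exact (const fun _ => true).congr fun _ _ => by simp
    | cons j q' => exact (const fun _ => false).congr fun _ _ => by simp
  | cons i q ih =>
    cases q' with
    | nil => exact ((const fun _ => false).congr fun _ _ => by simp).mono (by omega)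
    | cons j q' =>
      refine ((gate and (gate (fun a b => a == b) (select fun _ => i) (select fun _ => j))
        (ih q')).mono ?_).congr fun ω k => ?_
      · simp only [List.length_cons]; omega
      · simp only [List.map_cons, List.cons.injEq]
        rw [Bool.decide_and, Bool.beq_eq_decide_eq]

/-- Comparison from the top bit: if the top bits differ, that of `b` is the answer; otherwise the
lower bits decide. Reduction modulo `2 ^ W` makes the induction on the width possible. -/
theorem decide_lt (W : ℕ) {a b : Ω → ℕ} (ha : Det O x (fun ω => encNat W (a ω)) s)
    (hb : Det O x (fun ω => encNat W (b ω)) t) :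
    Det O x (fun ω (_ : Unit) => decide (a ω % 2 ^ W < b ω % 2 ^ W))
      (W * (2 * s + 3 * t + 5) + 2) := by
  induction W with
  | zero => exact ((const fun _ => false).congr fun _ _ => by simp [Nat.mod_one]).mono (by omega)
  | succ W ih =>
    have ha' : Det O x (fun ω (_ : Unit) => (a ω).testBit W) s :=
      ha.reindex fun _ => (Fin.last W)
    have hb' : Det O x (fun ω (_ : Unit) => (b ω).testBit W) t :=
      hb.reindex fun _ => (Fin.last W)
    have := ih (ha.reindex Fin.castSucc) (hb.reindex Fin.castSucc)
    refine ((ite (ha'.gate xor hb') hb' this).mono ?_).congr fun ω k => ?_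
    · simp only [Fintype.card_unit]
      rw [add_mul]; omega
    · rw [Nat.mod_pow_succ, Nat.mod_pow_succ, ← Nat.toNat_testBit, ← Nat.toNat_testBit]
      have h1 : a ω % 2 ^ W < 2 ^ W := Nat.mod_lt _ (by positivity)
      have h2 : b ω % 2 ^ W < 2 ^ W := Nat.mod_lt _ (by positivity)
      cases (a ω).testBit W <;> cases (b ω).testBit W <;> simp <;> omega

theorem query {ℓ : ℕ} {v : Ω → Fin ℓ → Bool} (h : Det O x v s) :
    Det O x (fun ω => O ω (List.ofFn (v ω))) (s + ℓ + 1) := by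
  refine (h.trans (t := ℓ + 1)
    ⟨.query (List.ofFn id) (.out Sum.inr), by simp [Circuit.size], fun ω => ?_⟩)
  simp only [Circuit.eval, Sum.elim_inr, List.map_ofFn, Function.comp_id]

end Det

/-! ### Sampling by rejection -/

/-- The first number less than `p` in a list of `K` numbers of `W` bits, or `0`. -/
def sampNat (p : ℕ) {W : ℕ} : (K : ℕ) → (Fin K → Bits W) → ℕ
  | 0, _ => 0
  | K + 1, k => if Nat.ofBits (k 0) < p then Nat.ofBits (k 0) else sampNat p K (Fin.tail k)

theorem sampNat_lt {p W : ℕ} (hp : 0 < p) (K : ℕ) (k : Fin K → Bits W) : sampNat p K k < p := by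
  induction K with
  | zero => exact hp
  | succ K ih =>
    unfold sampNat
    split_ifs with h
    · exact h
    · exact ih _

theorem encNat_ofBits {W : ℕ} (b : Bits W) : encNat W (Nat.ofBits b) = b := by
  funext i
  simp [encNat]

theorem ofBits_encNat (W a : ℕ) : Nat.ofBits (encNat W a) = a % 2 ^ W := Nat.ofBits_testBit a W

theorem Det.sampNat {σ W : ℕ} {Ω ι : Type} {O : Ω → Oracle σ} {x : Ω → ι → Bool} {s t : ℕ}
    {p : Ω → ℕ} (hp : ∀ ω, p ω < 2 ^ W) (h : Det O x (fun ω => encNat W (p ω)) s) (K : ℕ)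
    {k : Ω → Fin K → Bits W} (hk : Det O x (fun ω (i : Fin K × Fin W) => k ω i.1 i.2) t) :
    Det O x (fun ω => encNat W (sampNat (p ω) K (k ω)))
      (K * (2 * (W * (2 * t + 3 * s + 5) + 2) + t + 3 * W) + 2) := by
  induction K with
  | zero => exact (Det.const (encNat W 0)).mono (by omega)
  | succ K ih =>
    have h0 : Det O x (fun ω => k ω 0) t := hk.reindex fun i => (0, i)
    have h0' : Det O x (fun ω => encNat W (Nat.ofBits (k ω 0))) t := by
      simpa only [encNat_ofBits] using h0
    have h1 := ih (k := fun ω => Fin.tail (k ω)) (hk.reindex fun i : Fin K × Fin W => (i.1.succ, i.2))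
    refine ((Det.ite (Det.decide_lt W h0' h) h0 h1).mono ?_).congr fun ω i => ?_
    · simp only [Fintype.card_fin]
      rw [add_mul K 1]; omega
    · rw [Nat.mod_eq_of_lt (Nat.ofBits_lt_two_pow _), Nat.mod_eq_of_lt (hp ω)]
      simp only [DQMROT.sampNat, decide_eq_true_eq]
      split_ifs
      · rw [encNat_ofBits]
      · rfl

/-! ### Group operations -/

section Group

variable {𝒢 : GroupGen} {n σ : ℕ} {Ω ι : Type} {O : Ω → Oracle σ} {x : Ω → ι → Bool}
  {ρ : Ω → Bits (𝒢.coinLen n)} {d s t : ℕ}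

theorem Det.ofPlain {κ κ' : Type} (c : PlainCircuit κ' κ) {v : Ω → κ → Bool} {w : Ω → κ' → Bool}
    (h : Det O x v s) (hc : ∀ ω, c.run (v ω) = PMF.pure (w ω)) : Det O x w (s + c.size) :=
  h.trans ⟨.ofPlain c, Circuit.size_ofPlain c, fun ω => by rw [Circuit.eval_ofPlain, hc]⟩

theorem Det.params (h : Det O x ρ s) :
    Det O x (fun ω => 𝒢.params n (ρ ω)) (s + (𝒢.genC n).size) :=
  h.ofPlain _ fun ω => 𝒢.genC_run n (ρ ω)

theorem Det.mul {a b : ∀ ω, 𝒢.Grp n (ρ ω)} (hd : Det O x (fun ω => 𝒢.desc n (ρ ω)) d)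
    (ha : Det O x (fun ω => 𝒢.elem (a ω)) s) (hb : Det O x (fun ω => 𝒢.elem (b ω)) t) :
    Det O x (fun ω => 𝒢.elem (a ω * b ω)) (d + (s + t) + (𝒢.mulC n).size) :=
  (hd.elim (ha.elim hb)).ofPlain _ fun ω => 𝒢.mulC_run n (ρ ω) _ _

/-- Squaring through `Det.mul` would pay twice for `a`, and repeated squaring would become
exponential. Here the wires of `a` are computed once and fed to both inputs. -/
theorem Det.sq {a : ∀ ω, 𝒢.Grp n (ρ ω)} (hd : Det O x (fun ω => 𝒢.desc n (ρ ω)) d)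
    (ha : Det O x (fun ω => 𝒢.elem (a ω)) s) :
    Det O x (fun ω => 𝒢.elem (a ω * a ω)) (d + s + (𝒢.mulC n).size) := by
  refine ((hd.elim ha).reindex (Sum.elim Sum.inl (Sum.elim Sum.inr Sum.inr))).ofPlain _ fun ω => ?_
  rw [← 𝒢.mulC_run n (ρ ω)]
  congr 1
  funext i
  rcases i with i | i | i <;> rfl

theorem Det.inv {a : ∀ ω, 𝒢.Grp n (ρ ω)} (hd : Det O x (fun ω => 𝒢.desc n (ρ ω)) d)
    (ha : Det O x (fun ω => 𝒢.elem (a ω)) s) :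
    Det O x (fun ω => 𝒢.elem (a ω)⁻¹) (d + s + (𝒢.invC n).size) :=
  (hd.elim ha).ofPlain _ fun ω => 𝒢.invC_run n (ρ ω) _

/-- Square and multiply, `a ^ k = (a ^ (k / 2)) ^ 2 * a ^ (k % 2)`, by recursion on the number of
bits of the exponent. -/
theorem Det.pow {a : ∀ ω, 𝒢.Grp n (ρ ω)} (hd : Det O x (fun ω => 𝒢.desc n (ρ ω)) d)
    (ha : Det O x (fun ω => 𝒢.elem (a ω)) s) {W : ℕ} {k : Ω → ℕ} (hk : ∀ ω, k ω < 2 ^ W)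
    (h : Det O x (fun ω => encNat W (k ω)) t) :
    Det O x (fun ω => 𝒢.elem (a ω ^ k ω))
      ((W + 1) * (4 * d + 3 * s + 2 * t + 3 * (𝒢.mulC n).size + (𝒢.invC n).size +
        3 * 𝒢.elemLen n)) := by
  -- A group generator comes with no circuit for the neutral element; it is obtained as `a * a⁻¹`.
  have h1 : Det O x (fun ω => 𝒢.elem (1 : 𝒢.Grp n (ρ ω))) _ :=
    (Det.mul hd ha (Det.inv hd ha)).congr fun ω k => by rw [mul_inv_cancel]
  induction W generalizing k with
  | zero =>
    refine (h1.mono (by omega)).congr fun ω i => ?_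
    have := hk ω
    rw [Nat.lt_one_iff.mp (by simpa using this : k ω < 1), pow_zero]
  | succ W ih =>
    have h2 : ∀ ω, k ω / 2 < 2 ^ W := fun ω => by
      have := hk ω
      rw [pow_succ] at this
      omega
    have h3 := ih h2 ((h.reindex Fin.succ).congr fun ω i => by
      simp [encNat, Nat.testBit_succ])
    have h4 : Det O x (fun ω (_ : Unit) => (k ω).testBit 0) t := h.reindex fun _ => 0
    refine ((Det.mul hd (Det.sq hd h3) ((Det.ite h4 ha h1).congr (v' := fun ω =>
      𝒢.elem (if (k ω).testBit 0 then a ω else 1)) fun ω i => ?_)).mono ?_).congr fun ω i => ?_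
    · split_ifs <;> rfl
    · simp only [Fintype.card_fin]
      rw [add_mul (W + 1) 1]
      omega
    · congr 2
      rw [← pow_two, ← pow_mul]
      have h5 := Nat.div_add_mod (k ω) 2
      rw [Nat.testBit_zero]
      rcases Nat.mod_two_eq_zero_or_one (k ω) with h6 | h6
      · rw [h6] at h5
        simp [h6]
        congr 1; omega
      · rw [h6] at h5
        simp only [h6, decide_true, if_true]
        rw [← pow_succ]; congr 1; omega

end Group

/-! ### Families of circuits of polynomial size -/

/-- `f` is bounded by a polynomial in `sz`. -/
def PBound {J : Type} (sz f : J → ℕ) : Prop := ∃ P : Polynomial ℕ, ∀ j, f j ≤ P.eval (sz j)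

namespace PBound

variable {J : Type} {sz f f' : J → ℕ}

theorem const (c : ℕ) : PBound sz fun _ => c := ⟨Polynomial.C c, fun j => by simp⟩

theorem self : PBound sz sz := ⟨Polynomial.X, fun j => by simp⟩

theorem mono (h : PBound sz f) (hf : ∀ j, f' j ≤ f j) : PBound sz f' := by
  obtain ⟨P, hP⟩ := h
  exact ⟨P, fun j => (hf j).trans (hP j)⟩

theorem add (h : PBound sz f) (h' : PBound sz f') : PBound sz fun j => f j + f' j := by
  obtain ⟨P, hP⟩ := h
  obtain ⟨Q, hQ⟩ := h'
  exact ⟨P + Q, fun j => by rw [Polynomial.eval_add]; exact add_le_add (hP j) (hQ j)⟩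

theorem mul (h : PBound sz f) (h' : PBound sz f') : PBound sz fun j => f j * f' j := by
  obtain ⟨P, hP⟩ := h
  obtain ⟨Q, hQ⟩ := h'
  exact ⟨P * Q, fun j => by rw [Polynomial.eval_mul]; exact Nat.mul_le_mul (hP j) (hQ j)⟩

/-- Coefficients in `ℕ` are nonnegative; this is what allows polynomial bounds to be composed. -/
theorem _root_.DQMROT.eval_monotone (P : Polynomial ℕ) : Monotone fun a => P.eval a := by
  intro a b hab
  simp only [Polynomial.eval_eq_sum_range]
  gcongr

theorem trans {f'' : J → ℕ} (h : PBound sz f) (h' : PBound f f'') : PBound sz f'' := by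
  obtain ⟨P, hP⟩ := h
  obtain ⟨Q, hQ⟩ := h'
  refine ⟨Q.comp P, fun j => ?_⟩
  rw [Polynomial.eval_comp]
  exact (hQ j).trans (eval_monotone Q (hP j))

theorem of_polyBounded {g : ℕ → ℕ} (hg : PolyBounded g) (h : PBound sz f) :
    PBound sz fun j => g (f j) := by
  obtain ⟨P, hP⟩ := hg
  exact h.trans ⟨P, fun j => hP _⟩

end PBound

/-- `PDet sz O x v`: the values `v j ω` are computed from the wires `x j ω` with the oracle `O j ω`
by circuits of size polynomial in `sz j`. -/
def PDet {J : Type} (sz : J → ℕ) {σ : J → ℕ} {Ω ι κ : J → Type} (O : ∀ j, Ω j → Oracle (σ j))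
    (x : ∀ j, Ω j → ι j → Bool) (v : ∀ j, Ω j → κ j → Bool) : Prop :=
  ∃ f : J → ℕ, PBound sz f ∧ ∀ j, Det (O j) (x j) (v j) (f j)

namespace PDet

variable {J : Type} {sz : J → ℕ} {σ : J → ℕ} {Ω ι κ κ' : J → Type}
  {O : ∀ j, Ω j → Oracle (σ j)} {x : ∀ j, Ω j → ι j → Bool} {v : ∀ j, Ω j → κ j → Bool}
  {w : ∀ j, Ω j → κ' j → Bool}

theorem congr {v' : ∀ j, Ω j → κ j → Bool} (h : PDet sz O x v)
    (hv : ∀ j ω k, v' j ω k = v j ω k) : PDet sz O x v' := by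
  obtain ⟨f, hf, h⟩ := h
  exact ⟨f, hf, fun j => (h j).congr (hv j)⟩

theorem select (f : ∀ j, κ j → ι j) : PDet sz O x (fun j ω k => x j ω (f j k)) :=
  ⟨_, PBound.const 0, fun j => Det.select (f j)⟩

theorem reindex (h : PDet sz O x v) (f : ∀ j, κ' j → κ j) :
    PDet sz O x (fun j ω k => v j ω (f j k)) := by
  obtain ⟨g, hg, h⟩ := h
  exact ⟨g, hg, fun j => (h j).reindex (f j)⟩

theorem elim (h : PDet sz O x v) (h' : PDet sz O x w) :
    PDet sz O x (fun j ω => Sum.elim (v j ω) (w j ω)) := by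
  obtain ⟨f, hf, h⟩ := h
  obtain ⟨f', hf', h'⟩ := h'
  exact ⟨_, hf.add hf', fun j => (h j).elim (h' j)⟩

theorem const (b : ∀ j, κ j → Bool) : PDet sz O x (fun j _ => b j) :=
  ⟨_, PBound.const 2, fun j => Det.const (b j)⟩

/-- The size of the union over `i` must be bounded uniformly; so the premise is about the family
indexed by all pairs `(j, i)`. -/
theorem pi {I : J → Type} [∀ j, Fintype (I j)] (hI : PBound sz fun j => Fintype.card (I j))
    {v : ∀ j, I j → Ω j → κ j → Bool}
    (h : PDet (J := Σ j, I j) (fun a => sz a.1) (fun a => O a.1) (fun a => x a.1)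
      (fun a => v a.1 a.2)) :
    PDet sz O x (fun j ω (k : I j × κ j) => v j k.1 ω k.2) := by
  obtain ⟨f, ⟨P, hP⟩, h⟩ := h
  exact ⟨_, hI.mul ⟨P, fun j => le_rfl⟩, fun j => Det.pi fun i => (h ⟨j, i⟩).mono (hP ⟨j, i⟩)⟩

theorem pullback {J' : Type} (φ : J' → J) (h : PDet sz O x v) :
    PDet (fun a => sz (φ a)) (fun a => O (φ a)) (fun a => x (φ a)) (fun a => v (φ a)) := by
  obtain ⟨f, ⟨P, hP⟩, h⟩ := h
  exact ⟨_, ⟨P, fun a => hP (φ a)⟩, fun a => h (φ a)⟩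

/-- Two families of values, the choice between them depending on the index. -/
theorem cond (c : J → Prop) [DecidablePred c] {w : ∀ j, Ω j → κ j → Bool} (h : PDet sz O x v)
    (h' : PDet sz O x w) : PDet sz O x (fun j ω => if c j then v j ω else w j ω) := by
  obtain ⟨f, hf, h⟩ := h
  obtain ⟨f', hf', h'⟩ := h'
  refine ⟨_, hf.add hf', fun j => ?_⟩
  by_cases hc : c j
  · simp only [hc, if_true]; exact (h j).mono (Nat.le_add_right _ _)
  · simp only [hc, if_false]; exact (h' j).mono (Nat.le_add_left _ _)

theorem bitwise [∀ j, Fintype (κ j)] (hκ : PBound sz fun j => Fintype.card (κ j))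
    (f : Bool → Bool → Bool) {w : ∀ j, Ω j → κ j → Bool} (h : PDet sz O x v)
    (h' : PDet sz O x w) : PDet sz O x (fun j ω k => f (v j ω k) (w j ω k)) := by
  obtain ⟨g, hg, h⟩ := h
  obtain ⟨g', hg', h'⟩ := h'
  exact ⟨_, (hg.add hg').add hκ, fun j => (h j).bitwise f (h' j)⟩

theorem ite [∀ j, Fintype (κ j)] (hκ : PBound sz fun j => Fintype.card (κ j))
    {b : ∀ j, Ω j → Bool} {w : ∀ j, Ω j → κ j → Bool}
    (hb : PDet sz O x (fun j ω (_ : Unit) => b j ω)) (h : PDet sz O x v) (h' : PDet sz O x w) :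
    PDet sz O x (fun j ω k => if b j ω then v j ω k else w j ω k) := by
  obtain ⟨e, he, hb⟩ := hb
  obtain ⟨f, hf, h⟩ := h
  obtain ⟨f', hf', h'⟩ := h'
  exact ⟨_, ((((PBound.const 2).mul he).add hf).add hf').add ((PBound.const 3).mul hκ),
    fun j => (hb j).ite (h j) (h' j)⟩

theorem query {ℓ : J → ℕ} (hℓ : PBound sz ℓ) {v : ∀ j, Ω j → Fin (ℓ j) → Bool}
    (h : PDet sz O x v) : PDet sz O x (fun j ω => O j ω (List.ofFn (v j ω))) := by
  obtain ⟨f, hf, h⟩ := h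
  exact ⟨_, (hf.add hℓ).add (PBound.const 1), fun j => (h j).query⟩

theorem sampNat {W K : J → ℕ} (hW : PBound sz W) (hK : PBound sz K) {p : ∀ j, Ω j → ℕ}
    (hp : ∀ j ω, p j ω < 2 ^ W j) (h : PDet sz O x (fun j ω => encNat (W j) (p j ω)))
    {k : ∀ j, Ω j → Fin (K j) → Bits (W j)}
    (hk : PDet sz O x (fun j ω (i : Fin (K j) × Fin (W j)) => k j ω i.1 i.2)) :
    PDet sz O x (fun j ω => encNat (W j) (sampNat (p j ω) (K j) (k j ω))) := by
  obtain ⟨f, hf, h⟩ := h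
  obtain ⟨f', hf', hk⟩ := hk
  exact ⟨_, (hK.mul ((((PBound.const 2).mul ((hW.mul ((((PBound.const 2).mul hf').add
    ((PBound.const 3).mul hf)).add (PBound.const 5))).add (PBound.const 2))).add hf').add
    ((PBound.const 3).mul hW))).add (PBound.const 2), fun j => (h j).sampNat (hp j) _ (hk j)⟩

section Group

variable {𝒢 : GroupGen} {n : J → ℕ} {ρ : ∀ j, Ω j → Bits (𝒢.coinLen (n j))}

theorem params (hn : PBound sz n) (h : PDet sz O x ρ) :
    PDet sz O x (fun j ω => 𝒢.params (n j) (ρ j ω)) := by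
  obtain ⟨f, hf, h⟩ := h
  exact ⟨_, hf.add (.of_polyBounded 𝒢.genC_poly hn), fun j => (h j).params⟩

theorem mul (hn : PBound sz n) {a b : ∀ j ω, 𝒢.Grp (n j) (ρ j ω)}
    (hd : PDet sz O x (fun j ω => 𝒢.desc (n j) (ρ j ω)))
    (ha : PDet sz O x (fun j ω => 𝒢.elem (a j ω))) (hb : PDet sz O x (fun j ω => 𝒢.elem (b j ω))) :
    PDet sz O x (fun j ω => 𝒢.elem (a j ω * b j ω)) := by
  obtain ⟨d, hd', hd⟩ := hd
  obtain ⟨s, hs, ha⟩ := ha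
  obtain ⟨t, ht, hb⟩ := hb
  exact ⟨_, (hd'.add (hs.add ht)).add (.of_polyBounded 𝒢.mulC_poly hn),
    fun j => Det.mul (hd j) (ha j) (hb j)⟩

theorem inv (hn : PBound sz n) {a : ∀ j ω, 𝒢.Grp (n j) (ρ j ω)}
    (hd : PDet sz O x (fun j ω => 𝒢.desc (n j) (ρ j ω)))
    (ha : PDet sz O x (fun j ω => 𝒢.elem (a j ω))) :
    PDet sz O x (fun j ω => 𝒢.elem (a j ω)⁻¹) := by
  obtain ⟨d, hd', hd⟩ := hd
  obtain ⟨s, hs, ha⟩ := ha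
  exact ⟨_, (hd'.add hs).add (.of_polyBounded 𝒢.invC_poly hn), fun j => Det.inv (hd j) (ha j)⟩

theorem div (hn : PBound sz n) {a b : ∀ j ω, 𝒢.Grp (n j) (ρ j ω)}
    (hd : PDet sz O x (fun j ω => 𝒢.desc (n j) (ρ j ω)))
    (ha : PDet sz O x (fun j ω => 𝒢.elem (a j ω))) (hb : PDet sz O x (fun j ω => 𝒢.elem (b j ω))) :
    PDet sz O x (fun j ω => 𝒢.elem (a j ω / b j ω)) := by
  simp only [div_eq_mul_inv]
  exact mul hn hd ha (inv hn hd hb)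

theorem pow (hn : PBound sz n) {a : ∀ j ω, 𝒢.Grp (n j) (ρ j ω)} {k : ∀ j, Ω j → ℕ}
    (hd : PDet sz O x (fun j ω => 𝒢.desc (n j) (ρ j ω)))
    (ha : PDet sz O x (fun j ω => 𝒢.elem (a j ω))) (hk : ∀ j ω, k j ω < 2 ^ (n j + 2))
    (h : PDet sz O x (fun j ω => encNat (n j + 2) (k j ω))) :
    PDet sz O x (fun j ω => 𝒢.elem (a j ω ^ k j ω)) := by
  obtain ⟨d, hd', hd⟩ := hd
  obtain ⟨s, hs, ha⟩ := ha
  obtain ⟨t, ht, h⟩ := h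
  exact ⟨_, ((hn.add (PBound.const 2)).add (PBound.const 1)).mul
    (((((((PBound.const 4).mul hd').add ((PBound.const 3).mul hs)).add
      ((PBound.const 2).mul ht)).add ((PBound.const 3).mul (.of_polyBounded 𝒢.mulC_poly hn))).add
      (.of_polyBounded 𝒢.invC_poly hn)).add
      ((PBound.const 3).mul (.of_polyBounded 𝒢.elemLen_poly hn))),
    fun j => Det.pow (hd j) (ha j) (hk j) (h j)⟩

end Group

/-- Circuits for values that depend on coin tosses. -/
theorem exists_circuits {K : J → Type} [∀ j, Fintype (K j)] [∀ j, DecidableEq (K j)]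
    (hK : PBound sz fun j => Fintype.card (K j)) {v : ∀ j, Ω j → (K j → Bool) → κ j → Bool}
    (h : PDet (Ω := fun j => Ω j × (K j → Bool)) sz (fun j ω => O j ω.1)
      (fun j ω => Sum.elim (x j ω.1) ω.2) (fun j ω => v j ω.1 ω.2)) :
    ∃ C : ∀ j, Circuit (σ j) (κ j) (ι j), PBound sz (fun j => (C j).size) ∧
      ∀ j ω, (C j).eval (O j ω) (x j ω) = (PMF.uniformOfFintype (K j → Bool)).map (v j ω) := by
  obtain ⟨f, hf, h⟩ := h
  choose c hc h using h
  choose d hd hd' using fun j => Circuit.exists_coins (σ j) (K j) (ι j)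
  refine ⟨fun j => (d j).andThen (c j), (hK.add hf).mono fun j => ?_, fun j ω => ?_⟩
  · rw [Circuit.size_andThen, hd]
    exact Nat.add_le_add_left (hc j) _
  · rw [Circuit.eval_andThen, hd', PMF.map]
    congr 1
    funext b
    exact h j (ω, b)

end PDet

open scoped ENNReal

/-! ### Expectations and statistical distance -/

/-- The expectation of `f` under `P`. -/
def expect {α : Type} (P : PMF α) (f : α → ℝ≥0∞) : ℝ≥0∞ := ∑' a, P a * f a

section Expect

variable {α β γ : Type}

theorem bind_apply_eq_expect (P : PMF α) (F : α → PMF β) (b : β) :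
    P.bind F b = expect P fun a => F a b := rfl

theorem expect_bind (P : PMF α) (F : α → PMF β) (f : β → ℝ≥0∞) :
    expect (P.bind F) f = expect P fun a => expect (F a) f := by
  simp only [expect, PMF.bind_apply, ← ENNReal.tsum_mul_right, ← ENNReal.tsum_mul_left]
  rw [ENNReal.tsum_comm]
  simp only [mul_assoc]

@[simp] theorem expect_pure (a : α) (f : α → ℝ≥0∞) : expect (PMF.pure a) f = f a := by
  rw [expect, tsum_eq_single a]
  · simp
  · intro b hb
    simp [hb]

theorem expect_map (P : PMF α) (g : α → β) (f : β → ℝ≥0∞) :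
    expect (P.map g) f = expect P fun a => f (g a) := by
  simp only [PMF.map, expect_bind, Function.comp, expect_pure]

@[simp] theorem expect_const (P : PMF α) (c : ℝ≥0∞) : (expect P fun _ => c) = c := by
  rw [expect, ENNReal.tsum_mul_right, P.tsum_coe, one_mul]

theorem expect_mono (P : PMF α) {f g : α → ℝ≥0∞} (h : ∀ a, f a ≤ g a) :
    expect P f ≤ expect P g :=
  ENNReal.tsum_le_tsum fun a => mul_le_mul_right (h a) _

theorem expect_add (P : PMF α) (f g : α → ℝ≥0∞) :
    (expect P fun a => f a + g a) = expect P f + expect P g := by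
  simp only [expect, mul_add, ENNReal.tsum_add]

theorem expect_mul_const (P : PMF α) (f : α → ℝ≥0∞) (c : ℝ≥0∞) :
    (expect P fun a => f a * c) = expect P f * c := by
  simp only [expect, ← mul_assoc, ENNReal.tsum_mul_right]

theorem expect_finset_sum (P : PMF α) {I : Type} (s : Finset I) (f : I → α → ℝ≥0∞) :
    (expect P fun a => ∑ i ∈ s, f i a) = ∑ i ∈ s, expect P (f i) := by
  classical
  induction s using Finset.induction_on with
  | empty => simp
  | insert i s hi ih =>
    simp only [Finset.sum_insert hi]
    rw [expect_add, ih]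

theorem expect_le_one (P : PMF α) {f : α → ℝ≥0∞} (h : ∀ a, f a ≤ 1) : expect P f ≤ 1 :=
  (expect_mono P h).trans (expect_const P 1).le

theorem expect_uniform [Fintype α] [Nonempty α] (f : α → ℝ≥0∞) :
    expect (PMF.uniformOfFintype α) f = (Fintype.card α : ℝ≥0∞)⁻¹ * ∑ a, f a := by
  simp only [expect, PMF.uniformOfFintype_apply, tsum_fintype, Finset.mul_sum]

end Expect

/-- The statistical distance of `P` and `Q` is at most `ε`. -/
def Close {α : Type} (ε : ℝ≥0∞) (P Q : PMF α) : Prop :=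
  ∀ f : α → ℝ≥0∞, (∀ a, f a ≤ 1) → expect P f ≤ expect Q f + ε

namespace Close

variable {α β : Type} {P Q R : PMF α} {ε ε' : ℝ≥0∞}

theorem refl (P : PMF α) : Close 0 P P := fun _ _ => by simp

theorem of_eq (h : P = Q) : Close 0 P Q := h ▸ refl P

/-- The definition is one-sided, but applying it to the complementary test `1 - f` yields the other
inequality. -/
theorem symm (h : Close ε P Q) : Close ε Q P := by
  intro f hf
  have key : ∀ R : PMF α, expect R f + expect R (fun a => 1 - f a) = 1 := fun R => by
    rw [← expect_add]
    simp only [add_tsub_cancel_of_le (hf _), expect_const]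
  have h1 := h (fun a => 1 - f a) fun a => tsub_le_self
  have hfin : expect P (fun a => 1 - f a) ≠ ∞ :=
    ((expect_le_one P fun a => tsub_le_self).trans_lt ENNReal.one_lt_top).ne
  have hfin' : expect Q (fun a => 1 - f a) ≠ ∞ :=
    ((expect_le_one Q fun a => tsub_le_self).trans_lt ENNReal.one_lt_top).ne
  refine (ENNReal.add_le_add_iff_right hfin').mp ?_
  rw [key Q, add_assoc, add_comm ε]
  refine (key P).ge.trans ?_
  gcongr

theorem trans (h : Close ε P Q) (h' : Close ε' Q R) : Close (ε + ε') P R := fun f hf =>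
  (h f hf).trans <| by
    rw [add_comm ε, ← add_assoc]
    gcongr
    exact h' f hf

theorem mono (h : Close ε P Q) (hε : ε ≤ ε') : Close ε' P Q := fun f hf =>
  (h f hf).trans (by gcongr)

theorem bind_right (P : PMF α) {F G : α → PMF β} (h : ∀ a, Close ε (F a) (G a)) :
    Close ε (P.bind F) (P.bind G) := fun f hf => by
  rw [expect_bind, expect_bind, ← expect_const P ε, ← expect_add]
  exact expect_mono P fun a => h a f hf

theorem bind (h : Close ε P Q) {F G : α → PMF β} (h' : ∀ a, Close ε' (F a) (G a)) :
    Close (ε + ε') (P.bind F) (Q.bind G) := by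
  refine trans (Q := Q.bind F) (fun f hf => ?_) (bind_right Q h')
  rw [expect_bind, expect_bind]
  exact h _ fun a => expect_le_one _ hf

theorem map (h : Close ε P Q) (g : α → β) : Close ε (P.map g) (Q.map g) := by
  have := h.bind (ε' := 0) (F := PMF.pure ∘ g) (G := PMF.pure ∘ g) fun a => refl _
  rwa [add_zero] at this

end Close

/-! ### Rejection sampling is almost uniform -/

/-- The result of rejection sampling as a residue. -/
def samp (p : ℕ) {W K : ℕ} (k : Fin K × Fin W → Bool) : ZMod p :=
  (sampNat p K fun i j => k (i, j) : ℕ)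

theorem samp_val {p W K : ℕ} [NeZero p] (k : Fin K × Fin W → Bool) :
    (samp p k).val = sampNat p K fun i j => k (i, j) := by
  rw [samp, ZMod.val_natCast, Nat.mod_eq_of_lt (sampNat_lt (NeZero.pos p) _ _)]

/-- Numbers of `W` bits. -/
def bitsEquiv (W : ℕ) : Bits W ≃ Fin (2 ^ W) where
  toFun b := ⟨Nat.ofBits b, Nat.ofBits_lt_two_pow b⟩
  invFun a := encNat W a
  left_inv b := encNat_ofBits b
  right_inv a := Fin.ext (by
    simp only [ofBits_encNat, Nat.mod_eq_of_lt a.2])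

theorem sum_bits_ite {p W : ℕ} [NeZero p] (hp : p ≤ 2 ^ W) (f : ZMod p → ℝ≥0∞) (c : ℝ≥0∞) :
    ∑ b : Bits W, (if Nat.ofBits b < p then f (Nat.ofBits b : ℕ) else c) =
      (∑ a, f a) + (2 ^ W - p : ℕ) * c := by
  have h1 : ∑ b : Bits W, (if Nat.ofBits b < p then f (Nat.ofBits b : ℕ) else c) =
      ∑ a : Fin (2 ^ W), (if (a : ℕ) < p then f ((a : ℕ) : ZMod p) else c) :=
    (bitsEquiv W).sum_comp fun a : Fin (2 ^ W) =>
      (if (a : ℕ) < p then f ((a : ℕ) : ZMod p) else c)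
  have h2 : ∑ a : ZMod p, f a = ∑ a ∈ Finset.range p, f ((a : ℕ) : ZMod p) := by
    refine (Finset.sum_bij' (fun a _ => a.val) (fun a _ => (a : ZMod p)) ?_ ?_ ?_ ?_ ?_)
    · intro a _; exact Finset.mem_range.mpr (ZMod.val_lt a)
    · intro a _; exact Finset.mem_univ _
    · intro a _; exact ZMod.natCast_zmod_val a
    · intro a ha; exact ZMod.val_natCast_of_lt (Finset.mem_range.mp ha)
    · intro a _; rw [ZMod.natCast_zmod_val]
  rw [h1, h2, Fin.sum_univ_eq_sum_range (fun a => if a < p then f ((a : ℕ) : ZMod p) else c),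
    ← Finset.sum_range_add_sum_Ico _ hp]
  congr 1
  · exact Finset.sum_congr rfl fun a ha => if_pos (Finset.mem_range.mp ha)
  · rw [Finset.sum_congr rfl fun a ha => if_neg (not_lt.mpr (Finset.mem_Ico.mp ha).1)]
    simp

/-- The error of rejection sampling with `K` tries. -/
def sampError (K : ℕ) : ℝ≥0∞ := (7 / 8 : ℝ≥0∞) ^ K

/-- An accepted number is exactly uniform below `p`, and by `2 ^ W ≤ 8 * p` a round rejects with
probability at most `7 / 8`. Conditioning on the first round gives the factor in the error for each
further round; with no rounds the error is 1. -/
theorem close_samp_aux {p W : ℕ} [NeZero p] (hp : p ≤ 2 ^ W) (hp' : 2 ^ W ≤ 8 * p) (K : ℕ) :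
    Close (sampError K) (PMF.uniformOfFintype (ZMod p))
      ((PMF.uniformOfFintype (Fin K → Bits W)).map fun k => (sampNat p K k : ZMod p)) := by
  intro f hf
  induction K with
  | zero => simpa [sampError] using (expect_le_one _ hf).trans le_add_self
  | succ K ih =>
    set U := expect (PMF.uniformOfFintype (ZMod p)) f with hU
    -- If a rejected round were continued with an exact sample, the mean of `f` would be exactly
    -- `U`; only the continuation after a rejection has to be compared.
    have h1 : expect (PMF.uniformOfFintype (Bits W))
        (fun b => if Nat.ofBits b < p then f (Nat.ofBits b : ℕ) else U) = U := by
      rw [expect_uniform, sum_bits_ite hp]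
      have : ∑ a, f a = p * U := by
        rw [hU, expect_uniform, ZMod.card, ← mul_assoc, ENNReal.mul_inv_cancel, one_mul]
        · exact_mod_cast NeZero.ne p
        · exact ENNReal.natCast_ne_top _
      rw [this, ← add_mul, ← Nat.cast_add, Nat.add_sub_cancel' hp, ← mul_assoc]
      have hc : Fintype.card (Bits W) = 2 ^ W := by simp
      rw [hc, ENNReal.inv_mul_cancel, one_mul]
      · exact_mod_cast (by positivity : (2 ^ W : ℕ) ≠ 0)
      · exact ENNReal.natCast_ne_top _
    have h2 : expect (PMF.uniformOfFintype (Bits W))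
        (fun b => if Nat.ofBits b < p then 0 else 1) ≤ 7 / 8 := by
      have h : ∑ b : Bits W, (if Nat.ofBits b < p then (0 : ℝ≥0∞) else 1) = _ :=
        sum_bits_ite hp (fun _ => 0) 1
      rw [expect_uniform, h]
      simp only [Finset.sum_const_zero, zero_add, mul_one]
      have hc : Fintype.card (Bits W) = 2 ^ W := by simp
      rw [hc, mul_comm, ← div_eq_mul_inv]
      rw [ENNReal.div_le_iff (by exact_mod_cast (by positivity : (2 ^ W : ℕ) ≠ 0))
        (ENNReal.natCast_ne_top _), mul_comm, ← mul_div_assoc,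
        ENNReal.le_div_iff_mul_le (by simp) (by simp)]
      exact_mod_cast (by omega : (2 ^ W - p) * 8 ≤ 2 ^ W * 7)
    have h3 : expect ((PMF.uniformOfFintype (Fin (K + 1) → Bits W)).map
          fun k => (sampNat p (K + 1) k : ZMod p)) f =
        expect (PMF.uniformOfFintype (Bits W)) fun b =>
          if Nat.ofBits b < p then f (Nat.ofBits b : ℕ) else
            expect ((PMF.uniformOfFintype (Fin K → Bits W)).map
              fun k => (sampNat p K k : ZMod p)) f := by
      rw [PMF.map, uniform_bind_equiv (Fin.consEquiv fun _ : Fin (K + 1) => Bits W),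
        uniform_bind_prod, expect_bind]
      congr 1
      funext b
      simp only [expect_bind, expect_map, Function.comp, expect_pure, Fin.consEquiv_apply,
        sampNat, Fin.cons_zero]
      split_ifs with h
      · simp
      · rfl
    rw [h3]
    conv_lhs => rw [← h1]
    calc _ ≤ expect (PMF.uniformOfFintype (Bits W)) (fun b =>
          (if Nat.ofBits b < p then f (Nat.ofBits b : ℕ) else
            expect ((PMF.uniformOfFintype (Fin K → Bits W)).map
              fun k => (sampNat p K k : ZMod p)) f) +
          (if Nat.ofBits b < p then 0 else 1) * sampError K) := by
          refine expect_mono _ fun b => ?_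
          split_ifs
          · simp
          · simpa using ih
      _ ≤ _ := by
          rw [expect_add, expect_mul_const, sampError, sampError, pow_succ, mul_comm ((7 / 8) ^ K)]
          gcongr

theorem uniform_map_uncurry (I J : Type) [Fintype I] [Fintype J] [DecidableEq I]
    [DecidableEq J] :
    (PMF.uniformOfFintype (I × J → Bool)).map (fun k i j => k (i, j)) =
      PMF.uniformOfFintype (I → J → Bool) :=
  uniform_map_equiv (Equiv.curry I J Bool)

theorem close_samp {p W : ℕ} [NeZero p] (hp : p ≤ 2 ^ W) (hp' : 2 ^ W ≤ 8 * p) (K : ℕ) :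
    Close (sampError K) ((PMF.uniformOfFintype (Fin K × Fin W → Bool)).map (samp p))
      (PMF.uniformOfFintype (ZMod p)) := by
  have := (close_samp_aux hp hp' K).symm
  rw [← uniform_map_uncurry, PMF.map_comp] at this
  exact this

/-- One more independent almost uniform sample. -/
theorem Close.pi_option {A B I : Type} [Fintype A] [Nonempty A] [Fintype B] [Nonempty B]
    [Fintype (I → A)] [Fintype (I → B)] [Fintype (Option I → A)] [Fintype (Option I → B)]
    {ε ε' : ℝ≥0∞} (R : A → B)
    (h : Close ε ((PMF.uniformOfFintype A).map R) (PMF.uniformOfFintype B))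
    (ih : Close ε' ((PMF.uniformOfFintype (I → A)).map fun k i => R (k i))
      (PMF.uniformOfFintype (I → B))) :
    Close (ε + ε') ((PMF.uniformOfFintype (Option I → A)).map fun k i => R (k i))
      (PMF.uniformOfFintype (Option I → B)) := by
  have h1 := h.bind (fun b => ih.map fun k (i : Option I) => i.elim b k)
  have h2 : (PMF.uniformOfFintype (Option I → A)).map (fun k i => R (k i)) =
      ((PMF.uniformOfFintype A).map R).bind fun b =>
        ((PMF.uniformOfFintype (I → A)).map fun k i => R (k i)).map
          fun k (i : Option I) => i.elim b k := by
    rw [PMF.map, uniform_bind_option, PMF.bind_map]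
    congr 1; funext a
    rw [Function.comp, PMF.map_comp, PMF.map]
    congr 1; funext k
    refine congrArg PMF.pure (funext fun i => ?_)
    cases i <;> rfl
  have h3 : PMF.uniformOfFintype (Option I → B) =
      (PMF.uniformOfFintype B).bind fun b =>
        (PMF.uniformOfFintype (I → B)).map fun k (i : Option I) => i.elim b k := by
    rw [← PMF.bind_pure (PMF.uniformOfFintype (Option I → B)), uniform_bind_option]
    rfl
  rw [h2, h3]
  exact h1

/-- Independent almost uniform samples. -/
theorem Close.pi {A B : Type} [Fintype A] [Nonempty A] [Fintype B] [Nonempty B] {ε : ℝ≥0∞}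
    (R : A → B) (h : Close ε ((PMF.uniformOfFintype A).map R) (PMF.uniformOfFintype B))
    (I : Type) [Fintype I] [DecidableEq I] :
    Close (Fintype.card I * ε) ((PMF.uniformOfFintype (I → A)).map fun k i => R (k i))
      (PMF.uniformOfFintype (I → B)) := by
  suffices H : ∀ (I : Type) [Fintype I], ∀ [DecidableEq I],
      Close (Fintype.card I * ε) ((PMF.uniformOfFintype (I → A)).map fun k i => R (k i))
        (PMF.uniformOfFintype (I → B)) from H I
  intro I _
  refine Fintype.induction_empty_option (P := fun I [Fintype I] => ∀ [DecidableEq I],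
    Close (Fintype.card I * ε) ((PMF.uniformOfFintype (I → A)).map fun k i => R (k i))
      (PMF.uniformOfFintype (I → B))) ?_ ?_ ?_ I
  · intro I I' _ e ih _
    let _ := Fintype.ofEquiv I' e.symm
    classical
    have h1 := ih.map (Equiv.arrowCongr e (Equiv.refl B))
    rw [uniform_map_equiv, PMF.map_comp] at h1
    rw [← uniform_map_equiv (Equiv.arrowCongr e (Equiv.refl A)), PMF.map_comp]
    refine Close.mono (ε := Fintype.card I * ε) h1 (le_of_eq ?_)
    rw [@Fintype.card_congr I I' _ _ e]
  · intro _
    have : ∀ P Q : PMF (PEmpty.{1} → B), P = Q := fun P Q => by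
      ext a
      have h1 := P.tsum_coe
      have h2 := Q.tsum_coe
      rw [tsum_fintype, Fintype.sum_unique, Subsingleton.elim default a] at h1 h2
      rw [h1, h2]
    exact (of_eq (this _ _)).mono (zero_le)
  · intro I _ ih _
    classical
    rw [Fintype.card_option, Nat.cast_add, Nat.cast_one, add_mul, one_mul, add_comm]
    exact h.pi_option R ih

/-- Replacing one of several independent uniform values by a fresh uniform value. -/
theorem uniform_bind_update {I B C : Type} [Fintype I] [DecidableEq I] [Fintype B] [Nonempty B]
    (i : I) (F : (I → B) → PMF C) :
    ((PMF.uniformOfFintype B).bind fun b => (PMF.uniformOfFintype (I → B)).bind fun k =>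
      F (Function.update k i b)) = (PMF.uniformOfFintype (I → B)).bind F := by
  classical
  rw [uniform_bind_equiv (Equiv.funSplitAt i B).symm F, uniform_bind_prod]
  congr 1; funext b
  rw [uniform_bind_equiv (Equiv.funSplitAt i B).symm, uniform_bind_prod]
  -- The old value of the coordinate `i` is overwritten, so averaging over it has no effect.
  have : ∀ (c : B) (k : {j // j ≠ i} → B),
      Function.update ((Equiv.funSplitAt i B).symm (c, k)) i b =
        (Equiv.funSplitAt i B).symm (b, k) := by
    intro c k
    funext j
    by_cases h : j = i
    · subst h; simp
    · simp [h]
  simp only [this]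
  exact uniform_bind_const _

/-! ### The random oracle -/

section RandomOracle

variable {σ : ℕ}

instance : IsProbabilityMeasure (roLaw σ) := by unfold roLaw; infer_instance

theorem lintegral_toMeasure {α : Type} [Fintype α] [MeasurableSpace α]
    [MeasurableSingletonClass α] (P : PMF α) (f : α → ℝ≥0∞) :
    ∫⁻ a, f a ∂P.toMeasure = expect P f := by
  rw [lintegral_fintype, expect, tsum_fintype]
  refine Finset.sum_congr rfl fun a _ => ?_
  rw [PMF.toMeasure_apply_singleton _ _ (measurableSet_singleton a), mul_comm]

/-- The value of a random oracle at one point may be sampled afresh. -/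
theorem lintegral_roLaw_update (q : List Bool) {F : Oracle σ → ℝ≥0∞} (hF : Measurable F) :
    ∫⁻ H, F H ∂roLaw σ = ∫⁻ H, expect (PMF.uniformOfFintype (Bits σ))
      (fun u => F (Function.update H q u)) ∂roLaw σ := by
  set U : Measure (Bits σ) := (PMF.uniformOfFintype (Bits σ)).toMeasure with hU
  have hm : Measurable fun p : Oracle σ × Bits σ => Function.update p.1 q p.2 :=
    measurable_update'
  -- Overwriting one coordinate by an independent value of the same law preserves the product
  -- measure; it suffices to check this on finite boxes, according to whether they constrain the
  -- coordinate `q`.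
  have h : ((roLaw σ).prod U).map (fun p : Oracle σ × Bits σ => Function.update p.1 q p.2) =
      roLaw σ := by
    refine Measure.eq_infinitePi _ fun s t ht => ?_
    rw [Measure.map_apply hm (MeasurableSet.pi s.countable_toSet fun i _ => ht i)]
    by_cases hq : q ∈ s
    · have : (fun p : Oracle σ × Bits σ => Function.update p.1 q p.2) ⁻¹' (Set.pi s t) =
          (Set.pi (s.erase q : Finset _) t) ×ˢ t q := by
        ext ⟨H, u⟩
        simp only [Set.mem_preimage, Set.mem_pi, Finset.mem_coe, Set.mem_prod, Finset.mem_erase]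
        constructor
        · intro h
          refine ⟨fun i hi => ?_, by simpa using h q hq⟩
          simpa [hi.1] using h i hi.2
        · rintro ⟨h1, h2⟩ i hi
          by_cases hiq : i = q
          · subst hiq; simpa using h2
          · simpa [hiq] using h1 i ⟨hiq, hi⟩
      rw [this, Measure.prod_prod, roLaw, Measure.infinitePi_pi _ fun i _ => ht i,
        Finset.prod_erase_mul _ _ hq]
    · have : (fun p : Oracle σ × Bits σ => Function.update p.1 q p.2) ⁻¹' (Set.pi s t) =
          (Set.pi s t) ×ˢ Set.univ := by
        ext ⟨H, u⟩
        simp only [Set.mem_preimage, Set.mem_pi, Finset.mem_coe, Set.mem_prod, Set.mem_univ,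
          and_true]
        refine forall₂_congr fun i hi => ?_
        rw [Function.update_of_ne]
        rintro rfl
        exact hq hi
      rw [this, Measure.prod_prod, roLaw, Measure.infinitePi_pi _ fun i _ => ht i, measure_univ,
        mul_one]
  conv_lhs => rw [← h]
  rw [lintegral_map hF hm, lintegral_prod (fun p : Oracle σ × Bits σ =>
    F (Function.update p.1 q p.2)) (hF.comp hm).aemeasurable]
  simp only [hU, lintegral_toMeasure]

theorem expect_lintegral {α : Type} [Countable α] (P : PMF α) {F : α → Oracle σ → ℝ≥0∞}
    (hF : ∀ a, Measurable (F a)) :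
    (expect P fun a => ∫⁻ H, F a H ∂roLaw σ) = ∫⁻ H, expect P (fun a => F a H) ∂roLaw σ := by
  unfold expect
  rw [lintegral_tsum fun a => ((hF a).const_mul _).aemeasurable]
  simp only [lintegral_const_mul _ (hF _)]

theorem measurable_expect {α : Type} [Countable α] (P : PMF α) {F : α → Oracle σ → ℝ≥0∞}
    (hF : ∀ a, Measurable (F a)) : Measurable fun H => expect P fun a => F a H := by
  unfold expect
  exact Measurable.tsum fun a => (hF a).const_mul _

/-- The oracle enters both as a parameter and through its value at `q`. There are only countably
many possible answers, so measurability for each fixed answer gives joint measurability. -/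
theorem measurable_apply_oracle {F : Oracle σ → Bits σ → ℝ≥0∞} (hF : ∀ u, Measurable (F · u))
    {q : List Bool} : Measurable fun H => F H (H q) := by
  have h1 : Measurable fun p : Oracle σ × Bits σ => F p.1 p.2 :=
    measurable_from_prod_countable_left hF
  exact h1.comp (measurable_id.prodMk (measurable_pi_apply q))

theorem Circuit.measurable_eval {κ ι : Type} (c : Circuit σ κ ι) (x : ι → Bool) (w : κ → Bool) :
    Measurable fun H => c.eval H x w := by
  induction c with
  | out f => exact measurable_const
  | const b k ih => exact ih (addWire x b)
  | gate f i j k ih => exact ih (addWire x (f (x i) (x j)))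
  | coin k ih =>
    simp only [Circuit.eval, bind_apply_eq_expect]
    exact measurable_expect _ fun b => ih (addWire x b)
  | query q k ih =>
    exact measurable_apply_oracle (F := fun H u => k.eval H (Sum.elim x u) w) fun u => ih _

end RandomOracle

/-! ### Lazy sampling -/

section Lazy

variable {σ : ℕ}

/-- The oracle with the values in a table replaced. -/
def override : List (List Bool × Bits σ) → Oracle σ → Oracle σ
  | [], H => H
  | e :: L, H => Function.update (override L H) e.1 e.2

/-- Look up the value at `q` in a table, with default value `u`. -/
def lookup : List (List Bool × Bits σ) → List Bool → Bits σ → Bits σ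
  | [], _, u => u
  | e :: L, q, u => if q = e.1 then e.2 else lookup L q u

theorem lookup_of_mem {L : List (List Bool × Bits σ)} {q : List Bool} (h : q ∈ L.map Prod.fst)
    (u : Bits σ) (H : Oracle σ) : lookup L q u = override L H q := by
  induction L with
  | nil => simp at h
  | cons e L ih =>
    unfold lookup override
    by_cases hq : q = e.1
    · rw [if_pos hq, hq, Function.update_self]
    · rw [if_neg hq, Function.update_of_ne hq]
      exact ih (by simpa [hq] using h)

theorem lookup_of_notMem {L : List (List Bool × Bits σ)} {q : List Bool}
    (h : q ∉ L.map Prod.fst) (u : Bits σ) : lookup L q u = u := by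
  induction L with
  | nil => rfl
  | cons e L ih =>
    simp only [List.map_cons, List.mem_cons, not_or] at h
    rw [lookup, if_neg h.1, ih h.2]

theorem override_update {L : List (List Bool × Bits σ)} {q : List Bool}
    (h : q ∉ L.map Prod.fst) (u : Bits σ) (H : Oracle σ) :
    override L (Function.update H q u) = Function.update (override L H) q u := by
  induction L with
  | nil => rfl
  | cons e L ih =>
    simp only [List.map_cons, List.mem_cons, not_or] at h
    rw [override, override, ih h.2, Function.update_comm h.1]

theorem measurable_override (L : List (List Bool × Bits σ)) : Measurable (override L) := by
  induction L with
  | nil => exact measurable_id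
  | cons e L ih =>
    refine measurable_pi_iff.mpr fun q => ?_
    by_cases hq : q = e.1
    · subst hq; simp [override]
    · simp only [override, Function.update_of_ne hq]
      exact (measurable_pi_apply q).comp ih

/-- A query to an oracle with some known values is answered from the table of these values, or
else by fresh coins. -/
theorem lintegral_override (L : List (List Bool × Bits σ)) (q : List Bool)
    {G : Oracle σ → Bits σ → ℝ≥0∞} (hG : ∀ u, Measurable (G · u)) :
    ∫⁻ H, G (override L H) (override L H q) ∂roLaw σ =
      ∫⁻ H, expect (PMF.uniformOfFintype (Bits σ))
        (fun u => G (override ((q, lookup L q u) :: L) H) (lookup L q u)) ∂roLaw σ := by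
  -- A repeated query is determined by the table and the fresh string is ignored; entering it again
  -- changes nothing. At a new point the value of `H` is resampled and recorded.
  by_cases hq : q ∈ L.map Prod.fst
  · refine lintegral_congr fun H => ?_
    simp only [lookup_of_mem hq _ H, override, Function.update_eq_self, expect_const]
  · rw [lintegral_roLaw_update q]
    · refine lintegral_congr fun H => ?_
      simp only [lookup_of_notMem hq, override_update hq, override, Function.update_self]
    · exact (measurable_apply_oracle hG).comp (measurable_override L)

/-- A table of queries and answers, given by the wires that carry them. -/
abbrev Table (σ : ℕ) (ι : Type) : Type := List (List ι × (Fin σ → ι))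

/-- The bits of a table. -/
def Table.val {ι : Type} (T : Table σ ι) (x : ι → Bool) : List (List Bool × Bits σ) :=
  T.map fun e => (e.1.map x, fun i => x (e.2 i))

/-- Rename the wires of a table. -/
def Table.rename {ι ι' : Type} (T : Table σ ι) (g : ι → ι') : Table σ ι' :=
  T.map fun e => (e.1.map g, fun i => g (e.2 i))

theorem Table.val_rename {ι ι' : Type} (T : Table σ ι) (g : ι → ι') (x : ι' → Bool) :
    (T.rename g).val x = T.val (x ∘ g) := by
  simp [Table.val, Table.rename, List.map_map, Function.comp_def]

theorem Table.length_rename {ι ι' : Type} (T : Table σ ι) (g : ι → ι') :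
    (T.rename g).length = T.length := List.length_map _

/-- A lookup needs only equality tests and multiplexers, hence the zero-bit oracle. The input
consists of the existing wires and a fresh candidate answer, used as the default value. -/
theorem Table.det_lookup {ι : Type} (T : Table σ ι) (q : List ι) :
    Det (σ := 0) (Ω := (ι → Bool) × Bits σ) (fun _ _ => Fin.elim0)
      (fun ω => Sum.elim ω.1 ω.2) (fun ω => lookup (T.val ω.1) (q.map ω.1) ω.2)
      (T.length * (4 * q.length + 4 + 3 * σ)) := by
  induction T with
  | nil => exact (Det.select Sum.inr).mono (Nat.zero_le _)
  | cons e T ih =>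
    refine ((Det.ite (Det.decide_map_eq (q.map Sum.inl) (e.1.map Sum.inl))
      (Det.select fun i => Sum.inl (e.2 i)) ih).mono ?_).congr fun ω i => ?_
    · simp only [List.length_map, Fintype.card_fin, List.length_cons]
      rw [add_mul _ 1]; omega
    · simp only [Table.val, List.map_cons, lookup, List.map_map, Sum.elim_comp_inl,
        decide_eq_true_eq, Sum.elim_inl]
      split_ifs <;> rfl

/-- Lazy sampling. The gates of a straight-line program come in a fixed order, so the wires carrying
earlier queries and answers are known when the new circuit is built: the table is a list of wires,
and only the equality tests happen at run time. Averaging over `H` makes the values outside the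
table fresh and uniform. The invariant `T.length + c.size ≤ N` bounds both the table and the query
lengths, so that every lookup has the same cost bound. -/
theorem Circuit.exists_lazy {κ ι : Type} (c : Circuit σ κ ι) (T : Table σ ι) (N : ℕ)
    (hN : T.length + c.size ≤ N) :
    ∃ c' : PlainCircuit κ ι, c'.size ≤ c.size * (σ + N * (4 * N + 4 + 3 * σ) + 1) ∧
      ∀ x w, c'.run x w = ∫⁻ H, c.eval (override (T.val x) H) x w ∂roLaw σ := by
  have hsome : ∀ {ι : Type} (x : ι → Bool) (b : Bool), addWire x b ∘ some = x := fun _ _ => rfl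
  induction c with
  | out f => exact ⟨.out f, Nat.zero_le _, fun x w => by
      simp [PlainCircuit.run, Circuit.eval]⟩
  | const b k ih =>
    obtain ⟨k', hk, h⟩ := ih (T.rename some) (by
      rw [Table.length_rename]; simp only [Circuit.size] at hN; omega)
    refine ⟨.const b k', ?_, fun x w => ?_⟩
    · simp only [Circuit.size]; rw [add_mul]; omega
    · exact (h _ _).trans (by rw [Table.val_rename, hsome]; rfl)
  | gate f i j k ih =>
    obtain ⟨k', hk, h⟩ := ih (T.rename some) (by
      rw [Table.length_rename]; simp only [Circuit.size] at hN; omega)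
    refine ⟨.gate f i j k', ?_, fun x w => ?_⟩
    · simp only [Circuit.size]; rw [add_mul]; omega
    · exact (h _ _).trans (by rw [Table.val_rename, hsome]; rfl)
  | coin k ih =>
    obtain ⟨k', hk, h⟩ := ih (T.rename some) (by
      rw [Table.length_rename]; simp only [Circuit.size] at hN; omega)
    refine ⟨.coin k', ?_, fun x w => ?_⟩
    · simp only [Circuit.size]; rw [add_mul]; omega
    · have : (PlainCircuit.run (.coin k') x) w =
          expect (PMF.uniformOfFintype Bool) fun b => PlainCircuit.run k' (addWire x b) w := rfl
      rw [this]
      simp only [h, Table.val_rename, hsome]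
      rw [expect_lintegral]
      · rfl
      · exact fun b => (Circuit.measurable_eval _ _ _).comp (measurable_override _)
  | query q k ih =>
    simp only [Circuit.size] at hN
    obtain ⟨k', hk, h⟩ := ih ((q.map Sum.inl, Sum.inr) :: T.rename Sum.inl) (by
      rw [List.length_cons, Table.length_rename]; omega)
    obtain ⟨d, hd, hd'⟩ := T.det_lookup q
    obtain ⟨e, he, he'⟩ := Circuit.exists_coins 0 (Fin σ) _
    -- An oracle gate becomes: toss a candidate answer, replace it by the stored one if the query is
    -- in the table, and go on with the table extended by this entry.
    refine ⟨(e.andThen d).andThen k', ?_, fun x w => ?_⟩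
    · rw [Circuit.size_andThen, Circuit.size_andThen, he, Fintype.card_fin]
      simp only [Circuit.size]
      have h1 : T.length * (4 * q.length + 4 + 3 * σ) ≤ N * (4 * N + 4 + 3 * σ) := by
        gcongr <;> omega
      rw [add_mul, add_mul]
      have h2 : 0 ≤ q.length * (σ + N * (4 * N + 4 + 3 * σ) + 1) := Nat.zero_le _
      omega
    · have h0 : ∀ u, PMF.bind (PMF.pure u) (fun a => PlainCircuit.run k' (Sum.elim x a)) w =
          PlainCircuit.run k' (Sum.elim x u) w := fun u => by rw [PMF.pure_bind]
      have : PlainCircuit.run ((e.andThen d).andThen k') x w =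
          expect (PMF.uniformOfFintype (Bits σ)) fun u =>
            PlainCircuit.run k' (Sum.elim x (lookup (T.val x) (q.map x) u)) w := by
        have hd'' := fun u => hd' (x, u)
        simp only at hd''
        rw [PlainCircuit.run, Circuit.eval_andThen, Circuit.eval_andThen, he', PMF.bind_bind,
          bind_apply_eq_expect]
        congr 1
        funext u
        have h3 : Circuit.eval (fun _ => Fin.elim0) d (Sum.elim x u) =
          PMF.pure (lookup (T.val x) (q.map x) u) := hd'' u
        exact (congrArg (fun P => PMF.bind P _ w) h3).trans (h0 _)
      have hT : ∀ a : Bits σ, Table.val ((q.map Sum.inl, Sum.inr) :: T.rename Sum.inl)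
          (Sum.elim x a) = (q.map x, a) :: T.val x := fun a => by
        have := Table.val_rename T Sum.inl (Sum.elim x a)
        rw [Sum.elim_comp_inl] at this
        rw [← this]
        simp [Table.val]
      rw [this]
      simp only [h, hT]
      rw [expect_lintegral]
      · exact (lintegral_override (T.val x) (q.map x)
          (G := fun H u => k.eval H (Sum.elim x u) w)
          fun u => Circuit.measurable_eval _ _ _).symm
      · exact fun b => (Circuit.measurable_eval _ _ _).comp (measurable_override _)

end Lazy

/-! ### The queries of a circuit -/

namespace Circuit

variable {σ : ℕ} {κ : Type}

/-- The circuit that outputs the `j`-th query of a given circuit, if that query has length `ℓ`. -/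
def jthQuery (ℓ : ℕ) : {ι : Type} → Circuit σ κ ι → ℕ → Circuit σ (Fin ℓ) ι
  -- If there is no `j`-th query, or one of the wrong length, a default string is returned; a
  -- spurious output can only enlarge the bound in `eval_le_of_agree`.
  | _, .out _, _ => .const false (.out fun _ => none)
  | _, .const b k, j => .const b (k.jthQuery ℓ j)
  | _, .gate f i i' k, j => .gate f i i' (k.jthQuery ℓ j)
  | _, .coin k, j => .coin (k.jthQuery ℓ j)
  | _, .query q _, 0 =>
    if h : q.length = ℓ then .out fun i => q.get (i.cast h.symm) else
      .const false (.out fun _ => none)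
  | _, .query q k, j + 1 => .query q (k.jthQuery ℓ j)

theorem size_jthQuery (ℓ : ℕ) {ι : Type} (c : Circuit σ κ ι) (j : ℕ) :
    (c.jthQuery ℓ j).size ≤ c.size + 1 := by
  induction c generalizing j with
  | out f => exact le_rfl
  | const b k ih => simpa only [jthQuery, size] using Nat.add_le_add_right (ih j) 1
  | gate f i i' k ih => simpa only [jthQuery, size] using Nat.add_le_add_right (ih j) 1
  | coin k ih => simpa only [jthQuery, size] using Nat.add_le_add_right (ih j) 1
  | query q k ih =>
    cases j with
    | zero => unfold jthQuery; split_ifs <;> simp [size]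
    | succ j => have := ih j; simp only [jthQuery, size]; omega

/-- Two oracles that differ at one point only cannot be told apart unless this point is queried. -/
theorem eval_le_of_agree {ℓ : ℕ} {e : Fin ℓ → Bool} {H H' : Oracle σ}
    (hH : ∀ q, q ≠ List.ofFn e → H q = H' q) {ι : Type} (c : Circuit σ κ ι) (x : ι → Bool)
    (w : κ → Bool) {N : ℕ} (hN : c.size ≤ N) :
    c.eval H x w ≤ c.eval H' x w + ∑ j ∈ Finset.range N, (c.jthQuery ℓ j).eval H x e ∧
    c.eval H' x w ≤ c.eval H x w + ∑ j ∈ Finset.range N, (c.jthQuery ℓ j).eval H x e := by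
  induction c generalizing N with
  | out f => exact ⟨le_self_add, le_self_add⟩
  | const b k ih => exact ih _ (by simp only [size] at hN; omega)
  | gate f i i' k ih => exact ih _ (by simp only [size] at hN; omega)
  | coin k ih =>
    have hN' : k.size ≤ N := by simp only [size] at hN; omega
    simp only [eval, jthQuery, bind_apply_eq_expect, ← expect_finset_sum, ← expect_add]
    exact ⟨expect_mono _ fun b => (ih _ hN').1, expect_mono _ fun b => (ih _ hN').2⟩
  | query q k ih =>
    simp only [size] at hN
    obtain ⟨N, rfl⟩ : ∃ N', N = N' + 1 := ⟨N - 1, by omega⟩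
    rw [Finset.sum_range_succ']
    -- If this gate asks the critical point, the term `j = 0` equals 1 and dominates everything.
    -- Otherwise both oracles give the same answer and the remaining queries have shifted indices.
    -- The queries are always counted in the run with `H`, also in the second inequality.
    by_cases hq : q.map x = List.ofFn e
    · have hℓ : q.length = ℓ := by simpa using congrArg List.length hq
      have h1 : ((query q k).jthQuery ℓ 0).eval H x e = 1 := by
        simp only [jthQuery, hℓ, dif_pos, eval]
        have : e = fun i => x (q.get (i.cast hℓ.symm)) := by
          subst hℓ
          funext i
          have h2 : (q.map x)[(i : ℕ)]'(by simp) = (List.ofFn e)[(i : ℕ)]'(by simp) := by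
            simp only [hq]
          simpa using h2.symm
        rw [PMF.pure_apply, if_pos this]
      rw [h1]
      exact ⟨(PMF.coe_le_one _ _).trans (le_add_self.trans le_add_self),
        (PMF.coe_le_one _ _).trans (le_add_self.trans le_add_self)⟩
    · have h2 := ih (Sum.elim x (H (q.map x))) (N := N) (by omega)
      simp only [eval, jthQuery, ← hH _ hq]
      rw [← add_assoc, ← add_assoc]
      exact ⟨h2.1.trans le_self_add, h2.2.trans le_self_add⟩

end Circuit

/-! ### Negligible functions -/

theorem Negligible.mono {ε δ : ℕ → ℝ} (h : Negligible δ) (h0 : ∀ n, 0 ≤ ε n)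
    (hε : ∀ n, ε n ≤ δ n) : Negligible ε :=
  Asymptotics.SuperpolynomialDecay.trans_abs_le h fun n => by
    rw [abs_of_nonneg (h0 n), abs_of_nonneg ((h0 n).trans (hε n))]
    exact hε n

theorem Negligible.add {ε δ : ℕ → ℝ} (h : Negligible ε) (h' : Negligible δ) :
    Negligible fun n => ε n + δ n :=
  Asymptotics.SuperpolynomialDecay.add h h'

theorem Negligible.polyBounded_mul {f : ℕ → ℕ} (hf : PolyBounded f) {ε : ℕ → ℝ}
    (h : Negligible ε) (h0 : ∀ n, 0 ≤ ε n) : Negligible fun n => f n * ε n := by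
  obtain ⟨P, hP⟩ := hf
  have := Asymptotics.SuperpolynomialDecay.polynomial_mul h (P.map (Nat.castRingHom ℝ))
  refine Negligible.mono this (fun n => mul_nonneg (Nat.cast_nonneg _) (h0 n)) fun n => ?_
  refine mul_le_mul_of_nonneg_right ?_ (h0 n)
  have h1 : (P.map (Nat.castRingHom ℝ)).eval (n : ℝ) = (P.eval n : ℕ) := by
    simp
  rw [h1]
  exact_mod_cast hP n

theorem sampError_toReal (K : ℕ) : (sampError K).toReal = (7 / 8 : ℝ) ^ K := by
  simp [sampError]

theorem sampError_ne_top (K : ℕ) : sampError K ≠ ∞ := by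
  unfold sampError
  exact ENNReal.pow_ne_top (ENNReal.div_ne_top (by simp) (by simp))

theorem negligible_sampError : Negligible fun n => (sampError n).toReal := by
  intro k
  simp only [sampError_toReal]
  exact tendsto_pow_const_mul_const_pow_of_abs_lt_one k (by rw [abs_of_pos] <;> norm_num)

/-- A finite sum is at most the number of terms times one of them. -/
theorem exists_sum_le_mul (f : ℕ → ℝ) (N : ℕ) (hN : 0 < N) :
    ∃ j < N, ∑ i ∈ Finset.range N, f i ≤ N * f j := by
  obtain ⟨j, hj, h⟩ := Finset.exists_max_image (Finset.range N) f ⟨0, Finset.mem_range.mpr hN⟩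
  refine ⟨j, Finset.mem_range.mp hj, ?_⟩
  simpa using Finset.sum_le_card_nsmul (Finset.range N) f (f j) h

/-! ### Computational indistinguishability -/

section CompIndist

variable {σ : ℕ → ℕ} {ι : ℕ → Type}

theorem toReal_abs_sub_le {a b ε : ℝ≥0∞} (h1 : a ≤ b + ε) (h2 : b ≤ a + ε) (ha : a ≠ ∞)
    (hb : b ≠ ∞) (hε : ε ≠ ∞) : |a.toReal - b.toReal| ≤ ε.toReal := by
  have h1' := ENNReal.toReal_mono (ENNReal.add_ne_top.mpr ⟨hb, hε⟩) h1
  have h2' := ENNReal.toReal_mono (ENNReal.add_ne_top.mpr ⟨ha, hε⟩) h2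
  rw [ENNReal.toReal_add hb hε] at h1'
  rw [ENNReal.toReal_add ha hε] at h2'
  rw [abs_le]
  constructor <;> linarith

theorem acceptProb_eq {σ : ℕ} {ι : Type} (D : Circuit σ Unit ι) (X : Oracle σ → PMF (ι → Bool)) :
    acceptProb D X =
      (∫⁻ H, expect (X H) (fun w => D.eval H w fun _ => true) ∂roLaw σ).toReal := rfl

theorem lintegral_roLaw_ne_top {σ : ℕ} {F : Oracle σ → ℝ≥0∞} (hF : ∀ H, F H ≤ 1) :
    ∫⁻ H, F H ∂roLaw σ ≠ ∞ := by
  refine ((lintegral_mono hF).trans_lt ?_).ne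
  simp

theorem accept_ne_top {σ : ℕ} {ι : Type} (D : Circuit σ Unit ι) (X : Oracle σ → PMF (ι → Bool)) :
    ∫⁻ H, expect (X H) (fun w => D.eval H w fun _ => true) ∂roLaw σ ≠ ∞ :=
  lintegral_roLaw_ne_top fun _ => expect_le_one _ fun _ => PMF.coe_le_one _ _

/-- For each fixed oracle the acceptance probability of `D` is a test function with values at most
1; the bound is then averaged over the oracle. -/
theorem abs_acceptProb_sub_le_of_close {σ : ℕ} {ι : Type} (D : Circuit σ Unit ι)
    {X Y : Oracle σ → PMF (ι → Bool)} {ε : ℝ≥0∞} (hε : ε ≠ ∞) (h : ∀ H, Close ε (X H) (Y H)) :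
    |acceptProb D X - acceptProb D Y| ≤ ε.toReal := by
  have key : ∀ {X Y : Oracle σ → PMF (ι → Bool)}, (∀ H, Close ε (X H) (Y H)) →
      ∫⁻ H, expect (X H) (fun w => D.eval H w fun _ => true) ∂roLaw σ ≤
        ∫⁻ H, expect (Y H) (fun w => D.eval H w fun _ => true) ∂roLaw σ + ε := fun {X Y} h => by
    refine (lintegral_mono fun H => h H _ fun _ => PMF.coe_le_one _ _).trans ?_
    rw [lintegral_add_right _ measurable_const]
    simp
  exact toReal_abs_sub_le (key h) (key fun H => (h H).symm) (accept_ne_top _ _)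
    (accept_ne_top _ _) hε

theorem CompIndist.of_close {X Y : ∀ n, Oracle (σ n) → PMF (ι n → Bool)} {ε : ℕ → ℝ≥0∞}
    (hε : ∀ n, ε n ≠ ∞) (hε' : Negligible fun n => (ε n).toReal)
    (h : ∀ n H, Close (ε n) (X n H) (Y n H)) : CompIndist X Y := fun D _ =>
  hε'.mono (fun _ => abs_nonneg _) fun n => abs_acceptProb_sub_le_of_close (D n) (hε n) (h n)

theorem CompIndist.trans {X Y Z : ∀ n, Oracle (σ n) → PMF (ι n → Bool)} (h : CompIndist X Y)
    (h' : CompIndist Y Z) : CompIndist X Z := fun D hD =>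
  ((h D hD).add (h' D hD)).mono (fun _ => abs_nonneg _) fun _ => abs_sub_le _ _ _

/-- A reduction followed by a distinguisher is itself a distinguisher for the input of the
reduction. -/
theorem acceptProb_andThen {σ : ℕ} {ι ι' : Type} (C : Circuit σ ι' ι) (D : Circuit σ Unit ι')
    (X : Oracle σ → PMF (ι → Bool)) :
    acceptProb (C.andThen (D.rename Sum.inr)) X =
      acceptProb D fun H => (X H).bind fun w => C.eval H w := by
  simp only [acceptProb_eq, expect_bind]
  congr 1
  refine lintegral_congr fun H => ?_
  congr 1
  funext w
  rw [Circuit.eval_andThen, bind_apply_eq_expect]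
  simp only [Circuit.eval_rename, Sum.elim_comp_inr]

/-- The hybrid argument. -/
theorem CompIndist.hybrid {ι' : ℕ → Type} {X Y : ∀ n, Oracle (σ n) → PMF (ι n → Bool)}
    (hXY : CompIndist X Y) {N : ℕ → ℕ} (hN : PolyBounded N)
    (C : ∀ n, Fin (N n) → Circuit (σ n) (ι' n) (ι n))
    (hC : PBound (J := Σ n, Fin (N n)) (fun j => j.1) fun j => (C j.1 j.2).size)
    (Z : ∀ n, ℕ → Oracle (σ n) → PMF (ι' n → Bool)) {ε : ℕ → ℝ≥0∞} (hε : ∀ n, ε n ≠ ∞)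
    (hε' : Negligible fun n => (ε n).toReal)
    (hY : ∀ n (k : Fin (N n)) H,
      Close (ε n) (Z n k H) ((Y n H).bind fun w => (C n k).eval H w))
    (hX : ∀ n (k : Fin (N n)) H,
      Close (ε n) (Z n (k + 1) H) ((X n H).bind fun w => (C n k).eval H w)) :
    CompIndist (fun n => Z n 0) (fun n => Z n (N n)) := by
  intro D hD
  obtain ⟨P, hP⟩ := hC
  obtain ⟨Q, hQ⟩ := hD
  -- One distinguisher for each `n` suffices, by non-uniformity. The summand 1 in the size leaves
  -- room for the dummy circuit used when there are no hybrid steps.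
  have key : ∀ n, ∃ E : Circuit (σ n) Unit (ι n), E.size ≤ P.eval n + Q.eval n + 1 ∧
      |acceptProb (D n) (Z n 0) - acceptProb (D n) (Z n (N n))| ≤
        N n * ((ε n).toReal + |acceptProb E (X n) - acceptProb E (Y n)| + (ε n).toReal) := by
    intro n
    rcases Nat.eq_zero_or_pos (N n) with h0 | h0
    · exact ⟨.const true (.out fun _ => none), by simp [Circuit.size], by simp [h0]⟩
    -- The step with the largest gap is hard-wired, and its reduction is combined with the given
    -- distinguisher.
    · obtain ⟨j, hj, h⟩ := exists_sum_le_mul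
        (fun k => |acceptProb (D n) (Z n k) - acceptProb (D n) (Z n (k + 1))|) (N n) h0
      refine ⟨(C n ⟨j, hj⟩).andThen ((D n).rename Sum.inr), ?_, ?_⟩
      · rw [Circuit.size_andThen, Circuit.size_rename]
        exact (Nat.add_le_add (hP ⟨n, ⟨j, hj⟩⟩) (hQ n)).trans (Nat.le_add_right _ _)
      · have h1 : |acceptProb (D n) (Z n 0) - acceptProb (D n) (Z n (N n))| ≤
            ∑ k ∈ Finset.range (N n),
              |acceptProb (D n) (Z n k) - acceptProb (D n) (Z n (k + 1))| := by
          rw [← Finset.sum_range_sub' (fun k => acceptProb (D n) (Z n k)) (N n)]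
          exact Finset.abs_sum_le_sum_abs _ _
        refine (h1.trans h).trans (mul_le_mul_of_nonneg_left ?_ (Nat.cast_nonneg _))
        rw [acceptProb_andThen, acceptProb_andThen]
        have h2 := abs_acceptProb_sub_le_of_close (D n) (hε n) (hY n ⟨j, hj⟩)
        have h3 := abs_acceptProb_sub_le_of_close (D n) (hε n) (hX n ⟨j, hj⟩)
        simp only at h2 h3 ⊢
        set a := acceptProb (D n) (Z n j)
        set b := acceptProb (D n) (Z n (j + 1))
        set c := acceptProb (D n) fun H => (Y n H).bind fun w => (C n ⟨j, hj⟩).eval H w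
        set d := acceptProb (D n) fun H => (X n H).bind fun w => (C n ⟨j, hj⟩).eval H w
        have h4 := abs_sub_le a c b
        have h5 := abs_sub_le c d b
        rw [abs_sub_comm c d] at h5
        rw [abs_sub_comm d b] at h5
        linarith
  choose E hE h using key
  have hE' : PolyBounded fun n => (E n).size :=
    ⟨P + Q + 1, fun n => by simpa using hE n⟩
  refine Negligible.mono (Negligible.polyBounded_mul hN ((hε'.add (hXY E hE')).add hε') fun n =>
    add_nonneg (add_nonneg ENNReal.toReal_nonneg (abs_nonneg _)) ENNReal.toReal_nonneg)
    (fun _ => abs_nonneg _) h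

end CompIndist

/-! ### The hashed Diffie-Hellman problem -/

section HashDH

variable (𝒢 : GroupGen) (σ : ℕ → ℕ)

/-- The positions of the bits of an instance of the hashed Diffie-Hellman problem. -/
abbrev HDHWires (n : ℕ) : Type :=
  𝒢.ParamWires n ⊕ Fin (𝒢.elemLen n) ⊕ Fin (𝒢.elemLen n) ⊕ Fin (σ n)

variable {𝒢 σ}

/-- The instance `(𝔾, p, g, A, B, u)` of the hashed Diffie-Hellman problem. -/
def hdhInstance {n : ℕ} (ρ : Bits (𝒢.coinLen n)) (A B : 𝒢.Grp n ρ) (u : Bits (σ n)) :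
    HDHWires 𝒢 σ n → Bool :=
  Sum.elim (𝒢.params n ρ) (Sum.elim (𝒢.elem A) (Sum.elim (𝒢.elem B) u))

/-- The hash value of a group element. -/
def hashElem {n : ℕ} (H : Oracle (σ n)) {ρ : Bits (𝒢.coinLen n)} (a : 𝒢.Grp n ρ) : Bits (σ n) :=
  H (List.ofFn (𝒢.elem a))

variable (𝒢 σ)

/-- Real instances `(𝔾, p, g, g ^ a₁, g ^ a₂, H (g ^ (a₁ a₂)))`. -/
def hdhReal (n : ℕ) (H : Oracle (σ n)) : PMF (HDHWires 𝒢 σ n → Bool) :=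
  (PMF.uniformOfFintype (Bits (𝒢.coinLen n))).bind fun ρ =>
  (PMF.uniformOfFintype (ZMod (𝒢.ord n ρ))).bind fun a₁ =>
  (PMF.uniformOfFintype (ZMod (𝒢.ord n ρ))).bind fun a₂ =>
  PMF.pure (hdhInstance ρ (𝒢.g n ρ ^ a₁.val) (𝒢.g n ρ ^ a₂.val)
    (hashElem H (𝒢.g n ρ ^ (a₁ * a₂).val)))

/-- Ideal instances `(𝔾, p, g, g ^ a₁, g ^ a₂, u)`, with uniform `u`. -/
def hdhIdeal (n : ℕ) (_ : Oracle (σ n)) : PMF (HDHWires 𝒢 σ n → Bool) :=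
  (PMF.uniformOfFintype (Bits (𝒢.coinLen n))).bind fun ρ =>
  (PMF.uniformOfFintype (ZMod (𝒢.ord n ρ))).bind fun a₁ =>
  (PMF.uniformOfFintype (ZMod (𝒢.ord n ρ))).bind fun a₂ =>
  (PMF.uniformOfFintype (Bits (σ n))).bind fun u =>
  PMF.pure (hdhInstance ρ (𝒢.g n ρ ^ a₁.val) (𝒢.g n ρ ^ a₂.val) u)

variable {𝒢 σ}

theorem cdhGame_apply_true (n : ℕ) (A : PlainCircuit (Fin (𝒢.elemLen n))
      (𝒢.ParamWires n ⊕ Fin (𝒢.elemLen n) ⊕ Fin (𝒢.elemLen n))) :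
    𝒢.cdhGame n A True =
      expect (PMF.uniformOfFintype (Bits (𝒢.coinLen n))) fun ρ =>
      expect (PMF.uniformOfFintype (ZMod (𝒢.ord n ρ))) fun a₁ =>
      expect (PMF.uniformOfFintype (ZMod (𝒢.ord n ρ))) fun a₂ =>
        A.run (Sum.elim (𝒢.params n ρ)
          (Sum.elim (𝒢.elem (𝒢.g n ρ ^ a₁.val)) (𝒢.elem (𝒢.g n ρ ^ a₂.val))))
          (𝒢.elem (𝒢.g n ρ ^ (a₁ * a₂).val)) := by
  simp only [GroupGen.cdhGame, bind_apply_eq_expect]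
  congr 1; funext ρ
  congr 1; funext a₁
  congr 1; funext a₂
  rw [PMF.map_apply, tsum_eq_single (𝒢.elem (𝒢.g n ρ ^ (a₁ * a₂).val))]
  · simp
  · intro w hw
    rw [if_neg]
    simpa using hw

/-- The circuits that run a distinguisher for the hashed Diffie-Hellman problem with a lazily
sampled oracle, and output one of its queries. -/
theorem exists_cdh_circuit {n : ℕ} (D : Circuit (σ n) Unit (HDHWires 𝒢 σ n)) (j : ℕ) :
    ∃ A : PlainCircuit (Fin (𝒢.elemLen n))
        (𝒢.ParamWires n ⊕ Fin (𝒢.elemLen n) ⊕ Fin (𝒢.elemLen n)),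
      A.size ≤ (σ n + D.size + 1) * (σ n + (σ n + D.size + 1) *
        (4 * (σ n + D.size + 1) + 4 + 3 * σ n) + 1) ∧
      ∀ (ρ : Bits (𝒢.coinLen n)) (a b : 𝒢.Grp n ρ) (w : Fin (𝒢.elemLen n) → Bool),
        A.run (Sum.elim (𝒢.params n ρ) (Sum.elim (𝒢.elem a) (𝒢.elem b))) w =
        ∫⁻ H, expect (PMF.uniformOfFintype (Bits (σ n))) (fun u =>
          (D.jthQuery (𝒢.elemLen n) j).eval H (hdhInstance ρ a b u) w) ∂roLaw (σ n) := by
  obtain ⟨e, he, he'⟩ := Circuit.exists_coins (σ n) (Fin (σ n))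
    (𝒢.ParamWires n ⊕ Fin (𝒢.elemLen n) ⊕ Fin (𝒢.elemLen n))
  -- A CDH instance contains no mask; the circuit tosses the string `u` itself and takes all other
  -- wires from its input.
  set E := e.andThen ((D.jthQuery (𝒢.elemLen n) j).rename
    (Sum.elim (Sum.inl ∘ Sum.inl) (Sum.elim (Sum.inl ∘ Sum.inr ∘ Sum.inl)
      (Sum.elim (Sum.inl ∘ Sum.inr ∘ Sum.inr) Sum.inr)))) with hE
  have hEs : E.size ≤ σ n + D.size + 1 := by
    rw [hE, Circuit.size_andThen, he, Fintype.card_fin, Circuit.size_rename, add_assoc]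
    exact Nat.add_le_add_left (Circuit.size_jthQuery _ _ _) _
  obtain ⟨A, hA, h⟩ := E.exists_lazy [] (σ n + D.size + 1) (by simpa using hEs)
  refine ⟨A, hA.trans (Nat.mul_le_mul_right _ hEs), fun ρ a b w => ?_⟩
  rw [h]
  refine lintegral_congr fun H => ?_
  rw [hE, Circuit.eval_andThen, he', bind_apply_eq_expect]
  congr 1
  funext u
  rw [Circuit.eval_rename]
  congr 2
  funext i
  rcases i with i | i | i | i <;> rfl

theorem measurable_hashElem_subst {n : ℕ} {ρ : Bits (𝒢.coinLen n)} (a b q : 𝒢.Grp n ρ)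
    (D : Circuit (σ n) Unit (HDHWires 𝒢 σ n)) :
    Measurable fun H => D.eval H (hdhInstance ρ a b (hashElem H q)) fun _ => true :=
  measurable_apply_oracle (F := fun H u => D.eval H (hdhInstance ρ a b u) fun _ => true)
    fun _ => Circuit.measurable_eval _ _ _

/-- In the random oracle model, the CDH assumption implies that the hashed Diffie-Hellman problem
is hard. -/
theorem compIndist_hdh (hσ : PolyBounded σ) (hCDH : 𝒢.CDHAssumption) :
    CompIndist (hdhReal 𝒢 σ) (hdhIdeal 𝒢 σ) := by
  intro D hD
  choose A hA hA' using fun n j => exists_cdh_circuit (𝒢 := 𝒢) (D n) j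
  -- A union bound over the queries. There is one index more than the size requires, so that the sum
  -- is nonempty and has a largest term.
  have key : ∀ n, |acceptProb (D n) (hdhReal 𝒢 σ n) - acceptProb (D n) (hdhIdeal 𝒢 σ n)| ≤
      ∑ j ∈ Finset.range ((D n).size + 1), (𝒢.cdhGame n (A n j) True).toReal := by
    intro n
    rw [← ENNReal.toReal_sum fun j _ => PMF.apply_ne_top _ _]
    have hsum : ∑ j ∈ Finset.range ((D n).size + 1), 𝒢.cdhGame n (A n j) True =
        expect (PMF.uniformOfFintype (Bits (𝒢.coinLen n))) fun ρ =>
        expect (PMF.uniformOfFintype (ZMod (𝒢.ord n ρ))) fun a₁ =>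
        expect (PMF.uniformOfFintype (ZMod (𝒢.ord n ρ))) fun a₂ =>
          ∫⁻ H, expect (PMF.uniformOfFintype (Bits (σ n))) (fun u =>
            ∑ j ∈ Finset.range ((D n).size + 1), ((D n).jthQuery (𝒢.elemLen n) j).eval H
              (hdhInstance ρ (𝒢.g n ρ ^ a₁.val) (𝒢.g n ρ ^ a₂.val) u)
              (𝒢.elem (𝒢.g n ρ ^ (a₁ * a₂).val))) ∂roLaw (σ n) := by
      simp only [cdhGame_apply_true, hA', ← expect_finset_sum]
      congr 1; funext ρ
      congr 1; funext a₁
      congr 1; funext a₂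
      rw [← lintegral_finsetSum]
      · simp only [expect_finset_sum]
      · exact fun j _ => measurable_expect _ fun u => Circuit.measurable_eval _ _ _
    -- Resampling `H` at `g ^ (a₁ a₂)` turns a real instance into an ideal one, with uniform `u`,
    -- run with the oracle reprogrammed to `u` at that point.
    have hreal : ∫⁻ H, expect (hdhReal 𝒢 σ n H) (fun w => (D n).eval H w fun _ => true)
          ∂roLaw (σ n) =
        expect (PMF.uniformOfFintype (Bits (𝒢.coinLen n))) fun ρ =>
        expect (PMF.uniformOfFintype (ZMod (𝒢.ord n ρ))) fun a₁ =>
        expect (PMF.uniformOfFintype (ZMod (𝒢.ord n ρ))) fun a₂ =>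
          ∫⁻ H, expect (PMF.uniformOfFintype (Bits (σ n))) (fun u =>
            (D n).eval (Function.update H (List.ofFn (𝒢.elem (𝒢.g n ρ ^ (a₁ * a₂).val))) u)
              (hdhInstance ρ (𝒢.g n ρ ^ a₁.val) (𝒢.g n ρ ^ a₂.val) u) fun _ => true)
            ∂roLaw (σ n) := by
      simp only [hdhReal, expect_bind, expect_pure]
      rw [← expect_lintegral]
      · congr 1; funext ρ
        rw [← expect_lintegral]
        · congr 1; funext a₁
          rw [← expect_lintegral]
          · congr 1; funext a₂
            rw [lintegral_roLaw_update (List.ofFn (𝒢.elem (𝒢.g n ρ ^ (a₁ * a₂).val)))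
              (measurable_hashElem_subst _ _ _ _)]
            simp only [hashElem, Function.update_self]
          · exact fun _ => measurable_hashElem_subst _ _ _ _
        · exact fun _ => measurable_expect _ fun _ => measurable_hashElem_subst _ _ _ _
      · exact fun _ => measurable_expect _ fun _ => measurable_expect _ fun _ =>
          measurable_hashElem_subst _ _ _ _
    have hideal : ∫⁻ H, expect (hdhIdeal 𝒢 σ n H) (fun w => (D n).eval H w fun _ => true)
          ∂roLaw (σ n) =
        expect (PMF.uniformOfFintype (Bits (𝒢.coinLen n))) fun ρ =>
        expect (PMF.uniformOfFintype (ZMod (𝒢.ord n ρ))) fun a₁ =>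
        expect (PMF.uniformOfFintype (ZMod (𝒢.ord n ρ))) fun a₂ =>
          ∫⁻ H, expect (PMF.uniformOfFintype (Bits (σ n))) (fun u =>
            (D n).eval H (hdhInstance ρ (𝒢.g n ρ ^ a₁.val) (𝒢.g n ρ ^ a₂.val) u) fun _ => true)
            ∂roLaw (σ n) := by
      have hm : ∀ w, Measurable fun H => (D n).eval H w fun _ => true :=
        fun w => Circuit.measurable_eval _ _ _
      simp only [hdhIdeal, expect_bind, expect_pure]
      rw [← expect_lintegral]
      · congr 1; funext ρ
        rw [← expect_lintegral]
        · congr 1; funext a₁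
          rw [← expect_lintegral]
          exact fun _ => measurable_expect _ fun _ => hm _
        · exact fun _ => measurable_expect _ fun _ => measurable_expect _ fun _ => hm _
      · exact fun _ => measurable_expect _ fun _ => measurable_expect _ fun _ =>
          measurable_expect _ fun _ => hm _
    -- In both directions the bad event refers to the original `H`, which is independent of `u`;
    -- this is the experiment that the lazily sampled CDH circuit reproduces.
    have hbad : ∀ (ρ : Bits (𝒢.coinLen n)) (a₁ a₂ : ZMod (𝒢.ord n ρ)) (H : Oracle (σ n))
        (u : Bits (σ n)), _ := fun ρ a₁ a₂ H u =>
      Circuit.eval_le_of_agree (H := H)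
        (H' := Function.update H (List.ofFn (𝒢.elem (𝒢.g n ρ ^ (a₁ * a₂).val))) u)
        (fun q hq => (Function.update_of_ne hq _ _).symm) (D n)
        (hdhInstance ρ (𝒢.g n ρ ^ a₁.val) (𝒢.g n ρ ^ a₂.val) u) (fun _ => true)
        (Nat.le_succ (D n).size)
    rw [acceptProb_eq, acceptProb_eq]
    refine toReal_abs_sub_le ?_ ?_ (accept_ne_top _ _) (accept_ne_top _ _)
      (ENNReal.sum_ne_top.mpr fun j _ => PMF.apply_ne_top _ _)
    · rw [hreal, hideal, hsum]
      simp only [← expect_add]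
      refine expect_mono _ fun ρ => expect_mono _ fun a₁ => expect_mono _ fun a₂ => ?_
      rw [← lintegral_add_left (measurable_expect _ fun _ => Circuit.measurable_eval _ _ _)]
      refine lintegral_mono fun H => ?_
      rw [← expect_add]
      exact expect_mono _ fun u => (hbad ρ a₁ a₂ H u).2
    · rw [hreal, hideal, hsum]
      simp only [← expect_add]
      refine expect_mono _ fun ρ => expect_mono _ fun a₁ => expect_mono _ fun a₂ => ?_
      rw [← lintegral_add_right]
      · refine lintegral_mono fun H => ?_
        rw [← expect_add]
        exact expect_mono _ fun u => (hbad ρ a₁ a₂ H u).1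
      · exact measurable_expect _ fun u => Finset.measurable_sum _ fun j _ =>
          Circuit.measurable_eval _ _ _
  -- The most successful query index is hard-wired for each `n`, giving a single family of CDH
  -- circuits.
  choose J _ hJ' using fun n => exists_sum_le_mul
    (fun j => (𝒢.cdhGame n (A n j) True).toReal) ((D n).size + 1) (Nat.succ_pos _)
  have hD' : PBound id fun n => (D n).size := hD
  have hσ' : PBound id σ := hσ
  have hsz : PBound id fun n => σ n + (D n).size + 1 := (hσ'.add hD').add (.const 1)
  have hAp : PBound id fun n => (A n (J n)).size :=
    (hsz.mul ((hσ'.add (hsz.mul ((((PBound.const 4).mul hsz).add (.const 4)).add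
      ((PBound.const 3).mul hσ')))).add (.const 1))).mono fun n => hA n (J n)
  have hs : PolyBounded fun n => (D n).size + 1 := hD'.add (.const 1)
  exact (Negligible.polyBounded_mul hs (hCDH (fun n => A n (J n)) hAp)
    fun _ => ENNReal.toReal_nonneg).mono (fun _ => abs_nonneg _)
    fun n => (key n).trans (hJ' n)

end HashDH

/-! ### Powers of the generator -/

namespace GroupGen

variable {𝒢 : GroupGen} {n : ℕ} {ρ : Bits (𝒢.coinLen n)}

/-- The power `g ^ a`. -/
def exp (ρ : Bits (𝒢.coinLen n)) (a : ZMod (𝒢.ord n ρ)) : 𝒢.Grp n ρ := 𝒢.g n ρ ^ a.val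

theorem orderOf_g : orderOf (𝒢.g n ρ) = 𝒢.ord n ρ := by
  rw [← Nat.card_zpowers, 𝒢.gen_generates n ρ, Subgroup.card_top, Nat.card_eq_fintype_card]

theorem g_pow_eq_iff (a b : ℕ) : 𝒢.g n ρ ^ a = 𝒢.g n ρ ^ b ↔ a ≡ b [MOD 𝒢.ord n ρ] := by
  rw [pow_eq_pow_iff_modEq, orderOf_g]

theorem exp_add (a b : ZMod (𝒢.ord n ρ)) : exp ρ (a + b) = exp ρ a * exp ρ b := by
  rw [exp, exp, exp, ← pow_add, g_pow_eq_iff, ZMod.val_add]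
  exact Nat.mod_modEq _ _

theorem exp_sub (a b : ZMod (𝒢.ord n ρ)) : exp ρ (a - b) = exp ρ a / exp ρ b := by
  rw [eq_div_iff_mul_eq', ← exp_add, sub_add_cancel]

theorem exp_pow (a b : ZMod (𝒢.ord n ρ)) : exp ρ a ^ b.val = exp ρ (a * b) := by
  rw [exp, exp, ← pow_mul, g_pow_eq_iff, ZMod.val_mul]
  exact (Nat.mod_modEq _ _).symm

theorem exp_bijective : Function.Bijective (exp ρ) := by
  rw [Fintype.bijective_iff_injective_and_card, ZMod.card]
  refine ⟨fun a b h => ?_, rfl⟩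
  rw [exp, exp, g_pow_eq_iff] at h
  exact ZMod.val_injective _ (Nat.ModEq.eq_of_lt_of_lt h (ZMod.val_lt a) (ZMod.val_lt b))

/-- Exponentiation as a bijection. -/
def expEquiv (ρ : Bits (𝒢.coinLen n)) : ZMod (𝒢.ord n ρ) ≃ 𝒢.Grp n ρ :=
  Equiv.ofBijective (exp ρ) exp_bijective

@[simp] theorem expEquiv_apply (a : ZMod (𝒢.ord n ρ)) : expEquiv ρ a = exp ρ a := rfl

end GroupGen

open GroupGen

theorem bxor_bxor_cancel_left {k : ℕ} (x y : Bits k) : bxor x (bxor x y) = y := by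
  funext i
  simp [bxor]

theorem bxor_bxor_cancel_right {k : ℕ} (x y : Bits k) : bxor (bxor x y) y = x := by
  funext i
  simp [bxor]

/-- Adding a fixed bit string, as a bijection. -/
def bxorEquiv {k : ℕ} (y : Bits k) : Bits k ≃ Bits k where
  toFun x := bxor x y
  invFun x := bxor x y
  left_inv x := bxor_bxor_cancel_right x y
  right_inv x := bxor_bxor_cancel_right x y

/-! ### The messages in an execution -/

section Messages

variable {𝒢 : GroupGen} {n : ℕ} {ρ : Bits (𝒢.coinLen n)}

/-- The exponent that the receiver uses for the decryption. -/
def secretExp {p : ℕ} (s c : Bool) (r₁ r₂ : ZMod p) : ZMod p :=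
  r₂ + r₁ * (-1) ^ (xor c s).toNat

/-- The first proxy moves `δ_j` to position `s₁ ⊕ j`, so `δ_{s₂}` lands at `s`. It is shifted by `g
^ r₁` if `s₂ = 0` and by its inverse if `s₂ = 1`, which is the sign in the receiver's exponent. -/
theorem genQuery1_self (C : 𝒢.Grp n ρ) (s c : Bool) (r₁ r₂ : ZMod (𝒢.ord n ρ)) :
    genQuery1 (𝒢.g n ρ) c r₁ (genQuery2 (𝒢.g n ρ) C (xor c s) r₂) s =
      exp ρ (secretExp s c r₁ r₂) := by
  cases s <;> cases c <;>
    simp [genQuery1, genQuery2, secretExp, exp_add, ← sub_eq_add_neg, exp_sub] <;> rfl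

/-- The two entries are shifted in opposite directions, so their product stays `C`. -/
theorem genQuery1_not (C : 𝒢.Grp n ρ) (s c : Bool) (r₁ r₂ : ZMod (𝒢.ord n ρ)) :
    genQuery1 (𝒢.g n ρ) c r₁ (genQuery2 (𝒢.g n ρ) C (xor c s) r₂) (!s) =
      C / exp ρ (secretExp s c r₁ r₂) := by
  cases s <;> cases c <;>
    simp [genQuery1, genQuery2, secretExp, exp_add, ← sub_eq_add_neg, exp_sub,
      div_div_eq_mul_div, div_mul_eq_div_div] <;> simp only [exp] <;>
      first | rfl | exact (div_mul_eq_mul_div _ _ _)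

theorem mul_not {G : Type} [CommGroup G] (β : Bool → G) (s : Bool) :
    β false * β true = β s * β (!s) := by
  cases s
  · rfl
  · exact mul_comm _ _

/-- The second query in terms of the first. -/
theorem eq_of_genQuery1 (g : 𝒢.Grp n ρ) (c : Bool) (r : ZMod (𝒢.ord n ρ)) (δ : Bool → 𝒢.Grp n ρ) :
    δ = fun b => if b then genQuery1 g c r δ (!c) * g ^ r.val else
      genQuery1 g c r δ c / g ^ r.val := by
  funext b
  cases b <;> cases c <;> simp [genQuery1]

variable {σ : ℕ → ℕ} {z : ℕ}

/-- The transcript of an execution in terms of the first query. -/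
theorem transcript_eq (m : Database (σ n) z) (v : Fin z) (s : Bool) (H : Oracle (σ n))
    (C : 𝒢.Grp n ρ) (y : Fin z → Bool → ZMod (𝒢.ord n ρ)) (c : Bool)
    (r₁ r₂ : ZMod (𝒢.ord n ρ)) (β : Bool → 𝒢.Grp n ρ)
    (hβ : β s = exp ρ (secretExp s c r₁ r₂)) (hC : C = β false * β true) :
    transcript 𝒢 σ n m v s H ρ C y c r₁ r₂ =
      { ρ := ρ, C := C, y := y, req₁ := (c, r₁), req₂ := (xor c s, r₂)
        q₂ := fun b => if b then β (!c) * exp ρ r₁ else β c / exp ρ r₁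
        q₁ := β
        res := some fun t b =>
          (exp ρ (y t b), bxor (hashElem H (β b ^ (y t b).val)) (m t b))
        res' := some fun b =>
          (exp ρ (y v b), bxor (hashElem H (β b ^ (y v b).val)) (m v b))
        out := some (m v s) } := by
  have h1 : genQuery1 (𝒢.g n ρ) c r₁ (genQuery2 (𝒢.g n ρ) C (xor c s) r₂) = β := by
    funext b
    obtain rfl | rfl : b = s ∨ b = !s := by cases b <;> cases s <;> simp
    · rw [genQuery1_self, hβ]
    · rw [genQuery1_not, ← hβ, hC, mul_not β s, mul_div_cancel_left]
  have h2 := eq_of_genQuery1 (𝒢.g n ρ) c r₁ (genQuery2 (𝒢.g n ρ) C (xor c s) r₂)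
  rw [h1] at h2
  simp only [transcript, share, h1, genRes, ← hC, ne_eq, not_true_eq_false, if_false, oblFilter,
    retrieve, Option.map_some, hashElem]
  congr 2
  -- The Diffie–Hellman identity: the receiver's power of `g ^ y` is the sender's power of `β_s`, so
  -- the two masks coincide.
  have h3 : (𝒢.g n ρ ^ (y v s).val) ^ (r₂ + r₁ * (-1) ^ (xor c s).toNat).val =
      β s ^ (y v s).val := by
    rw [hβ, exp_pow, mul_comm (secretExp s c r₁ r₂), ← exp_pow]
    rfl
  rw [h3, bxor_bxor_cancel_left]

end Messages

/-! ### Reparametrized executions -/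

section Executions

variable {𝒢 : GroupGen} {σ : ℕ → ℕ} {n z : ℕ}

theorem uniform_bind_uncurry {I J A B : Type} [Fintype I] [Fintype J] [DecidableEq I]
    [DecidableEq J] [Fintype A] [Nonempty A] (F : (I → J → A) → PMF B) :
    (PMF.uniformOfFintype (I → J → A)).bind F =
      (PMF.uniformOfFintype (I × J → A)).bind fun y => F fun i j => y (i, j) :=
  uniform_bind_equiv (Equiv.curry I J A) F

theorem bind_comm_pairs {A B C D X : Type} (P : PMF A) (Q : PMF B) (R : PMF C) (S : PMF D)
    (F : A → B → C → D → PMF X) :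
    (P.bind fun a => Q.bind fun b => R.bind fun c => S.bind fun d => F a b c d) =
      R.bind fun c => S.bind fun d => P.bind fun a => Q.bind fun b => F a b c d := by
  calc _ = P.bind fun a => R.bind fun c => S.bind fun d => Q.bind fun b => F a b c d := by
        congr 1; funext a
        rw [PMF.bind_comm]
        congr 1; funext c
        rw [PMF.bind_comm]
    _ = _ := by
        rw [PMF.bind_comm]
        congr 1; funext c
        rw [PMF.bind_comm]

/-- The public group element and the exponent of the second proxy in terms of the logarithms of
the first query. -/
def queryEquiv (ρ : Bits (𝒢.coinLen n)) (s c : Bool) (r₁ : ZMod (𝒢.ord n ρ)) :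
    (Bool → ZMod (𝒢.ord n ρ)) ≃ 𝒢.Grp n ρ × ZMod (𝒢.ord n ρ) where
  toFun b := (exp ρ (b false) * exp ρ (b true), b s - r₁ * (-1) ^ (xor c s).toNat)
  invFun a i := if i = s then secretExp s c r₁ a.2 else
    (expEquiv ρ).symm a.1 - secretExp s c r₁ a.2
  left_inv b := by
    funext i
    have : (expEquiv ρ).symm (exp ρ (b false) * exp ρ (b true)) = b false + b true := by
      rw [← exp_add, ← expEquiv_apply, Equiv.symm_apply_apply]
    simp only [this, secretExp]
    cases i <;> cases s <;> simp
  right_inv := by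
    rintro ⟨C, r₂⟩
    refine Prod.ext ?_ (by simp [secretExp])
    have : exp ρ ((expEquiv ρ).symm C) = C := (expEquiv ρ).apply_symm_apply C
    change exp ρ _ * exp ρ _ = C
    rw [← exp_add]
    conv_rhs => rw [← this]
    congr 1
    cases s <;> simp

/-- An execution in terms of the logarithms of the first query. -/
theorem execution_map_eq {X : Type} (m : Database (σ n) z) (v : Fin z) (s : Bool)
    (H : Oracle (σ n)) (f : Transcript 𝒢 σ n z → X) :
    (execution 𝒢 σ n m v s H).map f =
      (PMF.uniformOfFintype (Bits (𝒢.coinLen n))).bind fun ρ =>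
      (PMF.uniformOfFintype (Bool → ZMod (𝒢.ord n ρ))).bind fun b =>
      (PMF.uniformOfFintype (Fin z × Bool → ZMod (𝒢.ord n ρ))).bind fun y =>
      (PMF.uniformOfFintype Bool).bind fun c =>
      (PMF.uniformOfFintype (ZMod (𝒢.ord n ρ))).bind fun r₁ =>
      PMF.pure (f {
        ρ := ρ, C := exp ρ (b false) * exp ρ (b true), y := fun t i => y (t, i)
        req₁ := (c, r₁), req₂ := (xor c s, b s - r₁ * (-1) ^ (xor c s).toNat)
        q₂ := fun i => if i then exp ρ (b (!c)) * exp ρ r₁ else exp ρ (b c) / exp ρ r₁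
        q₁ := fun i => exp ρ (b i)
        res := some fun t i => (exp ρ (y (t, i)),
          bxor (hashElem H (exp ρ (b i) ^ (y (t, i)).val)) (m t i))
        res' := some fun i => (exp ρ (y (v, i)),
          bxor (hashElem H (exp ρ (b i) ^ (y (v, i)).val)) (m v i))
        out := some (m v s) }) := by
  rw [execution, PMF.map_bind]
  congr 1; funext ρ
  simp only [PMF.map_bind, PMF.map_comp]
  calc _ = (PMF.uniformOfFintype Bool).bind fun c =>
        (PMF.uniformOfFintype (ZMod (𝒢.ord n ρ))).bind fun r₁ =>
        (PMF.uniformOfFintype (𝒢.Grp n ρ)).bind fun C =>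
        (PMF.uniformOfFintype (ZMod (𝒢.ord n ρ))).bind fun r₂ =>
        (PMF.uniformOfFintype (Fin z → Bool → ZMod (𝒢.ord n ρ))).bind fun y =>
          PMF.pure (f (transcript 𝒢 σ n m v s H ρ C y c r₁ r₂)) := by
        rw [PMF.bind_comm]
        congr 1; funext c
        rw [PMF.bind_comm]
        rfl
    _ = (PMF.uniformOfFintype Bool).bind fun c =>
        (PMF.uniformOfFintype (ZMod (𝒢.ord n ρ))).bind fun r₁ =>
        (PMF.uniformOfFintype (Bool → ZMod (𝒢.ord n ρ))).bind fun b =>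
        (PMF.uniformOfFintype (Fin z × Bool → ZMod (𝒢.ord n ρ))).bind fun y =>
        PMF.pure (f {
          ρ := ρ, C := exp ρ (b false) * exp ρ (b true), y := fun t i => y (t, i)
          req₁ := (c, r₁), req₂ := (xor c s, b s - r₁ * (-1) ^ (xor c s).toNat)
          q₂ := fun i => if i then exp ρ (b (!c)) * exp ρ r₁ else exp ρ (b c) / exp ρ r₁
          q₁ := fun i => exp ρ (b i)
          res := some fun t i => (exp ρ (y (t, i)),
            bxor (hashElem H (exp ρ (b i) ^ (y (t, i)).val)) (m t i))
          res' := some fun i => (exp ρ (y (v, i)),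
            bxor (hashElem H (exp ρ (b i) ^ (y (v, i)).val)) (m v i))
          out := some (m v s) }) := by
        congr 1; funext c
        congr 1; funext r₁
        -- The change of variables from `(C, r₂)` to the logarithms of `(β₀, β₁)`. The latter are
        -- uniform for every `c` and `r₁`, so they may afterwards be drawn first.
        rw [← uniform_bind_prod (fun a : 𝒢.Grp n ρ × ZMod (𝒢.ord n ρ) =>
          (PMF.uniformOfFintype (Fin z → Bool → ZMod (𝒢.ord n ρ))).bind fun y =>
            PMF.pure (f (transcript 𝒢 σ n m v s H ρ a.1 y c r₁ a.2))),
          uniform_bind_equiv (queryEquiv ρ s c r₁)]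
        congr 1; funext b
        rw [uniform_bind_uncurry]
        congr 1; funext y
        change PMF.pure (f (transcript 𝒢 σ n m v s H ρ (exp ρ (b false) * exp ρ (b true)) _ c r₁
          (b s - r₁ * (-1) ^ (xor c s).toNat))) = _
        rw [transcript_eq m v s H _ _ c r₁ _ (fun i => exp ρ (b i))
          (by simp [secretExp]) rfl]
    _ = _ := by
        exact bind_comm_pairs _ _ _ _ _

/-- Distinct coordinates are independent: after both are overwritten by fresh values, the rest of
the function no longer matters. -/
theorem uniform_bind_apply₂ {I A B : Type} [Fintype I] [DecidableEq I] [Fintype A] [Nonempty A]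
    {i j : I} (hij : i ≠ j) (F : A → A → PMF B) :
    ((PMF.uniformOfFintype (I → A)).bind fun y => F (y i) (y j)) =
      (PMF.uniformOfFintype A).bind fun a => (PMF.uniformOfFintype A).bind fun b => F a b := by
  rw [← uniform_bind_update i]
  congr 1; funext a
  rw [← uniform_bind_update j]
  congr 1; funext b
  simp [hij.symm]

/-- An execution in terms of the logarithm of the element of the first query that does not belong
to the receiver's choice. -/
theorem execution_map_eq' {X : Type} (m : Database (σ n) z) (v : Fin z) (s : Bool)
    (H : Oracle (σ n)) (f : Transcript 𝒢 σ n z → X)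
    (F : (ρ : Bits (𝒢.coinLen n)) → (a y y' : ZMod (𝒢.ord n ρ)) → Bool →
      (r₁ r₂ : ZMod (𝒢.ord n ρ)) → X)
    (hF : ∀ ρ a y c r₁ r₂, f (transcript 𝒢 σ n m v s H ρ
      (exp ρ a * exp ρ (secretExp s c r₁ r₂)) y c r₁ r₂) =
        F ρ a (y v s) (y v (!s)) c r₁ r₂) :
    (execution 𝒢 σ n m v s H).map f =
      (PMF.uniformOfFintype (Bits (𝒢.coinLen n))).bind fun ρ =>
      (PMF.uniformOfFintype (ZMod (𝒢.ord n ρ))).bind fun a =>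
      (PMF.uniformOfFintype (ZMod (𝒢.ord n ρ))).bind fun y' =>
      (PMF.uniformOfFintype Bool).bind fun c =>
      (PMF.uniformOfFintype (ZMod (𝒢.ord n ρ))).bind fun r₁ =>
      (PMF.uniformOfFintype (ZMod (𝒢.ord n ρ))).bind fun r₂ =>
      (PMF.uniformOfFintype (ZMod (𝒢.ord n ρ))).bind fun y =>
      PMF.pure (F ρ a y y' c r₁ r₂) := by
  rw [execution, PMF.map_bind]
  congr 1; funext ρ
  simp only [PMF.map_bind, PMF.map_comp]
  set Z := PMF.uniformOfFintype (ZMod (𝒢.ord n ρ))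
  set Y := PMF.uniformOfFintype (Fin z → Bool → ZMod (𝒢.ord n ρ))
  calc _ = (PMF.uniformOfFintype Bool).bind fun c => Z.bind fun r₁ => Z.bind fun r₂ =>
        (PMF.uniformOfFintype (𝒢.Grp n ρ)).bind fun C => Y.bind fun y =>
          PMF.pure (f (transcript 𝒢 σ n m v s H ρ C y c r₁ r₂)) := by
        rw [PMF.bind_comm]
        congr 1; funext c
        rw [PMF.bind_comm]
        congr 1; funext r₁
        rw [PMF.bind_comm]
        rfl
    _ = (PMF.uniformOfFintype Bool).bind fun c => Z.bind fun r₁ => Z.bind fun r₂ =>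
        Z.bind fun a => Z.bind fun y' => Z.bind fun y =>
          PMF.pure (F ρ a y y' c r₁ r₂) := by
        congr 1; funext c
        congr 1; funext r₁
        congr 1; funext r₂
        -- For fixed receiver's coins, `C = g ^ a * β_s` is uniform exactly when `a`, the logarithm
        -- of `β_{1-s}`, is. Of the exponents `y` only the two for the pair `v` matter to `f`.
        rw [uniform_bind_equiv ((expEquiv ρ).trans
          (Equiv.mulRight (exp ρ (secretExp s c r₁ r₂))))]
        congr 1; funext a
        simp only [Equiv.trans_apply, Equiv.coe_mulRight, expEquiv_apply, hF]
        rw [uniform_bind_uncurry]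
        exact uniform_bind_apply₂ (i := (v, !s)) (j := (v, s)) (by simp)
          fun y' y => PMF.pure (F ρ a y y' c r₁ r₂)
    _ = (PMF.uniformOfFintype Bool).bind fun c => Z.bind fun r₁ => Z.bind fun a =>
        Z.bind fun y' => Z.bind fun r₂ => Z.bind fun y => PMF.pure (F ρ a y y' c r₁ r₂) := by
        congr 1; funext c
        congr 1; funext r₁
        rw [PMF.bind_comm]
        congr 1; funext a
        rw [PMF.bind_comm]
    _ = (PMF.uniformOfFintype Bool).bind fun c => Z.bind fun a => Z.bind fun y' =>
        Z.bind fun r₁ => Z.bind fun r₂ => Z.bind fun y => PMF.pure (F ρ a y y' c r₁ r₂) := by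
        congr 1; funext c
        rw [PMF.bind_comm]
        congr 1; funext a
        rw [PMF.bind_comm]
    _ = _ := by
        rw [PMF.bind_comm]
        congr 1; funext a
        rw [PMF.bind_comm]

end Executions

/-! ### The views as functions of the group elements -/

section Views

variable {𝒢 : GroupGen} {σ : ℕ → ℕ} {n z : ℕ}

/-- The view of the sender. -/
def viewSOf (m : Database (σ n) z) (ρ : Bits (𝒢.coinLen n)) (β : Bool → 𝒢.Grp n ρ)
    (y : Fin z × Bool → ZMod (𝒢.ord n ρ)) : (protocol 𝒢 σ).WiresS n z → Bool :=
  Sum.elim (encDatabase m) <| Sum.elim ρ <|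
    Sum.elim (Sum.elim (𝒢.params n ρ) (𝒢.elem (β false * β true))) <|
    Sum.elim (fun i => encNat (n + 2) (y (i.1, i.2.1)).val i.2.2) (fun i => 𝒢.elem (β i.1) i.2)

/-- The view of the first proxy, when it obtains the pairs `e`. -/
def viewP1Of (v : Fin z) (ρ : Bits (𝒢.coinLen n)) (β : Bool → 𝒢.Grp n ρ) (c : Bool)
    (r : ZMod (𝒢.ord n ρ)) (e : Fin z → Bool → 𝒢.Grp n ρ × Bits (σ n)) :
    (protocol 𝒢 σ).WiresP1 n z → Bool :=
  Sum.elim (encIndex v) <|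
    Sum.elim (Sum.elim (𝒢.params n ρ) (𝒢.elem (β false * β true))) <|
    Sum.elim (Sum.elim (fun _ => c) (encNat (n + 2) r.val)) <|
    Sum.elim (fun i => 𝒢.elem (if i.1 then β (!c) * exp ρ r else β c / exp ρ r) i.2)
      fun i => i.elim true fun i => Transcript.encPair (e i.1) i.2

/-- The view of the second proxy. -/
def viewP2Of (ρ : Bits (𝒢.coinLen n)) (C : 𝒢.Grp n ρ) (c : Bool) (r : ZMod (𝒢.ord n ρ)) :
    (protocol 𝒢 σ).WiresP2 n → Bool :=
  Sum.elim (Sum.elim (𝒢.params n ρ) (𝒢.elem C)) (Sum.elim (fun _ => c) (encNat (n + 2) r.val))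

/-- The element of the first query that belongs to the receiver's choice. -/
def ownElem (ρ : Bits (𝒢.coinLen n)) (s c : Bool) (r₁ r₂ : ZMod (𝒢.ord n ρ)) : 𝒢.Grp n ρ :=
  if xor c s then exp ρ r₂ / exp ρ r₁ else exp ρ r₂ * exp ρ r₁

theorem ownElem_eq (ρ : Bits (𝒢.coinLen n)) (s c : Bool) (r₁ r₂ : ZMod (𝒢.ord n ρ)) :
    ownElem ρ s c r₁ r₂ = exp ρ (secretExp s c r₁ r₂) := by
  unfold ownElem secretExp
  cases xor c s <;> simp [exp_add, ← sub_eq_add_neg, exp_sub]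

/-- The view of the receiver, when `A` is the element of the first query that does not belong to
its choice, and `w` is the pair for the message it did not choose. -/
def viewROf (H : Oracle (σ n)) (s : Bool) (ms : Bits (σ n)) (ρ : Bits (𝒢.coinLen n))
    (A : 𝒢.Grp n ρ) (w : 𝒢.Grp n ρ × Bits (σ n)) (c : Bool) (r₁ r₂ y : ZMod (𝒢.ord n ρ)) :
    (protocol 𝒢 σ).WiresR n → Bool :=
  Sum.elim (fun _ => s) <| Sum.elim (Sum.elim (fun _ => c) (encNat (n + 2) r₁.val)) <|
    Sum.elim (Sum.elim (fun _ => xor c s) (encNat (n + 2) r₂.val)) <|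
    Sum.elim (Sum.elim (𝒢.params n ρ) (𝒢.elem (A * ownElem ρ s c r₁ r₂))) <|
    Sum.elim (fun i => i.elim true (Transcript.encPair fun b => if xor b s then w else
      (exp ρ y, bxor (hashElem H (ownElem ρ s c r₁ r₂ ^ y.val)) ms)))
      fun i => i.elim true ms

/-- In terms of the logarithms of `β`, the coins `c` and `r₁` affect only messages that the sender
does not see. They integrate out, and every trace of `v` and `s` goes with them. -/
theorem viewS_eq (m : Database (σ n) z) (v : Fin z) (s : Bool) (H : Oracle (σ n)) :
    (protocol 𝒢 σ).viewS n m v s H =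
      (PMF.uniformOfFintype (Bits (𝒢.coinLen n))).bind fun ρ =>
      (PMF.uniformOfFintype (Bool → ZMod (𝒢.ord n ρ))).bind fun b =>
      (PMF.uniformOfFintype (Fin z × Bool → ZMod (𝒢.ord n ρ))).bind fun y =>
      PMF.pure (viewSOf m ρ (fun i => exp ρ (b i)) y) := by
  refine (execution_map_eq m v s H _).trans ?_
  congr 1; funext ρ
  congr 1; funext b
  congr 1; funext y
  exact (congrArg (PMF.bind _) (funext fun c => PMF.bind_const _
    (PMF.pure (viewSOf m ρ (fun i => exp ρ (b i)) y)))).trans (PMF.bind_const _ _)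

/-- The pair `δ` can be recovered from `β`, `c` and `r₁`, so the choice bit, which is left only in
unseen messages, disappears. The database remains, but only under the masks. -/
theorem viewP1_eq (m : Database (σ n) z) (v : Fin z) (s : Bool) (H : Oracle (σ n)) :
    (protocol 𝒢 σ).viewP1 n m v s H =
      (PMF.uniformOfFintype (Bits (𝒢.coinLen n))).bind fun ρ =>
      (PMF.uniformOfFintype (Bool → ZMod (𝒢.ord n ρ))).bind fun b =>
      (PMF.uniformOfFintype (Fin z × Bool → ZMod (𝒢.ord n ρ))).bind fun y =>
      (PMF.uniformOfFintype Bool).bind fun c =>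
      (PMF.uniformOfFintype (ZMod (𝒢.ord n ρ))).bind fun r =>
      PMF.pure (viewP1Of v ρ (fun i => exp ρ (b i)) c r fun t i => (exp ρ (y (t, i)),
          bxor (hashElem H (exp ρ (b i) ^ (y (t, i)).val)) (m t i))) := by
  refine (execution_map_eq m v s H _).trans ?_
  congr 1; funext ρ
  congr 1; funext b
  congr 1; funext y
  congr 1; funext c
  congr 1; funext r
  congr 1; funext i
  rcases i with i | i | i | i | i | i <;> rfl

/-- The share `c ⊕ s` is uniform for either value of `s`, while `r₁` and `y` do not affect this
view. -/
theorem viewP2_eq (m : Database (σ n) z) (v : Fin z) (s : Bool) (H : Oracle (σ n)) :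
    (protocol 𝒢 σ).viewP2 n m v s H =
      (PMF.uniformOfFintype (Bits (𝒢.coinLen n))).bind fun ρ =>
      (PMF.uniformOfFintype (ZMod (𝒢.ord n ρ))).bind fun a =>
      (PMF.uniformOfFintype Bool).bind fun c =>
      (PMF.uniformOfFintype (ZMod (𝒢.ord n ρ))).bind fun r =>
      PMF.pure (viewP2Of ρ (exp ρ a) c r) := by
  change (execution 𝒢 σ n m v s H).map _ = _
  rw [execution, PMF.map_bind]
  congr 1; funext ρ
  simp only [PMF.map_bind, PMF.map_comp]
  rw [uniform_bind_equiv (expEquiv ρ)]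
  congr 1; funext a
  rw [uniform_bind_equiv (⟨fun c => xor c s, fun c => xor c s, fun c => by simp,
    fun c => by simp⟩ : Bool ≃ Bool)]
  congr 1; funext c
  refine (congrArg _ (funext fun r₁ => ?_)).trans (PMF.bind_const _ _)
  congr 1; funext r₂
  refine (congrArg (PMF.bind _) (funext fun y => ?_)).trans (PMF.bind_const _ _)
  refine congrArg PMF.pure (funext fun i => ?_)
  rcases i with i | i | i
  · rfl
  · simp [Transcript.viewP2, transcript, share, Transcript.encReq, viewP2Of]
  · rfl

/-- The message that was not chosen occurs only under the mask `H (g ^ (a y'))`, where `g ^ a =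
β_{1-s}` and `g ^ y'` are visible: a hashed Diffie–Hellman instance. -/
theorem viewR_eq (m : Database (σ n) z) (v : Fin z) (s : Bool) (H : Oracle (σ n)) :
    (protocol 𝒢 σ).viewR n m v s H =
      (PMF.uniformOfFintype (Bits (𝒢.coinLen n))).bind fun ρ =>
      (PMF.uniformOfFintype (ZMod (𝒢.ord n ρ))).bind fun a =>
      (PMF.uniformOfFintype (ZMod (𝒢.ord n ρ))).bind fun y' =>
      (PMF.uniformOfFintype Bool).bind fun c =>
      (PMF.uniformOfFintype (ZMod (𝒢.ord n ρ))).bind fun r₁ =>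
      (PMF.uniformOfFintype (ZMod (𝒢.ord n ρ))).bind fun r₂ =>
      (PMF.uniformOfFintype (ZMod (𝒢.ord n ρ))).bind fun y =>
      PMF.pure (viewROf H s (m v s) ρ (exp ρ a)
        (exp ρ y', bxor (hashElem H (exp ρ (a * y'))) (m v (!s))) c r₁ r₂ y) := by
  refine execution_map_eq' m v s H _ (fun ρ a y y' c r₁ r₂ => viewROf H s (m v s) ρ (exp ρ a)
    (exp ρ y', bxor (hashElem H (exp ρ (a * y'))) (m v (!s))) c r₁ r₂ y) fun ρ a y c r₁ r₂ => ?_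
  rw [transcript_eq m v s H _ y c r₁ r₂
    (fun b => if xor b s then exp ρ a else exp ρ (secretExp s c r₁ r₂)) (by simp)
    (by cases s <;> simp [mul_comm]), ← exp_pow, ← ownElem_eq]
  funext i
  rcases i with i | i | i | i | i | i
  · rfl
  · rfl
  · rfl
  · rfl
  · rcases i with _ | ⟨b, i⟩
    · rfl
    · obtain rfl | rfl : b = s ∨ b = !s := by cases b <;> cases s <;> simp
      · simp [Transcript.viewR, viewROf, encOption, Transcript.encPair, ownElem_eq]
      · simp [Transcript.viewR, viewROf, encOption, Transcript.encPair]
  · rcases i with _ | i <;> rfl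

theorem outputs_eq (m : Database (σ n) z) (v : Fin z) (s : Bool) (H : Oracle (σ n)) :
    (protocol 𝒢 σ).outputs n m v s H = PMF.pure (some (functionality m v s)) := by
  refine (execution_map_eq m v s H Transcript.outputs).trans ?_
  refine (congrArg _ (funext fun ρ => ?_)).trans (PMF.bind_const _ _)
  refine (congrArg _ (funext fun b => ?_)).trans (PMF.bind_const _ _)
  refine (congrArg _ (funext fun y => ?_)).trans (PMF.bind_const _ _)
  refine (congrArg _ (funext fun c => ?_)).trans (PMF.bind_const _ _)
  exact PMF.bind_const _ (PMF.pure (some (functionality m v s)))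

end Views

/-! ### Circuits for the views -/

namespace PDet

variable {J : Type} {sz : J → ℕ} {𝒢 : GroupGen} {σ : ℕ → ℕ} {n z : J → ℕ} {Ω ι κ : J → Type}
  {O : ∀ j, Ω j → Oracle (σ (n j))} {x : ∀ j, Ω j → ι j → Bool}
  {ρ : ∀ j, Ω j → Bits (𝒢.coinLen (n j))}

theorem bool {v : ∀ j, Bool → Ω j → κ j → Bool} (h : ∀ b, PDet sz O x fun j => v j b) :
    PDet sz O x (fun j ω (i : Bool × κ j) => v j i.1 ω i.2) :=
  (((h true).elim (h false)).reindex fun j (i : Bool × κ j) =>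
    if i.1 then Sum.inl i.2 else Sum.inr i.2).congr fun j ω ⟨b, i⟩ => by cases b <;> rfl

theorem desc (h : PDet sz O x (fun j ω => 𝒢.params (n j) (ρ j ω))) :
    PDet sz O x (fun j ω => 𝒢.desc (n j) (ρ j ω)) := h.reindex fun _ => Sum.inl

theorem ord_lt (𝒢 : GroupGen) (n : ℕ) (ρ : Bits (𝒢.coinLen n)) : 𝒢.ord n ρ < 2 ^ (n + 2) :=
  (𝒢.card_le n ρ).trans_lt (Nat.pow_lt_pow_right (by norm_num) (by omega))

theorem exp (hn : PBound sz n) (h : PDet sz O x (fun j ω => 𝒢.params (n j) (ρ j ω)))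
    {a : ∀ j ω, ZMod (𝒢.ord (n j) (ρ j ω))}
    (ha : PDet sz O x (fun j ω => encNat (n j + 2) (a j ω).val)) :
    PDet sz O x (fun j ω => 𝒢.elem (GroupGen.exp (ρ j ω) (a j ω))) := by
  have hg : PDet sz O x (fun j ω => 𝒢.elem (𝒢.g (n j) (ρ j ω))) :=
    h.reindex fun _ => Sum.inr ∘ Sum.inr
  exact pow hn h.desc hg (fun _ _ => (ZMod.val_lt _).trans (ord_lt _ _ _)) ha

theorem samp (hn : PBound sz n) (h : PDet sz O x (fun j ω => 𝒢.params (n j) (ρ j ω)))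
    {k : ∀ j, Ω j → Fin (n j) × Fin (n j + 2) → Bool} (hk : PDet sz O x k) :
    PDet sz O x (fun j ω => encNat (n j + 2) (samp (𝒢.ord (n j) (ρ j ω)) (k j ω)).val) := by
  simp only [samp_val]
  exact sampNat (hn.add (.const 2)) hn (fun _ _ => ord_lt _ _ _)
    (h.reindex fun _ => Sum.inr ∘ Sum.inl) hk

theorem hash (hn : PBound sz n) {a : ∀ j ω, 𝒢.Grp (n j) (ρ j ω)}
    (ha : PDet sz O x (fun j ω => 𝒢.elem (a j ω))) :
    PDet sz O x (fun j ω => hashElem (O j ω) (a j ω)) :=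
  query (.of_polyBounded 𝒢.elemLen_poly hn) ha

theorem powVal (hn : PBound sz n) (h : PDet sz O x (fun j ω => 𝒢.params (n j) (ρ j ω)))
    {a : ∀ j ω, 𝒢.Grp (n j) (ρ j ω)} {k : ∀ j ω, ZMod (𝒢.ord (n j) (ρ j ω))}
    (ha : PDet sz O x (fun j ω => 𝒢.elem (a j ω)))
    (hk : PDet sz O x (fun j ω => encNat (n j + 2) (k j ω).val)) :
    PDet sz O x (fun j ω => 𝒢.elem (a j ω ^ (k j ω).val)) :=
  pow hn h.desc ha (fun _ _ => (ZMod.val_lt _).trans (ord_lt _ _ _)) hk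

theorem bxor (hn : PBound sz n) (hσ : PolyBounded σ) {u u' : ∀ j, Ω j → Bits (σ (n j))}
    (h : PDet sz O x u) (h' : PDet sz O x u') :
    PDet sz O x (fun j ω => bxor (u j ω) (u' j ω)) :=
  bitwise (by simpa only [Fintype.card_fin] using PBound.of_polyBounded hσ hn) Bool.xor h h'

theorem elemIte (hn : PBound sz n) {b : ∀ j, Ω j → Bool} {a a' : ∀ j ω, 𝒢.Grp (n j) (ρ j ω)}
    (hb : PDet sz O x (fun j ω (_ : Unit) => b j ω))
    (h : PDet sz O x (fun j ω => 𝒢.elem (a j ω))) (h' : PDet sz O x (fun j ω => 𝒢.elem (a' j ω))) :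
    PDet sz O x (fun j ω => 𝒢.elem (if b j ω then a j ω else a' j ω)) :=
  (ite (by simpa only [Fintype.card_fin] using PBound.of_polyBounded 𝒢.elemLen_poly hn)
    hb h h').congr fun j ω k => by split_ifs <;> rfl

theorem viewSOf (hn : PBound sz n) (hz : PBound sz z) {m : ∀ j, Ω j → Database (σ (n j)) (z j)}
    {β : ∀ j ω, Bool → 𝒢.Grp (n j) (ρ j ω)}
    {y : ∀ j ω, Fin (z j) × Bool → ZMod (𝒢.ord (n j) (ρ j ω))}
    (hm : PDet sz O x (fun j ω => encDatabase (m j ω))) (hρ : PDet sz O x ρ)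
    (hβ : ∀ b, PDet sz O x (fun j ω => 𝒢.elem (β j ω b)))
    (hy : PDet (J := Σ j, Fin (z j) × Bool) (fun a => sz a.1) (fun a => O a.1) (fun a => x a.1)
      (fun a ω => encNat (n a.1 + 2) (y a.1 ω a.2).val)) :
    PDet sz O x (fun j ω => viewSOf (m j ω) (ρ j ω) (β j ω) (y j ω)) := by
  have hI : PBound sz fun j => Fintype.card (Fin (z j) × Bool) := by
    simpa only [Fintype.card_prod, Fintype.card_fin, Fintype.card_bool] using hz.mul (.const 2)
  have hp := params hn hρ
  have hy' : PDet sz O x fun j ω (i : Fin (z j) × Bool × Fin (n j + 2)) =>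
      encNat (n j + 2) (y j ω (i.1, i.2.1)).val i.2.2 :=
    (pi (v := fun j i ω => encNat (n j + 2) (y j ω i).val) hI hy).reindex
      fun j (i : Fin (z j) × Bool × Fin (n j + 2)) => ((i.1, i.2.1), i.2.2)
  exact hm.elim (hρ.elim ((hp.elim (mul hn hp.desc (hβ false) (hβ true))).elim
    (hy'.elim (bool (v := fun j b ω => 𝒢.elem (β j ω b)) hβ))))

theorem viewP1Of (hn : PBound sz n) (hz : PBound sz z) {v : ∀ j, Ω j → Fin (z j)}
    {β : ∀ j ω, Bool → 𝒢.Grp (n j) (ρ j ω)} {c : ∀ j, Ω j → Bool}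
    {r : ∀ j ω, ZMod (𝒢.ord (n j) (ρ j ω))}
    {e : ∀ j ω, Fin (z j) → Bool → 𝒢.Grp (n j) (ρ j ω) × Bits (σ (n j))}
    (hv : PDet sz O x (fun j ω => encIndex (v j ω)))
    (hp : PDet sz O x (fun j ω => 𝒢.params (n j) (ρ j ω)))
    (hβ : ∀ b, PDet sz O x (fun j ω => 𝒢.elem (β j ω b)))
    (hc : PDet sz O x (fun j ω (_ : Unit) => c j ω))
    (hr : PDet sz O x (fun j ω => encNat (n j + 2) (r j ω).val))
    (he : PDet (J := Σ j, Fin (z j) × Bool) (fun a => sz a.1) (fun a => O a.1) (fun a => x a.1)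
      (fun a ω => Sum.elim (𝒢.elem (e a.1 ω a.2.1 a.2.2).1) (e a.1 ω a.2.1 a.2.2).2)) :
    PDet sz O x (fun j ω => viewP1Of (v j ω) (ρ j ω) (β j ω) (c j ω) (r j ω) (e j ω)) := by
  have hI : PBound sz fun j => Fintype.card (Fin (z j) × Bool) := by
    simpa only [Fintype.card_prod, Fintype.card_fin, Fintype.card_bool] using hz.mul (.const 2)
  have he' : PDet sz O x fun j ω (i : Option (Fin (z j) × Transcript.PairWires 𝒢 σ (n j))) =>
      i.elim true fun i => Transcript.encPair (e j ω i.1) i.2 :=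
    (((const (κ := fun _ => Unit) fun _ _ => true).elim (pi (v := fun j i ω =>
      Sum.elim (𝒢.elem (e j ω i.1 i.2).1) (e j ω i.1 i.2).2) hI he)).reindex
      fun j (i : Option (Fin (z j) × Transcript.PairWires 𝒢 σ (n j))) =>
        i.elim (Sum.inl ()) fun i => Sum.inr ((i.1, i.2.1), i.2.2)).congr fun j ω i => by
          rcases i with _ | i <;> rfl
  have hβc : PDet sz O x (fun j ω => 𝒢.elem (β j ω (c j ω))) :=
    (elemIte hn hc (hβ true) (hβ false)).congr fun j ω k => by cases c j ω <;> rfl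
  have hβc' : PDet sz O x (fun j ω => 𝒢.elem (β j ω (!c j ω))) :=
    (elemIte hn hc (hβ false) (hβ true)).congr fun j ω k => by cases c j ω <;> rfl
  have hδ : PDet sz O x (fun j ω (i : Bool × Fin (𝒢.elemLen (n j))) =>
      𝒢.elem (if i.1 then β j ω (!c j ω) * GroupGen.exp (ρ j ω) (r j ω) else
        β j ω (c j ω) / GroupGen.exp (ρ j ω) (r j ω)) i.2) := by
    refine bool (v := fun j b ω => 𝒢.elem (if b then β j ω (!c j ω) * GroupGen.exp (ρ j ω) (r j ω)
      else β j ω (c j ω) / GroupGen.exp (ρ j ω) (r j ω))) fun b => ?_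
    cases b
    · exact div hn hp.desc hβc (exp hn hp hr)
    · exact mul hn hp.desc hβc' (exp hn hp hr)
  exact hv.elim ((hp.elim (mul hn hp.desc (hβ false) (hβ true))).elim
    ((hc.elim hr).elim (hδ.elim he')))

theorem viewP2Of {C : ∀ j ω, 𝒢.Grp (n j) (ρ j ω)} {c : ∀ j, Ω j → Bool}
    {r : ∀ j ω, ZMod (𝒢.ord (n j) (ρ j ω))}
    (hp : PDet sz O x (fun j ω => 𝒢.params (n j) (ρ j ω)))
    (hC : PDet sz O x (fun j ω => 𝒢.elem (C j ω)))
    (hc : PDet sz O x (fun j ω (_ : Unit) => c j ω))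
    (hr : PDet sz O x (fun j ω => encNat (n j + 2) (r j ω).val)) :
    PDet sz O x (fun j ω => viewP2Of (σ := σ) (ρ j ω) (C j ω) (c j ω) (r j ω)) :=
  (hp.elim hC).elim (hc.elim hr)

theorem viewROf (hn : PBound sz n) (hσ : PolyBounded σ) {s c : ∀ j, Ω j → Bool}
    {ms : ∀ j, Ω j → Bits (σ (n j))} {A : ∀ j ω, 𝒢.Grp (n j) (ρ j ω)}
    {w : ∀ j ω, 𝒢.Grp (n j) (ρ j ω) × Bits (σ (n j))} {r₁ r₂ y : ∀ j ω, ZMod (𝒢.ord (n j) (ρ j ω))}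
    (hs : PDet sz O x (fun j ω (_ : Unit) => s j ω)) (hms : PDet sz O x ms)
    (hp : PDet sz O x (fun j ω => 𝒢.params (n j) (ρ j ω)))
    (hA : PDet sz O x (fun j ω => 𝒢.elem (A j ω)))
    (hw : PDet sz O x (fun j ω => 𝒢.elem (w j ω).1)) (hw' : PDet sz O x (fun j ω => (w j ω).2))
    (hc : PDet sz O x (fun j ω (_ : Unit) => c j ω))
    (hr₁ : PDet sz O x (fun j ω => encNat (n j + 2) (r₁ j ω).val))
    (hr₂ : PDet sz O x (fun j ω => encNat (n j + 2) (r₂ j ω).val))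
    (hy : PDet sz O x (fun j ω => encNat (n j + 2) (y j ω).val)) :
    PDet sz O x (fun j ω => viewROf (O j ω) (s j ω) (ms j ω) (ρ j ω) (A j ω) (w j ω) (c j ω)
      (r₁ j ω) (r₂ j ω) (y j ω)) := by
  have hcs : PDet sz O x (fun j ω (_ : Unit) => xor (c j ω) (s j ω)) :=
    bitwise (by simpa only [Fintype.card_unit] using PBound.const 1) Bool.xor hc hs
  have hX : PDet sz O x (fun j ω =>
      𝒢.elem (ownElem (ρ j ω) (s j ω) (c j ω) (r₁ j ω) (r₂ j ω))) :=
    elemIte hn hcs (div hn hp.desc (exp hn hp hr₂) (exp hn hp hr₁))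
      (mul hn hp.desc (exp hn hp hr₂) (exp hn hp hr₁))
  -- The mask of the chosen message is computed with an oracle gate, so the simulated ciphertext is
  -- consistent with the oracle that the distinguisher queries.
  have he := (exp hn hp hy).elim (bxor hn hσ (hash hn (powVal hn hp hX hy)) hms)
  have hcard : PBound sz fun j => Fintype.card (Fin (𝒢.elemLen (n j)) ⊕ Fin (σ (n j))) := by
    simpa only [Fintype.card_sum, Fintype.card_fin] using
      (PBound.of_polyBounded 𝒢.elemLen_poly hn).add (.of_polyBounded hσ hn)
  have hpair : PDet sz O x (fun j ω => Transcript.encPair fun b => if xor b (s j ω) then w j ω else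
      (GroupGen.exp (ρ j ω) (y j ω), DQMROT.bxor (hashElem (O j ω)
        (ownElem (ρ j ω) (s j ω) (c j ω) (r₁ j ω) (r₂ j ω) ^ (y j ω).val)) (ms j ω))) := by
    refine bool (v := fun j b ω => Sum.elim
      (𝒢.elem (if xor b (s j ω) then w j ω else (GroupGen.exp (ρ j ω) (y j ω),
        DQMROT.bxor (hashElem (O j ω)
          (ownElem (ρ j ω) (s j ω) (c j ω) (r₁ j ω) (r₂ j ω) ^ (y j ω).val)) (ms j ω))).1)
      (if xor b (s j ω) then w j ω else (GroupGen.exp (ρ j ω) (y j ω),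
        DQMROT.bxor (hashElem (O j ω)
          (ownElem (ρ j ω) (s j ω) (c j ω) (r₁ j ω) (r₂ j ω) ^ (y j ω).val)) (ms j ω))).2)
      fun b => ?_
    cases b
    · exact (ite hcard hs (hw.elim hw') he).congr fun j ω k => by
        cases s j ω <;> rfl
    · exact (ite hcard hs he (hw.elim hw')).congr fun j ω k => by
        cases s j ω <;> rfl
  have hopt : ∀ {κ : J → Type} {u : ∀ j, Ω j → κ j → Bool}, PDet sz O x u →
      PDet sz O x (fun j ω (i : Option (κ j)) => i.elim true (u j ω)) := fun {κ u} h =>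
    (((const (κ := fun _ => Unit) fun _ _ => true).elim h).reindex
      fun j (i : Option (κ j)) => i.elim (Sum.inl ()) Sum.inr).congr fun j ω i => by
        rcases i with _ | i <;> rfl
  exact hs.elim ((hc.elim hr₁).elim ((hcs.elim hr₂).elim
    ((hp.elim (mul hn hp.desc hA hX)).elim ((hopt hpair).elim (hopt hms)))))

end PDet

/-! ### Simulated and real randomness -/

section Coins

variable {𝒢 : GroupGen} {n c : ℕ} {ρ : Bits (𝒢.coinLen n)} {X : Type}

/-- The coins for one sample by rejection. -/
abbrev SampWires (n : ℕ) : Type := Fin n × Fin (n + 2)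

/-- Candidates have `n + 2` bits; from `2 ^ n ≤ 2 * p` one gets `2 ^ (n + 2) ≤ 8 * p`, and `n`
rounds make the error negligible. -/
theorem close_samp_ord : Close (sampError n)
    ((PMF.uniformOfFintype (SampWires n → Bool)).map (samp (𝒢.ord n ρ)))
    (PMF.uniformOfFintype (ZMod (𝒢.ord n ρ))) := by
  refine close_samp (PDet.ord_lt 𝒢 n ρ).le ?_ n
  have : 2 ^ n ≤ 2 * 𝒢.ord n ρ := 𝒢.le_card n ρ
  rw [pow_add]
  omega

/-- The factor counts the samples still to be exchanged. Applied along nested binds, the lemma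
builds totals of the shape `0 + 1 + 1`. -/
theorem close_bind_samp {F : (SampWires n → Bool) → PMF X} {G : ZMod (𝒢.ord n ρ) → PMF X}
    (h : ∀ k, Close ((c : ℕ) * sampError n) (F k) (G (samp (𝒢.ord n ρ) k))) :
    Close ((c + 1 : ℕ) * sampError n) ((PMF.uniformOfFintype (SampWires n → Bool)).bind F)
      ((PMF.uniformOfFintype (ZMod (𝒢.ord n ρ))).bind G) := by
  have h1 := Close.bind (F := G) (G := G) (close_samp_ord (𝒢 := 𝒢) (ρ := ρ)) fun a => Close.refl _
  rw [PMF.bind_map] at h1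
  refine ((Close.bind_right _ h).trans h1).mono (le_of_eq ?_)
  push_cast
  ring

theorem close_bind_samp_pi {I : Type} [Fintype I] [DecidableEq I]
    {F : (I × SampWires n → Bool) → PMF X} {G : (I → ZMod (𝒢.ord n ρ)) → PMF X}
    (h : ∀ k, Close ((c : ℕ) * sampError n) (F k)
      (G fun i => samp (𝒢.ord n ρ) fun a => k (i, a))) :
    Close ((c + Fintype.card I : ℕ) * sampError n)
      ((PMF.uniformOfFintype (I × SampWires n → Bool)).bind F)
      ((PMF.uniformOfFintype (I → ZMod (𝒢.ord n ρ))).bind G) := by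
  have h0 := Close.pi _ (close_samp_ord (𝒢 := 𝒢) (ρ := ρ)) I
  rw [← uniform_map_uncurry, PMF.map_comp] at h0
  have h1 := Close.bind (F := G) (G := G) h0 fun a => Close.refl _
  rw [PMF.bind_map] at h1
  refine ((Close.bind_right _ h).trans h1).mono (le_of_eq ?_)
  push_cast
  ring

theorem close_bind_unit {ε : ℝ≥0∞} {F : (Unit → Bool) → PMF X} {G : Bool → PMF X}
    (h : ∀ b, Close ε (F fun _ => b) (G b)) :
    Close ε ((PMF.uniformOfFintype (Unit → Bool)).bind F)
      ((PMF.uniformOfFintype Bool).bind G) := by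
  rw [uniform_bind_equiv (Equiv.funUnique Unit Bool).symm]
  exact Close.bind_right _ h

theorem close_bind_curry {ε : ℝ≥0∞} {I K : Type} [Fintype I] [DecidableEq I] [Fintype K]
    [DecidableEq K] {F : (I × K → Bool) → PMF X} {G : (I → K → Bool) → PMF X}
    (h : ∀ k, Close ε (F k) (G fun i j => k (i, j))) :
    Close ε ((PMF.uniformOfFintype (I × K → Bool)).bind F)
      ((PMF.uniformOfFintype (I → K → Bool)).bind G) := by
  rw [← uniform_map_uncurry, PMF.bind_map]
  exact Close.bind_right _ h

theorem close_of_eq {P Q : PMF X} (h : P = Q) : Close ((0 : ℕ) * sampError n) P Q :=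
  (Close.of_eq h).mono zero_le

end Coins

theorem mul_sampError_ne_top (c n : ℕ) : (c : ℝ≥0∞) * sampError n ≠ ∞ :=
  ENNReal.mul_ne_top (ENNReal.natCast_ne_top _) (sampError_ne_top _)

theorem negligible_mul_sampError {c : ℕ → ℕ} (hc : PolyBounded c) :
    Negligible fun n => ((c n : ℝ≥0∞) * sampError n).toReal := by
  simp only [ENNReal.toReal_mul, ENNReal.toReal_natCast]
  exact Negligible.polyBounded_mul hc negligible_sampError fun _ => ENNReal.toReal_nonneg

theorem CompIndist.of_close_samp {σ : ℕ → ℕ} {ι : ℕ → Type}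
    {X Y : ∀ n, Oracle (σ n) → PMF (ι n → Bool)} {c : ℕ → ℕ} (hc : PolyBounded c)
    (h : ∀ n H, Close ((c n : ℕ) * sampError n) (X n H) (Y n H)) : CompIndist X Y :=
  .of_close (fun _ => mul_sampError_ne_top _ _) (negligible_mul_sampError hc) h

theorem PBound.sampWires {J : Type} {sz n : J → ℕ} (hn : PBound sz n) :
    PBound sz fun j => Fintype.card (SampWires (n j)) := by
  simpa only [Fintype.card_prod, Fintype.card_fin] using hn.mul (hn.add (.const 2))

theorem PBound.pullback {J J' : Type} {sz f : J → ℕ} (φ : J' → J) (h : PBound sz f) :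
    PBound (fun j => sz (φ j)) fun j => f (φ j) := by
  obtain ⟨P, hP⟩ := h
  exact ⟨P, fun j => hP (φ j)⟩

theorem PBound.fst : PBound (fun j : ℕ × ℕ => j.1 + j.2) fun j => j.1 :=
  self.mono fun _ => Nat.le_add_right _ _

theorem PBound.snd : PBound (fun j : ℕ × ℕ => j.1 + j.2) fun j => j.2 :=
  self.mono fun _ => Nat.le_add_left _ _

/-! ### Simulators for the sender and the second proxy -/

section Simulators

set_option synthInstance.maxSize 2000

variable (𝒢 : GroupGen) (σ : ℕ → ℕ)

/-- The coins of the simulator for the sender. -/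
abbrev SenderCoins (n z : ℕ) : Type :=
  Fin (𝒢.coinLen n) ⊕ (Bool × SampWires n) ⊕ ((Fin z × Bool) × SampWires n)

/-- The generator's coins belong to the view, so `ρ` is tossed directly; only the exponents need
rejection sampling. The index is the pair `(n, z)` and the bound is polynomial in its sum. -/
theorem exists_sender_circuits :
    ∃ C : ∀ j : ℕ × ℕ, Circuit (σ j.1) ((protocol 𝒢 σ).WiresS j.1 j.2)
        (Fin j.2 × Bool × Fin (σ j.1)),
      PBound (fun j : ℕ × ℕ => j.1 + j.2) (fun j => (C j).size) ∧
      ∀ j (ω : Database (σ j.1) j.2 × Oracle (σ j.1)), (C j).eval ω.2 (encDatabase ω.1) =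
        (PMF.uniformOfFintype (SenderCoins 𝒢 j.1 j.2 → Bool)).map fun w =>
          viewSOf (𝒢 := 𝒢) ω.1 (fun k => w (Sum.inl k))
            (fun b => exp _ (samp _ fun k => w (Sum.inr (Sum.inl (b, k)))))
            (fun t => samp _ fun k => w (Sum.inr (Sum.inr (t, k)))) := by
  refine PDet.exists_circuits (K := fun j : ℕ × ℕ => SenderCoins 𝒢 j.1 j.2)
    (O := fun j (ω : Database (σ j.1) j.2 × Oracle (σ j.1)) => ω.2)
    (x := fun j ω => encDatabase ω.1) ?_ ?_
  · simp only [Fintype.card_sum, Fintype.card_prod (Fin _ × Bool), Fintype.card_prod Bool,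
      Fintype.card_prod _ Bool, Fintype.card_bool, Fintype.card_fin (𝒢.coinLen _),
      Fintype.card_fin (Prod.snd _)]
    have h := PBound.sampWires PBound.fst
    exact (PBound.of_polyBounded 𝒢.coinLen_poly .fst).add
      (((PBound.const 2).mul h).add ((PBound.snd.mul (.const 2)).mul h))
  · have hρ : PDet (fun j : ℕ × ℕ => j.1 + j.2)
        (fun j (ω : (Database (σ j.1) j.2 × Oracle (σ j.1)) × (SenderCoins 𝒢 j.1 j.2 → Bool)) =>
          ω.1.2) (fun j ω => Sum.elim (encDatabase ω.1.1) ω.2) (fun j ω k => ω.2 (Sum.inl k)) :=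
      PDet.select fun j k => Sum.inr (Sum.inl k)
    have hp := PDet.params PBound.fst hρ
    refine PDet.viewSOf PBound.fst PBound.snd (PDet.select fun j => Sum.inl) hρ (fun b => ?_) ?_
    · exact PDet.exp PBound.fst hp (PDet.samp PBound.fst hp
        (PDet.select fun j k => Sum.inr (Sum.inr (Sum.inl (b, k)))))
    · exact PDet.samp (J := Σ j : ℕ × ℕ, Fin j.2 × Bool) (n := fun j => j.1.1)
        (PBound.fst.pullback Sigma.fst) (hp.pullback Sigma.fst) (PDet.select
          fun (j : Σ j : ℕ × ℕ, Fin j.2 × Bool) k => Sum.inr (Sum.inr (Sum.inr (j.2, k))))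

/-- There are `2 z + 2` sampled residues: the exponents `y` and the logarithms of `β₀` and `β₁`.
Everything else is distributed identically. -/
theorem close_sender {n z : ℕ} (m : Database (σ n) z) (v : Fin z) (s : Bool) (H : Oracle (σ n)) :
    Close ((0 + Fintype.card (Fin z × Bool) + Fintype.card Bool : ℕ) * sampError n)
      ((PMF.uniformOfFintype (SenderCoins 𝒢 n z → Bool)).map fun w =>
        viewSOf (𝒢 := 𝒢) m (fun k => w (Sum.inl k))
          (fun b => exp _ (samp _ fun k => w (Sum.inr (Sum.inl (b, k)))))
          (fun t => samp _ fun k => w (Sum.inr (Sum.inr (t, k)))))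
      ((protocol 𝒢 σ).viewS n m v s H) := by
  rw [viewS_eq, PMF.map]
  simp only [uniform_bind_sumElim]
  refine Close.bind_right _ fun ρ => ?_
  refine close_bind_samp_pi fun b => ?_
  refine close_bind_samp_pi fun y => ?_
  exact close_of_eq rfl

theorem exists_sim_sender : ∃ Sim : (n z : ℕ) → Circuit (σ n) ((protocol 𝒢 σ).WiresS n z)
      (Fin z × Bool × Fin (σ n)),
    PolyBounded₂ (fun n z => (Sim n z).size) ∧
    ∀ x : Inputs σ, CompIndist
      (fun n H => (Sim n (x.z n)).eval H (encDatabase (x.m n)))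
      (fun n H => (protocol 𝒢 σ).viewS n (x.m n) (x.v n) (x.s n) H) := by
  obtain ⟨C, ⟨P, hP⟩, hC⟩ := exists_sender_circuits 𝒢 σ
  refine ⟨fun n z => C (n, z), ⟨P, fun n z => hP (n, z)⟩, fun x => ?_⟩
  refine .of_close_samp (c := fun n => 0 + Fintype.card (Fin (x.z n) × Bool) + Fintype.card Bool)
    ?_ fun n H => ?_
  · obtain ⟨Q, hQ⟩ := x.z_poly
    refine ⟨Q * 2 + 2, fun n => ?_⟩
    simpa using hQ n
  · rw [hC (n, x.z n) (x.m n, H)]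
    exact close_sender 𝒢 σ (x.m n) (x.v n) (x.s n) H

/-- The view is statistically close to the sampled one for every oracle; the two inexact samples are
the logarithm of `C` and the exponent in the request. -/
theorem exists_sim_proxy2 : ∃ Sim : (n : ℕ) → Circuit (σ n) ((protocol 𝒢 σ).WiresP2 n) Empty,
    PolyBounded (fun n => (Sim n).size) ∧
    ∀ x : Inputs σ, CompIndist
      (fun n H => (Sim n).eval H Empty.elim)
      (fun n H => (protocol 𝒢 σ).viewP2 n (x.m n) (x.v n) (x.s n) H) := by
  let K : ℕ → Type := fun n => Fin (𝒢.coinLen n) ⊕ SampWires n ⊕ Unit ⊕ SampWires n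
  let V : ∀ n, Oracle (σ n) → (K n → Bool) → (protocol 𝒢 σ).WiresP2 n → Bool := fun n _ w =>
    viewP2Of (𝒢 := 𝒢) (fun k => w (Sum.inl k)) (exp _ (samp _ fun k => w (Sum.inr (Sum.inl k))))
      (w (Sum.inr (Sum.inr (Sum.inl ())))) (samp _ fun k => w (Sum.inr (Sum.inr (Sum.inr k))))
  have hn : PBound (fun n : ℕ => n) fun n => n := .self
  obtain ⟨C, ⟨P, hP⟩, hC⟩ := PDet.exists_circuits (sz := fun n : ℕ => n) (K := K)
    (ι := fun _ => Empty) (Ω := fun n => Oracle (σ n)) (O := fun n H => H)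
    (x := fun n H => Empty.elim) (v := V) (by
      simp only [K, Fintype.card_sum, Fintype.card_unit]
      exact ((PBound.of_polyBounded 𝒢.coinLen_poly hn).mono fun _ => (Fintype.card_fin _).le).add
        (hn.sampWires.add ((PBound.const 1).add hn.sampWires))) (by
      have hρ : PDet (fun n : ℕ => n) (fun n (ω : Oracle (σ n) × (K n → Bool)) => ω.1)
          (fun n ω => Sum.elim Empty.elim ω.2) (fun n ω k => ω.2 (Sum.inl k)) :=
        PDet.select fun n k => Sum.inr (Sum.inl k)
      have hp := PDet.params hn hρ
      exact PDet.viewP2Of hp (PDet.exp hn hp (PDet.samp hn hp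
          (PDet.select fun n k => Sum.inr (Sum.inr (Sum.inl k)))))
        (PDet.select fun n k => Sum.inr (Sum.inr (Sum.inr (Sum.inl ()))))
        (PDet.samp hn hp (PDet.select fun n k => Sum.inr (Sum.inr (Sum.inr (Sum.inr k))))))
  refine ⟨C, ⟨P, hP⟩, fun x => .of_close_samp (c := fun _ => 0 + 1 + 1) ⟨2, fun n => by simp⟩
    fun n H => ?_⟩
  rw [hC n H, viewP2_eq, PMF.map]
  simp only [K, uniform_bind_sumElim]
  refine Close.bind_right _ fun ρ => ?_
  refine close_bind_samp fun b => ?_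
  refine close_bind_unit fun c => ?_
  refine close_bind_samp fun r => ?_
  exact close_of_eq rfl

end Simulators

/-- Justifies embedding a challenge: a reduction may draw all values and then overwrite one
coordinate of each function by the uniform challenge without changing the law. -/
theorem uniform_bind_update₂ {A B I I' X : Type} [Fintype A] [Nonempty A] [Fintype B] [Nonempty B]
    [Fintype I] [DecidableEq I] [Fintype I'] [DecidableEq I'] (i : I) (i' : I')
    (F : (I → A) → (I' → B) → PMF X) :
    ((PMF.uniformOfFintype A).bind fun a => (PMF.uniformOfFintype B).bind fun b =>
      (PMF.uniformOfFintype (I → A)).bind fun f => (PMF.uniformOfFintype (I' → B)).bind fun g =>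
      F (Function.update f i a) (Function.update g i' b)) =
    (PMF.uniformOfFintype (I → A)).bind fun f => (PMF.uniformOfFintype (I' → B)).bind fun g =>
      F f g := by
  rw [← uniform_bind_update i]
  congr 1; funext a
  rw [PMF.bind_comm]
  congr 1; funext f
  exact uniform_bind_update i' fun g => F (Function.update f i a) g

theorem uniform_bind_update₃ {A B C I I' X : Type} [Fintype A] [Nonempty A] [Fintype B]
    [Nonempty B] [Fintype C] [Nonempty C] [Fintype I] [DecidableEq I] [Fintype I']
    [DecidableEq I'] (i : I) (i' : I') (F : (I → A) → (I' → B) → (I' → C) → PMF X) :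
    ((PMF.uniformOfFintype A).bind fun a => (PMF.uniformOfFintype B).bind fun b =>
      (PMF.uniformOfFintype C).bind fun c =>
      (PMF.uniformOfFintype (I → A)).bind fun f => (PMF.uniformOfFintype (I' → B)).bind fun g =>
      (PMF.uniformOfFintype (I' → C)).bind fun h =>
      F (Function.update f i a) (Function.update g i' b) (Function.update h i' c)) =
    (PMF.uniformOfFintype (I → A)).bind fun f => (PMF.uniformOfFintype (I' → B)).bind fun g =>
      (PMF.uniformOfFintype (I' → C)).bind fun h => F f g h := by
  rw [← uniform_bind_update₂ i i']
  congr 1; funext a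
  congr 1; funext b
  rw [PMF.bind_comm]
  congr 1; funext f
  rw [PMF.bind_comm]
  congr 1; funext g
  exact uniform_bind_update i' fun h => F (Function.update f i a) (Function.update g i' b) h

/-! ### The hybrid argument for the first proxy -/

section FirstProxy

variable {𝒢 : GroupGen} {σ : ℕ → ℕ} {n z : ℕ}

/-- The view of the first proxy when only the first `k` messages are encrypted by hash values, and
the other ones by the bit strings `u`. -/
def hybridView (m : Database (σ n) z) (v : Fin z) (k : ℕ) (H : Oracle (σ n))
    (ρ : Bits (𝒢.coinLen n)) (b : Bool → ZMod (𝒢.ord n ρ)) (y : Fin z × Bool → ZMod (𝒢.ord n ρ))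
    (u : Fin z × Bool → Bits (σ n)) (c : Bool) (r : ZMod (𝒢.ord n ρ)) :
    (protocol 𝒢 σ).WiresP1 n z → Bool :=
  viewP1Of v ρ (fun i => exp ρ (b i)) c r fun t i => (exp ρ (y (t, i)),
    bxor (if (Fintype.equivFin (Fin z × Bool) (t, i)).val < k then
      hashElem H (exp ρ (b i) ^ (y (t, i)).val) else u (t, i)) (m t i))

variable (𝒢) in
/-- The distribution of the `k`-th hybrid view of the first proxy. -/
def hybridP1 (m : Database (σ n) z) (v : Fin z) (k : ℕ) (H : Oracle (σ n)) :
    PMF ((protocol 𝒢 σ).WiresP1 n z → Bool) :=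
  (PMF.uniformOfFintype (Bits (𝒢.coinLen n))).bind fun ρ =>
  (PMF.uniformOfFintype (Bool → ZMod (𝒢.ord n ρ))).bind fun b =>
  (PMF.uniformOfFintype (Fin z × Bool → ZMod (𝒢.ord n ρ))).bind fun y =>
  (PMF.uniformOfFintype (Fin z × Bool → Bits (σ n))).bind fun u =>
  (PMF.uniformOfFintype Bool).bind fun c =>
  (PMF.uniformOfFintype (ZMod (𝒢.ord n ρ))).bind fun r =>
  PMF.pure (hybridView m v k H ρ b y u c r)

theorem hybridP1_card (m : Database (σ n) z) (v : Fin z) (s : Bool) (H : Oracle (σ n)) :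
    hybridP1 𝒢 m v (Fintype.card (Fin z × Bool)) H = (protocol 𝒢 σ).viewP1 n m v s H := by
  rw [hybridP1, viewP1_eq]
  congr 1; funext ρ
  congr 1; funext b
  congr 1; funext y
  simp only [hybridView, Fin.is_lt, if_true]
  exact PMF.bind_const _ _

/-- One-time pad: adding the fixed database permutes the uniform strings `u`, so the law does not
depend on the messages and can be sampled from `v` and `z`. -/
theorem hybridP1_zero (m : Database (σ n) z) (v : Fin z) (H : Oracle (σ n)) :
    hybridP1 𝒢 m v 0 H =
      (PMF.uniformOfFintype (Bits (𝒢.coinLen n))).bind fun ρ =>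
      (PMF.uniformOfFintype (Bool → ZMod (𝒢.ord n ρ))).bind fun b =>
      (PMF.uniformOfFintype (Fin z × Bool → ZMod (𝒢.ord n ρ))).bind fun y =>
      (PMF.uniformOfFintype (Fin z × Bool → Bits (σ n))).bind fun u =>
      (PMF.uniformOfFintype Bool).bind fun c =>
      (PMF.uniformOfFintype (ZMod (𝒢.ord n ρ))).bind fun r =>
      PMF.pure (viewP1Of v ρ (fun i => exp ρ (b i)) c r fun t i => (exp ρ (y (t, i)), u (t, i))) := by
  unfold hybridP1
  refine congrArg (PMF.bind _) (funext fun ρ => ?_)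
  refine congrArg (PMF.bind _) (funext fun b => ?_)
  refine congrArg (PMF.bind _) (funext fun y => ?_)
  refine ((congrArg (PMF.bind _) (funext fun u => ?_)).trans (uniform_bind_equiv
    (Equiv.piCongrRight fun i : Fin z × Bool => bxorEquiv (m i.1 i.2)) _).symm)
  refine congrArg (PMF.bind _) (funext fun c => ?_)
  refine congrArg (PMF.bind _) (funext fun r => ?_)
  simp only [hybridView, Nat.not_lt_zero, if_false]
  rfl

/-- The hybrids `k` and `k + 1` differ only at the position numbered `k`, where the former reads `u`
and the latter a hash value; putting that hash value into `u` makes them equal. -/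
theorem hybridView_update_real (m : Database (σ n) z) (v : Fin z)
    (k : Fin (Fintype.card (Fin z × Bool))) (H : Oracle (σ n)) (ρ : Bits (𝒢.coinLen n))
    (a₁ a₂ : ZMod (𝒢.ord n ρ)) (b : Bool → ZMod (𝒢.ord n ρ))
    (y : Fin z × Bool → ZMod (𝒢.ord n ρ)) (u : Fin z × Bool → Bits (σ n)) (c : Bool)
    (r : ZMod (𝒢.ord n ρ)) (i : Fin z × Bool) (hi : i = (Fintype.equivFin (Fin z × Bool)).symm k) :
    hybridView m v k H ρ (Function.update b i.2 a₁) (Function.update y i a₂)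
        (Function.update u i (hashElem H (exp ρ (a₁ * a₂)))) c r =
      hybridView m v (k + 1) H ρ (Function.update b i.2 a₁) (Function.update y i a₂) u c r := by
  unfold hybridView
  congr 1
  funext t d
  congr 2
  by_cases htd : (t, d) = i
  · subst htd
    simp [hi, exp_pow]
  · have h : (Fintype.equivFin (Fin z × Bool) (t, d)).val ≠ k := fun h => htd (by
      rw [hi, ← Fin.ext h, Equiv.symm_apply_apply])
    have h' : (Fintype.equivFin (Fin z × Bool) (t, d)).val < k + 1 ↔
        (Fintype.equivFin (Fin z × Bool) (t, d)).val < k := by omega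
    simp only [h', Function.update_of_ne htd]

/-! ### The simulator for the first proxy -/

set_option synthInstance.maxSize 2000

/-- The coins for the view of the first proxy, apart from those of the group generator. -/
abbrev ProxyCoins (σ : ℕ → ℕ) (n z : ℕ) : Type :=
  (Bool × SampWires n) ⊕ ((Fin z × Bool) × SampWires n) ⊕ ((Fin z × Bool) × Fin (σ n)) ⊕
    Unit ⊕ SampWires n

theorem PBound.proxyCoins {J : Type} {sz n z : J → ℕ} (hn : PBound sz n) (hz : PBound sz z)
    (hσ : PolyBounded σ) : PBound sz fun j => Fintype.card (ProxyCoins σ (n j) (z j)) := by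
  have hI : PBound sz fun j => Fintype.card (Fin (z j) × Bool) := by
    simpa only [Fintype.card_prod, Fintype.card_fin, Fintype.card_bool] using hz.mul (.const 2)
  simp only [Fintype.card_sum, Fintype.card_prod (Fin _ × Bool), Fintype.card_prod Bool,
    Fintype.card_bool, Fintype.card_unit]
  exact ((PBound.const 2).mul hn.sampWires).add ((hI.mul hn.sampWires).add
    ((hI.mul ((PBound.of_polyBounded hσ hn).mono fun _ => (Fintype.card_fin _).le)).add
      ((PBound.const 1).add hn.sampWires)))

/-- The exponents `b` that are sampled with the coins `w`. -/
def ProxyCoins.b (ρ : Bits (𝒢.coinLen n)) (w : ProxyCoins σ n z → Bool) :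
    Bool → ZMod (𝒢.ord n ρ) := fun i => samp _ fun k => w (Sum.inl (i, k))

/-- The exponents `y` that are sampled with the coins `w`. -/
def ProxyCoins.y (ρ : Bits (𝒢.coinLen n)) (w : ProxyCoins σ n z → Bool) :
    Fin z × Bool → ZMod (𝒢.ord n ρ) := fun i => samp _ fun k => w (Sum.inr (Sum.inl (i, k)))

/-- The bit strings among the coins `w`. -/
def ProxyCoins.u (w : ProxyCoins σ n z → Bool) : Fin z × Bool → Bits (σ n) := fun i k =>
  w (Sum.inr (Sum.inr (Sum.inl (i, k))))

/-- The single bit among the coins `w`. -/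
def ProxyCoins.c (w : ProxyCoins σ n z → Bool) : Bool :=
  w (Sum.inr (Sum.inr (Sum.inr (Sum.inl ()))))

/-- The exponent `r` that is sampled with the coins `w`. -/
def ProxyCoins.r (ρ : Bits (𝒢.coinLen n)) (w : ProxyCoins σ n z → Bool) : ZMod (𝒢.ord n ρ) :=
  samp _ fun k => w (Sum.inr (Sum.inr (Sum.inr (Sum.inr k))))

/-- The function `F` is arbitrary so that the same estimate covers the simulator and the hybrids
with overwritten coordinates. -/
theorem close_proxyCoins {X : Type} (ρ : Bits (𝒢.coinLen n))
    (F : (Bool → ZMod (𝒢.ord n ρ)) → (Fin z × Bool → ZMod (𝒢.ord n ρ)) →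
      (Fin z × Bool → Bits (σ n)) → Bool → ZMod (𝒢.ord n ρ) → X) :
    Close ((0 + 1 + Fintype.card (Fin z × Bool) + Fintype.card Bool : ℕ) * sampError n)
      ((PMF.uniformOfFintype (ProxyCoins σ n z → Bool)).bind fun w =>
        PMF.pure (F (ProxyCoins.b ρ w) (ProxyCoins.y ρ w) (ProxyCoins.u w) (ProxyCoins.c w)
          (ProxyCoins.r ρ w)))
      ((PMF.uniformOfFintype (Bool → ZMod (𝒢.ord n ρ))).bind fun b =>
        (PMF.uniformOfFintype (Fin z × Bool → ZMod (𝒢.ord n ρ))).bind fun y =>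
        (PMF.uniformOfFintype (Fin z × Bool → Bits (σ n))).bind fun u =>
        (PMF.uniformOfFintype Bool).bind fun c =>
        (PMF.uniformOfFintype (ZMod (𝒢.ord n ρ))).bind fun r => PMF.pure (F b y u c r)) := by
  simp only [uniform_bind_sumElim]
  refine close_bind_samp_pi fun b => ?_
  refine close_bind_samp_pi fun y => ?_
  refine close_bind_curry fun u => ?_
  refine close_bind_unit fun c => ?_
  refine close_bind_samp fun r => ?_
  exact close_of_eq rfl

theorem polyBounded_proxyCoins {z : ℕ → ℕ} (hz : PolyBounded z) :
    PolyBounded fun n => 0 + 1 + Fintype.card (Fin (z n) × Bool) + Fintype.card Bool := by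
  obtain ⟨Q, hQ⟩ := hz
  refine ⟨1 + Q * 2 + 2, fun n => ?_⟩
  simpa using hQ n

variable (𝒢) in
theorem exists_proxy1_circuits (hσ : PolyBounded σ) :
    ∃ C : ∀ j : ℕ × ℕ, Circuit (σ j.1) ((protocol 𝒢 σ).WiresP1 j.1 j.2) (Fin j.2.size),
      PBound (fun j : ℕ × ℕ => j.1 + j.2) (fun j => (C j).size) ∧
      ∀ j (ω : Fin j.2 × Oracle (σ j.1)), (C j).eval ω.2 (encIndex ω.1) =
        (PMF.uniformOfFintype (Fin (𝒢.coinLen j.1) ⊕ ProxyCoins σ j.1 j.2 → Bool)).map fun w =>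
          viewP1Of ω.1 (w ∘ Sum.inl) (fun i => exp _ (ProxyCoins.b _ (w ∘ Sum.inr) i))
            (ProxyCoins.c (w ∘ Sum.inr)) (ProxyCoins.r _ (w ∘ Sum.inr)) fun t i =>
              (exp _ (ProxyCoins.y _ (w ∘ Sum.inr) (t, i)), ProxyCoins.u (w ∘ Sum.inr) (t, i)) := by
  refine PDet.exists_circuits (K := fun j : ℕ × ℕ => Fin (𝒢.coinLen j.1) ⊕ ProxyCoins σ j.1 j.2)
    (O := fun j (ω : Fin j.2 × Oracle (σ j.1)) => ω.2) (x := fun j ω => encIndex ω.1) ?_ ?_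
  · simp only [Fintype.card_sum (α := Fin (𝒢.coinLen _))]
    exact ((PBound.of_polyBounded 𝒢.coinLen_poly .fst).mono fun _ => (Fintype.card_fin _).le).add
      (.proxyCoins .fst .snd hσ)
  · have hρ : PDet (fun j : ℕ × ℕ => j.1 + j.2)
        (fun j (ω : (Fin j.2 × Oracle (σ j.1)) ×
          (Fin (𝒢.coinLen j.1) ⊕ ProxyCoins σ j.1 j.2 → Bool)) => ω.1.2)
        (fun j ω => Sum.elim (encIndex ω.1.1) ω.2) (fun j ω => ω.2 ∘ Sum.inl) :=
      PDet.select fun j k => Sum.inr (Sum.inl k)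
    have hp := PDet.params PBound.fst hρ
    refine PDet.viewP1Of PBound.fst PBound.snd (PDet.select fun j => Sum.inl) hp (fun b => ?_)
      (PDet.select fun j k => Sum.inr (Sum.inr (Sum.inr (Sum.inr (Sum.inr (Sum.inl ()))))))
      (PDet.samp .fst hp (PDet.select
        fun j k => Sum.inr (Sum.inr (Sum.inr (Sum.inr (Sum.inr (Sum.inr k)))))))
      (PDet.elim ?_ (PDet.select fun (j : Σ j : ℕ × ℕ, Fin j.2 × Bool) k =>
        Sum.inr (Sum.inr (Sum.inr (Sum.inr (Sum.inl (j.2, k)))))))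
    · exact PDet.exp .fst hp (PDet.samp .fst hp
        (PDet.select fun j k => Sum.inr (Sum.inr (Sum.inl (b, k)))))
    · have hn : PBound (fun j : Σ j : ℕ × ℕ, Fin j.2 × Bool => j.1.1 + j.1.2) fun j => j.1.1 :=
        PBound.fst.pullback Sigma.fst
      have hp' := hp.pullback (Sigma.fst : (Σ j : ℕ × ℕ, Fin j.2 × Bool) → ℕ × ℕ)
      exact PDet.exp hn hp' (PDet.samp hn hp' (PDet.select
        fun (j : Σ j : ℕ × ℕ, Fin j.2 × Bool) k => Sum.inr (Sum.inr (Sum.inr (Sum.inl (j.2, k))))))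

theorem close_hybridP1_zero (m : Database (σ n) z) (v : Fin z) (H : Oracle (σ n)) :
    Close ((0 + 1 + Fintype.card (Fin z × Bool) + Fintype.card Bool : ℕ) * sampError n)
      ((PMF.uniformOfFintype (Fin (𝒢.coinLen n) ⊕ ProxyCoins σ n z → Bool)).map fun w =>
          viewP1Of v (w ∘ Sum.inl) (fun i => exp _ (ProxyCoins.b _ (w ∘ Sum.inr) i))
            (ProxyCoins.c (w ∘ Sum.inr)) (ProxyCoins.r _ (w ∘ Sum.inr)) fun t i =>
              (exp _ (ProxyCoins.y _ (w ∘ Sum.inr) (t, i)), ProxyCoins.u (w ∘ Sum.inr) (t, i)))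
      (hybridP1 𝒢 m v 0 H) := by
  rw [PMF.map, hybridP1_zero, uniform_bind_sumElim]
  exact Close.bind_right _ fun ρ => close_proxyCoins ρ fun b y u c r =>
    viewP1Of v ρ (fun i => exp ρ (b i)) c r fun t i => (exp ρ (y (t, i)), u (t, i))

/-- The data of an instance of the hashed Diffie-Hellman problem. -/
abbrev HDHData (𝒢 : GroupGen) (σ : ℕ → ℕ) (n : ℕ) : Type :=
  Σ ρ : Bits (𝒢.coinLen n), ZMod (𝒢.ord n ρ) × ZMod (𝒢.ord n ρ) × Bits (σ n)

variable (𝒢) in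
-- The point is that the view is computable from `g ^ a₁`, `g ^ a₂` and the string alone, although
-- the overwritten exponents are unknown. The inputs `m` and `v` are hard-wired, which
-- non-uniformity permits.
theorem exists_hybrid_circuits (hσ : PolyBounded σ) (x : Inputs σ) :
    ∃ C : ∀ j : Σ n, Fin (Fintype.card (Fin (x.z n) × Bool)),
        Circuit (σ j.1) ((protocol 𝒢 σ).WiresP1 j.1 (x.z j.1)) (HDHWires 𝒢 σ j.1),
      PBound (fun j => j.1) (fun j => (C j).size) ∧
      ∀ j (ω : HDHData 𝒢 σ j.1 × Oracle (σ j.1)),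
        (C j).eval ω.2 (hdhInstance ω.1.1 (exp _ ω.1.2.1) (exp _ ω.1.2.2.1) ω.1.2.2.2) =
        (PMF.uniformOfFintype (ProxyCoins σ j.1 (x.z j.1) → Bool)).map fun w =>
          hybridView (x.m j.1) (x.v j.1) j.2 ω.2 ω.1.1
            (Function.update (ProxyCoins.b _ w)
              ((Fintype.equivFin (Fin (x.z j.1) × Bool)).symm j.2).2 ω.1.2.1)
            (Function.update (ProxyCoins.y _ w)
              ((Fintype.equivFin (Fin (x.z j.1) × Bool)).symm j.2) ω.1.2.2.1)
            (Function.update (ProxyCoins.u w)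
              ((Fintype.equivFin (Fin (x.z j.1) × Bool)).symm j.2) ω.1.2.2.2)
            (ProxyCoins.c w) (ProxyCoins.r _ w) := by
  let J : Type := Σ n, Fin (Fintype.card (Fin (x.z n) × Bool))
  let J' : Type := Σ j : J, Fin (x.z j.1) × Bool
  let idx : (j : J) → Fin (x.z j.1) × Bool := fun j => (Fintype.equivFin _).symm j.2
  have hn : PBound (fun j : J => j.1) fun j => j.1 := .self
  have hz : PBound (fun j : J => j.1) fun j => x.z j.1 := .of_polyBounded x.z_poly hn
  have hn' : PBound (fun j : J' => j.1.1) fun j => j.1.1 := .self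
  refine PDet.exists_circuits (J := J) (sz := fun j => j.1)
    (K := fun j : J => ProxyCoins σ j.1 (x.z j.1))
    (O := fun j (ω : HDHData 𝒢 σ j.1 × Oracle (σ j.1)) => ω.2)
    (x := fun j ω => hdhInstance ω.1.1 (exp _ ω.1.2.1) (exp _ ω.1.2.2.1) ω.1.2.2.2)
    (.proxyCoins hn hz hσ) ?_
  set O : ∀ j : J, (HDHData 𝒢 σ j.1 × Oracle (σ j.1)) × (ProxyCoins σ j.1 (x.z j.1) → Bool) →
    Oracle (σ j.1) := fun j ω => ω.1.2
  set X : ∀ j : J, (HDHData 𝒢 σ j.1 × Oracle (σ j.1)) × (ProxyCoins σ j.1 (x.z j.1) → Bool) →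
    HDHWires 𝒢 σ j.1 ⊕ ProxyCoins σ j.1 (x.z j.1) → Bool := fun j ω => Sum.elim
      (hdhInstance ω.1.1.1 (exp _ ω.1.1.2.1) (exp _ ω.1.1.2.2.1) ω.1.1.2.2.2) ω.2
  have hp : PDet (fun j : J => j.1) O X (fun j ω => 𝒢.params j.1 ω.1.1.1) :=
    PDet.select fun j k => Sum.inl (Sum.inl k)
  have hp' := hp.pullback (Sigma.fst : J' → J)
  have hA : PDet (fun j : J => j.1) O X (fun j ω => 𝒢.elem (exp _ ω.1.1.2.1)) :=
    PDet.select fun j k => Sum.inl (Sum.inr (Sum.inl k))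
  have hB : PDet (fun j : J => j.1) O X (fun j ω => 𝒢.elem (exp _ ω.1.1.2.2.1)) :=
    PDet.select fun j k => Sum.inl (Sum.inr (Sum.inr (Sum.inl k)))
  have hu : PDet (fun j : J => j.1) O X (fun j ω => ω.1.1.2.2.2) :=
    PDet.select fun j k => Sum.inl (Sum.inr (Sum.inr (Sum.inr k)))
  -- The element at the bit of the challenged position is the challenge itself; the other has a
  -- sampled exponent. Which case applies depends on the index only, not on the wires.
  have hβ : PDet (J := J') (fun j => j.1.1) (fun j => O j.1) (fun j => X j.1) (fun j ω =>
      𝒢.elem (exp ω.1.1.1 (Function.update (ProxyCoins.b _ ω.2) (idx j.1).2 ω.1.1.2.1 j.2.2))) :=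
    (PDet.cond (fun j : J' => j.2.2 = (idx j.1).2) (hA.pullback Sigma.fst)
      (PDet.exp hn' hp' (PDet.samp hn' hp'
        (PDet.select fun (j : J') k => Sum.inr (Sum.inl (j.2.2, k)))))).congr fun j ω k => by
          by_cases h : j.2.2 = (idx j.1).2
          · rw [if_pos h, h, Function.update_self]
          · rw [if_neg h, Function.update_of_ne h]
            rfl
  have hβ' : ∀ b, PDet (fun j : J => j.1) O X (fun j ω =>
      𝒢.elem (exp ω.1.1.1 (Function.update (ProxyCoins.b _ ω.2) (idx j).2 ω.1.1.2.1 b))) :=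
    fun b => (PDet.cond (fun j : J => b = (idx j).2) hA (PDet.exp hn hp (PDet.samp hn hp
        (PDet.select fun j k => Sum.inr (Sum.inl (b, k)))))).congr fun j ω k => by
          by_cases h : b = (idx j).2
          · rw [if_pos h, h, Function.update_self]
          · rw [if_neg h, Function.update_of_ne h]
            rfl
  have hy : PDet (J := J') (fun j => j.1.1) (fun j => O j.1) (fun j => X j.1) (fun j ω =>
      encNat (j.1.1 + 2) (ProxyCoins.y ω.1.1.1 ω.2 j.2).val) :=
    PDet.samp hn' hp' (PDet.select fun (j : J') k => Sum.inr (Sum.inr (Sum.inl (j.2, k))))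
  have hm : PDet (J := J') (fun j => j.1.1) (fun j => O j.1) (fun j => X j.1) (fun j ω =>
      x.m j.1.1 j.2.1 j.2.2) := PDet.const _
  refine PDet.viewP1Of hn hz (PDet.const _) hp hβ'
    (PDet.select fun j k => Sum.inr (Sum.inr (Sum.inr (Sum.inr (Sum.inl ())))))
    (PDet.samp hn hp (PDet.select fun j k => Sum.inr (Sum.inr (Sum.inr (Sum.inr (Sum.inr k))))))
    -- At the challenged position the ciphertext is the second challenge element with the masked
    -- message. Elsewhere the exponent `y` is known, so `β ^ y` is computable even if `β` is the
    -- first challenge element.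
    ((PDet.cond (fun j : J' => j.2 = idx j.1)
      ((hB.pullback Sigma.fst).elim (PDet.bxor hn' hσ (hu.pullback Sigma.fst) hm))
      ((PDet.exp hn' hp' hy).elim (PDet.bxor hn' hσ
        (PDet.cond (fun j : J' => (Fintype.equivFin (Fin (x.z j.1.1) × Bool) j.2).val < j.1.2)
          (PDet.hash hn' (PDet.powVal hn' hp' hβ hy))
          (PDet.select fun (j : J') k => Sum.inr (Sum.inr (Sum.inr (Sum.inl (j.2, k)))))) hm))).congr
      fun j ω k => ?_)
  by_cases h : j.2 = idx j.1
  · rw [if_pos h]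
    simp only [Prod.mk.eta, h]
    -- The challenged position has number exactly `k`, not less than `k`, so hybrid `k` uses the
    -- string there.
    have h' : ¬(Fintype.equivFin (Fin (x.z j.1.1) × Bool) (idx j.1)).val < j.1.2 := by simp [idx]
    rw [if_neg h']
    simp only [idx, Function.update_self]
  · rw [if_neg h]
    simp only [Prod.mk.eta, idx] at h ⊢
    rw [Function.update_of_ne h, Function.update_of_ne h]
    split_ifs <;> rfl

/-- Only the two exponents have to be overwritten by uniform values: hybrid `k + 1` no longer reads
the string at the challenged position. -/
theorem close_hybridP1_real (m : Database (σ n) z) (v : Fin z)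
    (k : Fin (Fintype.card (Fin z × Bool))) (H : Oracle (σ n)) (i : Fin z × Bool)
    (hi : i = (Fintype.equivFin (Fin z × Bool)).symm k)
    (C : Circuit (σ n) ((protocol 𝒢 σ).WiresP1 n z) (HDHWires 𝒢 σ n))
    (hC : ∀ ω : HDHData 𝒢 σ n,
      C.eval H (hdhInstance ω.1 (exp _ ω.2.1) (exp _ ω.2.2.1) ω.2.2.2) =
        (PMF.uniformOfFintype (ProxyCoins σ n z → Bool)).map fun w =>
          hybridView m v k H ω.1 (Function.update (ProxyCoins.b _ w) i.2 ω.2.1)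
            (Function.update (ProxyCoins.y _ w) i ω.2.2.1)
            (Function.update (ProxyCoins.u w) i ω.2.2.2) (ProxyCoins.c w) (ProxyCoins.r _ w)) :
    Close ((0 + 1 + Fintype.card (Fin z × Bool) + Fintype.card Bool : ℕ) * sampError n)
      (hybridP1 𝒢 m v (k + 1) H) ((hdhReal 𝒢 σ n H).bind fun w => C.eval H w) := by
  refine Close.symm ?_
  simp only [hdhReal, PMF.bind_bind, PMF.pure_bind]
  refine Close.bind_right _ fun ρ => ?_
  rw [← uniform_bind_update₂ i.2 i]
  refine Close.bind_right _ fun a₁ => Close.bind_right _ fun a₂ => ?_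
  refine (Close.of_eq (hC ⟨ρ, a₁, a₂, hashElem H (exp ρ (a₁ * a₂))⟩)).trans ?_ |>.mono
    (zero_add _).le
  simp only [PMF.map, Function.comp_def, hybridView_update_real m v k H ρ _ _ _ _ _ _ _ i hi]
  exact close_proxyCoins ρ fun b y u c r => hybridView m v (k + 1) H ρ
    (Function.update b i.2 a₁) (Function.update y i a₂) u c r

/-- An ideal challenge string is independent of the exponents, so all three overwritten coordinates
are fresh uniform values. -/
theorem close_hybridP1_ideal (m : Database (σ n) z) (v : Fin z) (k : ℕ) (H : Oracle (σ n))
    (i : Fin z × Bool) (C : Circuit (σ n) ((protocol 𝒢 σ).WiresP1 n z) (HDHWires 𝒢 σ n))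
    (hC : ∀ ω : HDHData 𝒢 σ n,
      C.eval H (hdhInstance ω.1 (exp _ ω.2.1) (exp _ ω.2.2.1) ω.2.2.2) =
        (PMF.uniformOfFintype (ProxyCoins σ n z → Bool)).map fun w =>
          hybridView m v k H ω.1 (Function.update (ProxyCoins.b _ w) i.2 ω.2.1)
            (Function.update (ProxyCoins.y _ w) i ω.2.2.1)
            (Function.update (ProxyCoins.u w) i ω.2.2.2) (ProxyCoins.c w) (ProxyCoins.r _ w)) :
    Close ((0 + 1 + Fintype.card (Fin z × Bool) + Fintype.card Bool : ℕ) * sampError n)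
      (hybridP1 𝒢 m v k H) ((hdhIdeal 𝒢 σ n H).bind fun w => C.eval H w) := by
  refine Close.symm ?_
  simp only [hdhIdeal, PMF.bind_bind, PMF.pure_bind]
  refine Close.bind_right _ fun ρ => ?_
  rw [← uniform_bind_update₃ i.2 i]
  refine Close.bind_right _ fun a₁ => Close.bind_right _ fun a₂ => Close.bind_right _ fun u' => ?_
  refine (Close.of_eq (hC ⟨ρ, a₁, a₂, u'⟩)).trans ?_ |>.mono (zero_add _).le
  exact close_proxyCoins ρ fun b y u c r => hybridView m v k H ρ
    (Function.update b i.2 a₁) (Function.update y i a₂) (Function.update u i u') c r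

variable (𝒢) in
theorem exists_sim_proxy1 (hσ : PolyBounded σ) (hCDH : 𝒢.CDHAssumption) :
    ∃ Sim : (n z : ℕ) → Circuit (σ n) ((protocol 𝒢 σ).WiresP1 n z) (Fin z.size),
    PolyBounded₂ (fun n z => (Sim n z).size) ∧
    ∀ x : Inputs σ, CompIndist
      (fun n H => (Sim n (functionality (x.m n) (x.v n) (x.s n)).toP1).eval H (encIndex (x.v n)))
      (fun n H => (protocol 𝒢 σ).viewP1 n (x.m n) (x.v n) (x.s n) H) := by
  obtain ⟨C, ⟨P, hP⟩, hC⟩ := exists_proxy1_circuits 𝒢 hσ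
  refine ⟨fun n z => C (n, z), ⟨P, fun n z => hP (n, z)⟩, fun x => ?_⟩
  have hN : PolyBounded fun n => Fintype.card (Fin (x.z n) × Bool) := by
    obtain ⟨Q, hQ⟩ := x.z_poly
    refine ⟨Q * 2, fun n => ?_⟩
    simpa using hQ n
  obtain ⟨D, hD, hD'⟩ := exists_hybrid_circuits 𝒢 hσ x
  -- There are `2 z` steps, polynomially many; hybrid 0 has only uniform masks, and the last hybrid
  -- is the actual view.
  have h := CompIndist.hybrid (compIndist_hdh hσ hCDH) hN (fun n k => D ⟨n, k⟩) hD
    (fun n k H => hybridP1 𝒢 (x.m n) (x.v n) k H) (fun n => mul_sampError_ne_top _ n)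
    (negligible_mul_sampError (polyBounded_proxyCoins x.z_poly))
    (fun n k H => close_hybridP1_ideal _ _ _ H _ _ fun ω => hD' ⟨n, k⟩ (ω, H))
    (fun n k H => close_hybridP1_real _ _ _ H _ rfl _ fun ω => hD' ⟨n, k⟩ (ω, H))
  rw [show (fun n => (fun n k H => hybridP1 𝒢 (x.m n) (x.v n) k H) n
      (Fintype.card (Fin (x.z n) × Bool))) = _ from funext₂ fun n H =>
        hybridP1_card (x.m n) (x.v n) (x.s n) H] at h
  refine (CompIndist.of_close_samp (polyBounded_proxyCoins x.z_poly) fun n H => ?_).trans h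
  refine (Close.of_eq (hC (n, x.z n) (x.v n, H))).trans ?_ |>.mono (zero_add _).le
  exact close_hybridP1_zero _ _ _

end FirstProxy

/-! ### The simulator for the receiver -/

section Receiver

set_option synthInstance.maxSize 2000

variable {𝒢 : GroupGen} {σ : ℕ → ℕ} {n z : ℕ}

/-- The coins for `c, r₁, r₂, y` in the view of the receiver. -/
abbrev ReceiverCoins (n : ℕ) : Type := Unit ⊕ SampWires n ⊕ SampWires n ⊕ SampWires n

theorem PBound.receiverCoins {J : Type} {sz n : J → ℕ} (hn : PBound sz n) :
    PBound sz fun j => Fintype.card (ReceiverCoins (n j)) := by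
  simp only [Fintype.card_sum, Fintype.card_unit]
  exact (PBound.const 1).add (hn.sampWires.add (hn.sampWires.add hn.sampWires))

/-- The view of the receiver, when `c, r₁, r₂, y` are sampled with the coins `w`. -/
def viewROfCoins (H : Oracle (σ n)) (s : Bool) (ms : Bits (σ n)) (ρ : Bits (𝒢.coinLen n))
    (A : 𝒢.Grp n ρ) (e : 𝒢.Grp n ρ × Bits (σ n)) (w : ReceiverCoins n → Bool) :
    (protocol 𝒢 σ).WiresR n → Bool :=
  viewROf H s ms ρ A e (w (Sum.inl ())) (samp _ fun k => w (Sum.inr (Sum.inl k)))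
    (samp _ fun k => w (Sum.inr (Sum.inr (Sum.inl k))))
    (samp _ fun k => w (Sum.inr (Sum.inr (Sum.inr k))))

/-- The distribution of the view of the receiver, for given `A` and `e`. -/
def viewRLaw (H : Oracle (σ n)) (s : Bool) (ms : Bits (σ n)) (ρ : Bits (𝒢.coinLen n))
    (A : 𝒢.Grp n ρ) (e : 𝒢.Grp n ρ × Bits (σ n)) : PMF ((protocol 𝒢 σ).WiresR n → Bool) :=
  (PMF.uniformOfFintype Bool).bind fun c =>
  (PMF.uniformOfFintype (ZMod (𝒢.ord n ρ))).bind fun r₁ =>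
  (PMF.uniformOfFintype (ZMod (𝒢.ord n ρ))).bind fun r₂ =>
  (PMF.uniformOfFintype (ZMod (𝒢.ord n ρ))).bind fun y =>
  PMF.pure (viewROf H s ms ρ A e c r₁ r₂ y)

theorem close_viewROfCoins (H : Oracle (σ n)) (s : Bool) (ms : Bits (σ n))
    (ρ : Bits (𝒢.coinLen n)) (A : 𝒢.Grp n ρ) (e : 𝒢.Grp n ρ × Bits (σ n)) :
    Close ((0 + 1 + 1 + 1 : ℕ) * sampError n)
      ((PMF.uniformOfFintype (ReceiverCoins n → Bool)).map (viewROfCoins H s ms ρ A e))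
      (viewRLaw H s ms ρ A e) := by
  rw [PMF.map]
  simp only [uniform_bind_sumElim]
  refine close_bind_unit fun c => ?_
  refine close_bind_samp fun r₁ => ?_
  refine close_bind_samp fun r₂ => ?_
  refine close_bind_samp fun y => ?_
  exact close_of_eq rfl

variable (𝒢) in
/-- The distribution of the view of the receiver, but with uniform bits instead of the encryption
of the message that the receiver did not choose. -/
def idealViewR (H : Oracle (σ n)) (s : Bool) (ms : Bits (σ n)) :
    PMF ((protocol 𝒢 σ).WiresR n → Bool) :=
  (PMF.uniformOfFintype (Bits (𝒢.coinLen n))).bind fun ρ =>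
  (PMF.uniformOfFintype (ZMod (𝒢.ord n ρ))).bind fun a =>
  (PMF.uniformOfFintype (ZMod (𝒢.ord n ρ))).bind fun y' =>
  (PMF.uniformOfFintype (Bits (σ n))).bind fun u =>
  viewRLaw H s ms ρ (exp ρ a) (exp ρ y', u)

/-- The coins of the simulator for the receiver. -/
abbrev ReceiverSimCoins (𝒢 : GroupGen) (σ : ℕ → ℕ) (n : ℕ) : Type :=
  Fin (𝒢.coinLen n) ⊕ SampWires n ⊕ SampWires n ⊕ Fin (σ n) ⊕ ReceiverCoins n

theorem PDet.viewROfCoins {J : Type} {sz : J → ℕ} {n : J → ℕ} {Ω ι : J → Type}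
    {O : ∀ j, Ω j → Oracle (σ (n j))} {x : ∀ j, Ω j → ι j → Bool}
    {ρ : ∀ j, Ω j → Bits (𝒢.coinLen (n j))} (hn : PBound sz n) (hσ : PolyBounded σ)
    {s : ∀ j, Ω j → Bool} {ms : ∀ j, Ω j → Bits (σ (n j))} {A : ∀ j ω, 𝒢.Grp (n j) (ρ j ω)}
    {e : ∀ j ω, 𝒢.Grp (n j) (ρ j ω) × Bits (σ (n j))} {w : ∀ j, Ω j → ReceiverCoins (n j) → Bool}
    (hs : PDet sz O x (fun j ω (_ : Unit) => s j ω)) (hms : PDet sz O x ms)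
    (hp : PDet sz O x (fun j ω => 𝒢.params (n j) (ρ j ω)))
    (hA : PDet sz O x (fun j ω => 𝒢.elem (A j ω)))
    (he : PDet sz O x (fun j ω => 𝒢.elem (e j ω).1)) (he' : PDet sz O x (fun j ω => (e j ω).2))
    (hw : PDet sz O x w) :
    PDet sz O x (fun j ω =>
      viewROfCoins (O j ω) (s j ω) (ms j ω) (ρ j ω) (A j ω) (e j ω) (w j ω)) :=
  PDet.viewROf hn hσ hs hms hp hA he he' (hw.reindex fun _ _ => Sum.inl ())
    (PDet.samp hn hp (hw.reindex fun _ k => Sum.inr (Sum.inl k)))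
    (PDet.samp hn hp (hw.reindex fun _ k => Sum.inr (Sum.inr (Sum.inl k))))
    (PDet.samp hn hp (hw.reindex fun _ k => Sum.inr (Sum.inr (Sum.inr k))))

variable (𝒢) in
theorem exists_receiver_circuits (hσ : PolyBounded σ) :
    ∃ C : ∀ n, Circuit (σ n) ((protocol 𝒢 σ).WiresR n) (Unit ⊕ Fin (σ n)),
      PBound (fun n => n) (fun n => (C n).size) ∧
      ∀ n (ω : (Bool × Bits (σ n)) × Oracle (σ n)),
        (C n).eval ω.2 (Sum.elim (fun _ => ω.1.1) ω.1.2) =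
        (PMF.uniformOfFintype (ReceiverSimCoins 𝒢 σ n → Bool)).map fun w =>
          viewROfCoins (𝒢 := 𝒢) ω.2 ω.1.1 ω.1.2 (fun k => w (Sum.inl k))
            (exp _ (samp _ fun k => w (Sum.inr (Sum.inl k))))
            (exp _ (samp _ fun k => w (Sum.inr (Sum.inr (Sum.inl k)))),
              fun k => w (Sum.inr (Sum.inr (Sum.inr (Sum.inl k)))))
            fun k => w (Sum.inr (Sum.inr (Sum.inr (Sum.inr k)))) := by
  have hn : PBound (fun n : ℕ => n) fun n => n := .self
  refine PDet.exists_circuits (K := fun n => ReceiverSimCoins 𝒢 σ n)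
    (O := fun n (ω : (Bool × Bits (σ n)) × Oracle (σ n)) => ω.2)
    (x := fun n ω => Sum.elim (fun _ => ω.1.1) ω.1.2) ?_ ?_
  · have := hn.receiverCoins
    simp only [Fintype.card_sum] at this ⊢
    exact ((PBound.of_polyBounded 𝒢.coinLen_poly hn).mono fun _ => (Fintype.card_fin _).le).add
      (hn.sampWires.add (hn.sampWires.add
        (((PBound.of_polyBounded hσ hn).mono fun _ => (Fintype.card_fin _).le).add this)))
  · have hρ : PDet (fun n : ℕ => n)
        (fun n (ω : ((Bool × Bits (σ n)) × Oracle (σ n)) × (ReceiverSimCoins 𝒢 σ n → Bool)) =>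
          ω.1.2) (fun n ω => Sum.elim (Sum.elim (fun _ : Unit => ω.1.1.1) ω.1.1.2) ω.2)
        (fun n ω k => ω.2 (Sum.inl k)) := PDet.select fun n k => Sum.inr (Sum.inl k)
    have hp := PDet.params hn hρ
    exact PDet.viewROfCoins hn hσ (PDet.select fun n => Sum.inl ∘ Sum.inl)
      (PDet.select fun n => Sum.inl ∘ Sum.inr) hp
      (PDet.exp hn hp (PDet.samp hn hp (PDet.select fun n k => Sum.inr (Sum.inr (Sum.inl k)))))
      (PDet.exp hn hp (PDet.samp hn hp
        (PDet.select fun n k => Sum.inr (Sum.inr (Sum.inr (Sum.inl k))))))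
      (PDet.select fun n k => Sum.inr (Sum.inr (Sum.inr (Sum.inr (Sum.inl k)))))
      (PDet.select fun n k => Sum.inr (Sum.inr (Sum.inr (Sum.inr (Sum.inr k)))))

theorem close_idealViewR (H : Oracle (σ n)) (s : Bool) (ms : Bits (σ n)) :
    Close ((0 + 1 + 1 + 1 + 1 + 1 : ℕ) * sampError n)
      ((PMF.uniformOfFintype (ReceiverSimCoins 𝒢 σ n → Bool)).map fun w =>
          viewROfCoins (𝒢 := 𝒢) H s ms (fun k => w (Sum.inl k))
            (exp _ (samp _ fun k => w (Sum.inr (Sum.inl k))))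
            (exp _ (samp _ fun k => w (Sum.inr (Sum.inr (Sum.inl k)))),
              fun k => w (Sum.inr (Sum.inr (Sum.inr (Sum.inl k)))))
            fun k => w (Sum.inr (Sum.inr (Sum.inr (Sum.inr k)))))
      (idealViewR 𝒢 H s ms) := by
  rw [PMF.map]
  rw [uniform_bind_sumElim]
  refine Close.bind_right _ fun ρ => ?_
  rw [uniform_bind_sumElim]
  refine close_bind_samp fun a => ?_
  rw [uniform_bind_sumElim]
  refine close_bind_samp fun y' => ?_
  rw [uniform_bind_sumElim]
  refine Close.bind_right _ fun u => ?_
  exact close_viewROfCoins H s ms ρ (exp ρ (samp _ a)) (exp ρ (samp _ y'), u)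

variable (𝒢) in
-- The challenge elements stand for `β_{1-s}` and `g ^ y'`, whose logarithms are never used: `C` is
-- the product of the first with `β_s`, and `β_s` comes from the receiver's own coins. The index
-- type `Fin 1` matches the form of `CompIndist.hybrid`.
theorem exists_hybridR_circuits (hσ : PolyBounded σ) (s : ℕ → Bool)
    (ms m' : ∀ n, Bits (σ n)) :
    ∃ C : ∀ j : Σ _ : ℕ, Fin 1, Circuit (σ j.1) ((protocol 𝒢 σ).WiresR j.1) (HDHWires 𝒢 σ j.1),
      PBound (fun j => j.1) (fun j => (C j).size) ∧
      ∀ j (ω : HDHData 𝒢 σ j.1 × Oracle (σ j.1)),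
        (C j).eval ω.2 (hdhInstance ω.1.1 (exp _ ω.1.2.1) (exp _ ω.1.2.2.1) ω.1.2.2.2) =
        (PMF.uniformOfFintype (ReceiverCoins j.1 → Bool)).map
          (viewROfCoins ω.2 (s j.1) (ms j.1) ω.1.1 (exp _ ω.1.2.1)
            (exp _ ω.1.2.2.1, bxor ω.1.2.2.2 (m' j.1))) := by
  have hn : PBound (fun j : Σ _ : ℕ, Fin 1 => j.1) fun j => j.1 := .self
  refine PDet.exists_circuits (J := Σ _ : ℕ, Fin 1) (K := fun j => ReceiverCoins j.1)
    (O := fun j (ω : HDHData 𝒢 σ j.1 × Oracle (σ j.1)) => ω.2)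
    (x := fun j ω => hdhInstance ω.1.1 (exp _ ω.1.2.1) (exp _ ω.1.2.2.1) ω.1.2.2.2)
    hn.receiverCoins ?_
  exact PDet.viewROfCoins hn hσ (PDet.const _) (PDet.const _)
    (PDet.select fun j k => Sum.inl (Sum.inl k))
    (PDet.select fun j k => Sum.inl (Sum.inr (Sum.inl k)))
    (PDet.select fun j k => Sum.inl (Sum.inr (Sum.inr (Sum.inl k))))
    (PDet.bxor hn hσ (PDet.select fun j k => Sum.inl (Sum.inr (Sum.inr (Sum.inr k))))
      (PDet.const _))
    (PDet.select fun j k => Sum.inr k)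

variable (𝒢) in
theorem compIndist_idealViewR (hσ : PolyBounded σ) (hCDH : 𝒢.CDHAssumption) (x : Inputs σ) :
    CompIndist (fun n H => idealViewR 𝒢 H (x.s n) (x.m n (x.v n) (x.s n)))
      (fun n H => (protocol 𝒢 σ).viewR n (x.m n) (x.v n) (x.s n) H) := by
  obtain ⟨C, hC, hC'⟩ := exists_hybridR_circuits 𝒢 hσ x.s
    (fun n => x.m n (x.v n) (x.s n)) (fun n => x.m n (x.v n) (!x.s n))
  refine CompIndist.hybrid (N := fun _ => 1) (ε := fun n => (0 + 1 + 1 + 1 : ℕ) * sampError n)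
    (compIndist_hdh hσ hCDH) ⟨1, fun n => by simp⟩
    -- A hybrid argument of a single step, from the view with a uniform mask to the real one.
    (fun n k => C ⟨n, k⟩) hC (fun n k H => if k = 0 then
      idealViewR 𝒢 H (x.s n) (x.m n (x.v n) (x.s n))
      else (protocol 𝒢 σ).viewR n (x.m n) (x.v n) (x.s n) H)
    (fun n => mul_sampError_ne_top _ n)
    (negligible_mul_sampError (c := fun _ => 0 + 1 + 1 + 1) ⟨3, fun n => by simp⟩)
    (fun n k H => ?_) (fun n k H => ?_)
  · rw [if_pos (by omega)]
    refine Close.symm ?_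
    simp only [hdhIdeal, PMF.bind_bind, PMF.pure_bind]
    refine Close.bind_right _ fun ρ => Close.bind_right _ fun a => Close.bind_right _ fun y' => ?_
    -- The uniform mask absorbs the unknown message `m_{1-s,v}`, which the simulator therefore does
    -- not need.
    refine Close.trans (Close.bind_right _ fun u =>
      (Close.of_eq (hC' ⟨n, k⟩ (⟨ρ, a, y', u⟩, H))).trans (close_viewROfCoins _ _ _ _ _ _))
      (Close.of_eq (uniform_bind_equiv (bxorEquiv (x.m n (x.v n) (!x.s n))) fun u =>
        viewRLaw H (x.s n) (x.m n (x.v n) (x.s n)) ρ (exp ρ a) (exp ρ y', u)).symm) |>.mono ?_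
    rw [zero_add, add_zero]
  · rw [if_neg (by omega), viewR_eq]
    refine Close.symm ?_
    simp only [hdhReal, PMF.bind_bind, PMF.pure_bind]
    refine Close.bind_right _ fun ρ => Close.bind_right _ fun a => Close.bind_right _ fun y' => ?_
    exact ((Close.of_eq (hC' ⟨n, k⟩ (⟨ρ, a, y', hashElem H (exp ρ (a * y'))⟩, H))).trans
      (close_viewROfCoins _ _ _ _ _ _)).mono (zero_add _).le

variable (𝒢) in
theorem exists_sim_receiver (hσ : PolyBounded σ) (hCDH : 𝒢.CDHAssumption) :
    ∃ Sim : (n : ℕ) → Circuit (σ n) ((protocol 𝒢 σ).WiresR n) (Unit ⊕ Fin (σ n)),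
    PolyBounded (fun n => (Sim n).size) ∧
    ∀ x : Inputs σ, CompIndist
      (fun n H => (Sim n).eval H (Sum.elim (fun _ => x.s n)
        (functionality (x.m n) (x.v n) (x.s n)).toR))
      (fun n H => (protocol 𝒢 σ).viewR n (x.m n) (x.v n) (x.s n) H) := by
  obtain ⟨C, ⟨P, hP⟩, hC⟩ := exists_receiver_circuits 𝒢 hσ
  refine ⟨C, ⟨P, hP⟩, fun x => .trans (.of_close_samp (c := fun _ => 0 + 1 + 1 + 1 + 1 + 1)
    ⟨5, fun n => by simp⟩ fun n H => ?_) (compIndist_idealViewR 𝒢 hσ hCDH x)⟩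
  refine (Close.of_eq (hC n ((x.s n, x.m n (x.v n) (x.s n)), H))).trans ?_ |>.mono (zero_add _).le
  exact close_idealViewR _ _ _

end Receiver

end

end DQMROT

theorem mainTheorem5 (𝒢 : DQMROT.GroupGen) (σ : ℕ → ℕ) (hσ : DQMROT.PolyBounded σ)
    (hDL : 𝒢.DLAssumption) (hCDH : 𝒢.CDHAssumption) :
    (DQMROT.protocol 𝒢 σ).SecurelyRealizes :=
  ⟨fun _ _ => DQMROT.outputs_eq, DQMROT.exists_sim_sender 𝒢 σ,
    DQMROT.exists_sim_proxy1 𝒢 hσ hCDH, DQMROT.exists_sim_proxy2 𝒢 σ,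
    DQMROT.exists_sim_receiver 𝒢 hσ hCDH⟩
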